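/- Let $B$ be a real separable Banach space, $\{F_m\}_{m\ge1}\subset B^\star$ functionals with $\|F_m\|=1$ and $\|x\|_B=\sup_m|F_m(x)|$ for all $x\in B$, and let $t_m>0$ with $\sum_m t_m=1$. Let $\widetilde H\supset B$ be the Hilbert space completion of $B$ for $\langle x,y\rangle_{\widetilde H}=\sum_m t_mF_m(x)F_m(y)$; each $F_m$ extends continuously to $\widetilde H$. Put $\|x\|_B=\infty$ for $x\in\widetilde H\setminus B$. Further let $H=\{x\in B:\|x\|_H^2=\sum_mF_m(x)^2<\infty\}$ and $\widetilde H^\star=\{x\in B:\|x\|_{\widetilde H^\star}^2=\sum_mF_m(x)^2/t_m<\infty\}$. Let $X=\{X_n\}_{n\in\mathbb Z}$ be a standard ARB(1) process: the strictly stationary, centred, square-integrable $B$-valued solution of $X_n=\rho(X_{n-1})+\varepsilon_n$, where $\varepsilon$ is i.i.d., centred, with $E\|\varepsilon_0\|_B^2<\infty$, $\rho\in\mathcal L(B)$ and $\|\rho^{j_0}\|_{\mathcal L(B)}<1$ for some $j_0\ge1$. Let $C=E[X_0\otimes X_0]$ and $C_n=\frac1n\sum_{i=0}^{n-1}X_i\otimes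 X_i$ on $\widetilde H$, with $C=\sum_{j\ge1}C_j\,\phi_j\otimes\phi_j$, $C_1\ge C_2\ge\dots>0$, $\{\phi_j\}$ orthonormal in $\widetilde H$, and, for $n\ge2$, a.s. $C_n\phi_{n,j}=C_{n,j}\phi_{n,j}$, where $\{\phi_{n,j}\}_{j\ge1}$ is a complete orthonormal system of $\widetilde H$ and $C_{n,1}\ge\dots\ge C_{n,n}\ge0=C_{n,n+1}=\cdots$. Write $\phi'_{n,j}=\operatorname{sgn}\langle\phi_{n,j},\phi_j\rangle_{\widetilde H}\,\phi_j$ with $\operatorname{sgn}0=1$, and $\Lambda_k=\sup_{1\le j\le k}(C_j-C_{j+1})^{-1}$. Let $\mathcal H(X)=C^{1/2}(\widetilde H)$ be the reproducing kernel Hilbert space of $C$, with $\|f\|_{\mathcal H(X)}^2=\langle C^{-1}f,f\rangle_{\widetilde H}$; $\{\sqrt{C_j}\,\phi_j\}$ is an orthonormal basis of it. Write $\|c\|_{B\times B}=\sup_{l,m}|E[F_l(X_0)F_m(X_0)]|$ and $\|c-c_n\|_{B\times B}=\sup_{l,m}\bigl|E[F_l(X_0)F_m(X_0)]-\frac1n\sum_{i<n}F_l(X_i)F_m(X_i)\bigr|$.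 Let $\|\cdot\|_{\mathcal L}$ and $\|\cdot\|_{\mathcal S}$ be the operator and the Hilbert–Schmidt norm on $\widetilde H$, and $$N=\sup_{m\ge1}\sum_{j\ge1}F_m(\phi_j)^2\in[0,\infty],\qquad V=\sup_{j\ge1}\|\phi_j\|_B\in[0,\infty].$$ Assume: (A1) $\|X_0\|_B$ is a.s. bounded, and the eigenspace of $C$ for each $C_j$ is one-dimensional; (A2) $k_n\ge1$ and $C_{n,k_n}>0$ a.s. for $n\ge2$, $k_n\to\infty$, and $k_n/n\to0$; (A3) $\sup_{\|x\|_B\le1}\bigl\|\rho(x)-\sum_{j=1}^k\langle\rho(x),\phi_j\rangle_{\widetilde H}\phi_j\bigr\|_B\to0$ as $k\to\infty$; (A4) $\mathcal H(X)$ is continuously embedded in $\widetilde H^\star$; (A5) the embedding of $\mathcal H(X)$ into $H$ is Hilbert–Schmidt, that is, $\sum_j\|\sqrt{C_j}\,\phi_j\|_H^2<\infty$; and $C_{k_n}^{-1}\sqrt{k_n}\,\Lambda_{k_n}=o\bigl(\sqrt{n/\ln n}\bigr)$. Then, almost surely, for all sufficiently large $n$, in $[0,\infty]$, $$\sup_{j\le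 k_n}\|\phi_{n,j}-\phi'_{n,j}\|_B\le\frac2{C_{k_n}}\Bigl[\max(N,\sqrt N)\Bigl[\|C-C_n\|_{\mathcal L}+2\max\bigl(\|C\|_{\mathcal L}^{1/2},\|C_n\|_{\mathcal L}^{1/2}\bigr)\sup_{\ell,m\ge1}|F_\ell(\phi'_{n,m})|\Bigl(8k_n\Lambda_{k_n}^2\|C_n-C\|_{\mathcal L}^2+\sum_{m>k_n}\|\phi_{n,m}-\phi'_{n,m}\|_{\widetilde H}^2\Bigr)^{1/2}\Bigr]+\sup_{j\le k_n}\|\phi_{n,j}-\phi'_{n,j}\|_{\widetilde H}\,N\,\|C\|_{\mathcal S}+V\|C-C_n\|_{\mathcal S}\Bigr],$$ and also $$\sup_{j\le k_n}\|\phi_{n,j}-\phi'_{n,j}\|_B\le\frac2{C_{k_n}}\Bigl[\|c-c_n\|_{B\times B}+\sup_{j\le k_n}\|\phi_{n,j}-\phi'_{n,j}\|_{\widetilde H}\,\|c\|_{B\times B}+\sup_{j\le k_n}\|\phi_j\|_B\,\|C-C_n\|_{\mathcal S}\Bigr].$$ Moreover $\sup_{j\le k_n}\|\phi_{n,j}-\phi'_{n,j}\|_B\to0$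 almost surely as $n\to\infty$. -/

import Mathlib

open MeasureTheory ProbabilityTheory Filter Topology Asymptotics
open scoped ENNReal NNReal InnerProductSpace

noncomputable section

/-- A norming sequence `F n` of norm-one functionals on `B`, and positive weights `t n` of sum `1`:
the data from which the Hilbert space of Kuelbs' lemma is built. -/
structure KuelbsSystem (B : Type*) [NormedAddCommGroup B] [NormedSpace ℝ B] where
  F : ℕ → StrongDual ℝ B
  t : ℕ → ℝ
  norm_F : ∀ n, ‖F n‖ = 1
  norming : ∀ x : B, IsLUB (Set.range fun n => |F n x|) ‖x‖
  t_pos : ∀ n, 0 < t n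
  t_sum : HasSum t 1

namespace KuelbsSystem

variable {B : Type*} [NormedAddCommGroup B] [NormedSpace ℝ B] (K : KuelbsSystem B)

theorem abs_F_le (n : ℕ) (x : B) : |K.F n x| ≤ ‖x‖ :=
  (K.norming x).1 ⟨n, rfl⟩

theorem sq_le (x : B) (n : ℕ) : (√(K.t n) * K.F n x) ^ 2 ≤ K.t n * ‖x‖ ^ 2 := by
  rw [mul_pow, Real.sq_sqrt (K.t_pos n).le]
  refine mul_le_mul_of_nonneg_left ?_ (K.t_pos n).le
  rw [← sq_abs]
  exact pow_le_pow_left₀ (abs_nonneg _) (K.abs_F_le n x) 2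

theorem summable_sq (x : B) : Summable fun n => (√(K.t n) * K.F n x) ^ 2 :=
  Summable.of_nonneg_of_le (fun _ => sq_nonneg _) (K.sq_le x) (K.t_sum.summable.mul_right _)

theorem memlp_toL2 (x : B) : Memℓp (fun n => √(K.t n) * K.F n x) 2 := by
  apply memℓp_gen
  simpa only [ENNReal.toReal_ofNat, Real.rpow_ofNat, Real.norm_eq_abs, sq_abs] using
    K.summable_sq x

/-- The map `x ↦ (√(t n) F n x)_n` from `B` to `ℓ²`; the pull-back of the inner product of `ℓ²` is
`(x, y) ↦ ∑ n, t n * F n x * F n y`. -/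
def toL2 : B →L[ℝ] lp (fun _ : ℕ => ℝ) 2 :=
  LinearMap.mkContinuous
    { toFun := fun x => ⟨fun n => √(K.t n) * K.F n x, K.memlp_toL2 x⟩
      map_add' := fun x y => by
        ext n
        simp only [map_add, mul_add]
        rfl
      map_smul' := fun a x => by
        ext n
        exact (congrArg _ (map_smul (K.F n) a x)).trans (mul_left_comm _ _ _) } 1
    (fun x => by
      rw [one_mul]
      refine abs_le_of_sq_le_sq' ?_ (norm_nonneg x) |>.2
      have h := lp.norm_rpow_eq_tsum (p := 2) (by norm_num)
        (⟨fun n => √(K.t n) * K.F n x, K.memlp_toL2 x⟩ : lp (fun _ : ℕ => ℝ) 2)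
      simp only [ENNReal.toReal_ofNat, Real.rpow_ofNat, Real.norm_eq_abs, sq_abs] at h
      refine h.trans_le ?_
      have h2 := (K.summable_sq x).tsum_le_tsum (K.sq_le x) (K.t_sum.summable.mul_right _)
      refine h2.trans ?_
      rw [tsum_mul_right, K.t_sum.tsum_eq, one_mul])

/-- The Hilbert space of Kuelbs' lemma: the completion of `B` for the inner product
`(x, y) ↦ ∑ n, t n * F n x * F n y`, realised as the closure of the image of `B` in `ℓ²`. -/
abbrev Htilde : Type := (LinearMap.range K.toL2.toLinearMap).topologicalClosure

instance : CompleteSpace K.Htilde :=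
  (Submodule.isClosed_topologicalClosure _).completeSpace_coe

/-- The continuous embedding of `B` into `Htilde`. -/
def emb : B →L[ℝ] K.Htilde :=
  K.toL2.codRestrict _ fun x => Submodule.le_topologicalClosure _ ⟨x, rfl⟩

/-- The continuous extension of `F m` from `B` to `Htilde`. -/
def Fext (m : ℕ) (f : K.Htilde) : ℝ := (f : lp (fun _ : ℕ => ℝ) 2) m / √(K.t m)

theorem Fext_emb (m : ℕ) (x : B) : K.Fext m (K.emb x) = K.F m x :=
  mul_div_cancel_left₀ _ (Real.sqrt_pos.2 (K.t_pos m)).ne'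

theorem emb_injective : Function.Injective K.emb := by
  intro x y h
  have h0 : ∀ n, K.F n (x - y) = 0 := fun n => by
    rw [map_sub, ← K.Fext_emb, ← K.Fext_emb, h, sub_self]
  have h1 : ‖x - y‖ ≤ 0 := (K.norming (x - y)).2 (by rintro _ ⟨n, rfl⟩; simp [h0 n])
  exact sub_eq_zero.1 (norm_le_zero_iff.1 h1)

/-- The `B`-norm of an element of `Htilde`; it is `∞` outside `B`. -/
def normB (f : K.Htilde) : ℝ≥0∞ := ⨅ (x : B) (_ : K.emb x = f), ‖x‖ₑ

/-- The squared norm of `H = {x ∈ B : ∑ m, (F m x)² < ∞}`; it is `∞` outside `H`. -/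
def normHSq (f : K.Htilde) : ℝ≥0∞ :=
  ⨅ (x : B) (_ : K.emb x = f), ∑' m, ENNReal.ofReal (K.F m x ^ 2)

/-- The squared norm of the dual `{x ∈ B : ∑ m, (F m x)² / t m < ∞}` of `Htilde` (a subspace of
`B`); it is `∞` outside this space. -/
def normDualSq (f : K.Htilde) : ℝ≥0∞ :=
  ⨅ (x : B) (_ : K.emb x = f), ∑' m, ENNReal.ofReal (K.F m x ^ 2 / K.t m)

theorem normB_emb (x : B) : K.normB (K.emb x) = ‖x‖ₑ := by
  refine le_antisymm (iInf_le_of_le x (iInf_le_of_le rfl le_rfl)) (le_iInf₂ fun y hy => ?_)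
  rw [K.emb_injective hy]

end KuelbsSystem

section Operators

variable {E : Type*} [NormedAddCommGroup E] [InnerProductSpace ℝ E]

/-- The Hilbert–Schmidt norm `(∑ j, ‖T e_j‖²)^(1/2)` (any orthonormal basis `e`), written as a
supremum over finite orthonormal families so that no basis has to be chosen. -/
def hsNorm (T : E →L[ℝ] E) : ℝ≥0∞ :=
  (⨆ (m : ℕ) (v : Fin m → E) (_ : Orthonormal ℝ v), ∑ i, ‖T (v i)‖ₑ ^ 2) ^ (1 / 2 : ℝ)

/-- `T = ∑ j, c j ⟨·, φ j⟩ φ j`, with `c 0 ≥ c 1 ≥ … > 0` and `φ` orthonormal: the spectral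
representation of `T`. The index `j` stands for `j + 1` in the usual enumeration from `1`. -/
structure IsSpectralSystem (T : E →L[ℝ] E) (c : ℕ → ℝ) (φ : ℕ → E) : Prop where
  orthonormal : Orthonormal ℝ φ
  antitone : Antitone c
  pos : ∀ j, 0 < c j
  hasSum : ∀ f, HasSum (fun j => (c j * ⟪f, φ j⟫_ℝ) • φ j) (T f)

/-- A complete orthonormal system `φ` of eigenvectors of the empirical operator `T` of `n`
observations, with eigenvalues `c 0 ≥ … ≥ c (n - 1) ≥ 0 = c n = c (n + 1) = …`. -/
structure IsEmpiricalSystem (T : E →L[ℝ] E) (n : ℕ) (c : ℕ → ℝ) (φ : ℕ → E) : Prop where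
  orthonormal : Orthonormal ℝ φ
  complete : (Submodule.span ℝ (Set.range φ)).topologicalClosure = ⊤
  antitone : Antitone c
  nonneg : ∀ j, 0 ≤ c j
  zero : ∀ j, n ≤ j → c j = 0
  eigen : ∀ j, T (φ j) = c j • φ j

open Classical in
/-- The squared norm `⟨C⁻¹ f, f⟩ = ∑ j, ⟨f, φ j⟩² / c j` of the reproducing kernel Hilbert space
`C^(1/2)(E)` of the operator `C` with spectral system `(c, φ)`; it is `∞` outside this space, in
particular outside the closed span of `φ`, which is the orthogonal complement of `ker C`. -/
def rkhsNormSq (c : ℕ → ℝ) (φ : ℕ → E) (f : E) : ℝ≥0∞ :=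
  if f ∈ (Submodule.span ℝ (Set.range φ)).topologicalClosure then
    ∑' j, ENNReal.ofReal (⟪f, φ j⟫_ℝ ^ 2 / c j)
  else ⊤

/-- `sgn ⟨ψ, φ⟩ φ`, where `sgn 0 = 1`. -/
def signAligned (ψ φ : E) : E := (if 0 ≤ ⟪ψ, φ⟫_ℝ then (1 : ℝ) else -1) • φ

end Operators

/-- `Λ_k`, the supremum of `1 / (C_j - C_{j+1})` over `j = 1, …, k` (enumerated from `0`). -/
def Lam (c : ℕ → ℝ) (k : ℕ) : ℝ := ⨆ j : Fin k, (c j - c (j + 1))⁻¹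

section Observations

variable {Ω : Type*} [MeasurableSpace Ω] {B : Type*} [NormedAddCommGroup B] [NormedSpace ℝ B]
  [MeasurableSpace B]

/-- Strong white noise: i.i.d., centred, with finite second moment. -/
structure IsStrongWhiteNoise (P : Measure Ω) (ε : ℤ → Ω → B) : Prop where
  measurable : ∀ n, Measurable (ε n)
  indep : iIndepFun ε P
  identDistrib : ∀ n, IdentDistrib (ε n) (ε 0) P P
  memLp : ∀ n, MemLp (ε n) 2 P
  mean_zero : ∀ n, ∫ ω, ε n ω ∂P = 0

/-- Standard ARB(1) process: the strictly stationary centred square-integrable solution of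
`X n = ρ (X (n - 1)) + ε n`, where `ε` is strong white noise and some power of `ρ` has norm `< 1`. -/
structure IsStandardARB1 (P : Measure Ω) (ρ : B →L[ℝ] B) (ε X : ℤ → Ω → B) : Prop where
  noise : IsStrongWhiteNoise P ε
  contraction : ∃ j : ℕ, 1 ≤ j ∧ ‖ρ ^ j‖ < 1
  measurable : ∀ n, Measurable (X n)
  stationary : ∀ h : ℤ, P.map (fun ω n => X (n + h) ω) = P.map (fun ω n => X n ω)
  memLp : ∀ n, MemLp (X n) 2 P
  mean_zero : ∀ n, ∫ ω, X n ω ∂P = 0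
  state : ∀ n, ∀ᵐ ω ∂P, X n ω = ρ (X (n - 1) ω) + ε n ω

/-- `C(F l)(F m) = E[F l (X 0) F m (X 0)]`, for the autocovariance operator on the dual of `B`. -/
def covForm (K : KuelbsSystem B) (P : Measure Ω) (X : ℤ → Ω → B) (l m : ℕ) : ℝ :=
  ∫ ω, K.F l (X 0 ω) * K.F m (X 0 ω) ∂P

/-- `C_n(F l)(F m)`, for the empirical autocovariance operator on the dual of `B`. -/
def empCovForm (K : KuelbsSystem B) (X : ℤ → Ω → B) (n : ℕ) (ω : Ω) (l m : ℕ) : ℝ :=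
  (n : ℝ)⁻¹ * ∑ i ∈ Finset.range n, K.F l (X i ω) * K.F m (X i ω)

/-- The autocovariance operator `C = E[X 0 ⊗ X 0]` on `Htilde`. -/
def covOp (K : KuelbsSystem B) (P : Measure Ω) (X : ℤ → Ω → B) : K.Htilde →L[ℝ] K.Htilde :=
  ∫ ω, InnerProductSpace.rankOne ℝ (K.emb (X 0 ω)) (K.emb (X 0 ω)) ∂P

/-- The empirical autocovariance operator `C_n = n⁻¹ ∑ i < n, X i ⊗ X i` on `Htilde`. -/
def empCovOp (K : KuelbsSystem B) (X : ℤ → Ω → B) (n : ℕ) (ω : Ω) : K.Htilde →L[ℝ] K.Htilde :=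
  (n : ℝ)⁻¹ • ∑ i ∈ Finset.range n,
    InnerProductSpace.rankOne ℝ (K.emb (X i ω)) (K.emb (X i ω))

end Observations

section Constants

variable {B : Type*} [NormedAddCommGroup B] [NormedSpace ℝ B]

/-- The supremum norm `‖a‖_{B × B} = sup_{l, m} |a(F l)(F m)|` of a bilinear form. -/
def formNorm (a : ℕ → ℕ → ℝ) : ℝ≥0∞ := ⨆ (l : ℕ) (m : ℕ), ‖a l m‖ₑ

/-- `N = sup_m N_m`, with `N_m = ∑ j, (F m (φ j))²`. -/
def supN (K : KuelbsSystem B) (φ : ℕ → K.Htilde) : ℝ≥0∞ :=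
  ⨆ m : ℕ, ∑' j, ENNReal.ofReal (K.Fext m (φ j) ^ 2)

/-- `V = sup_j ‖φ j‖_B`. -/
def supV (K : KuelbsSystem B) (φ : ℕ → K.Htilde) : ℝ≥0∞ := ⨆ j : ℕ, K.normB (φ j)

end Constants

end

/-! Let `r_m` be the Riesz vector of `F m` in `Htilde`. For a symmetric `T` with values in `B`, `F m
(T f) = ⟪T r_m, f⟫`, so the `B`-norm of `T f` is at most `sup_m ‖T r_m‖ * ‖f‖`. Both `C` and `C_n`
are such operators, and with `φ' = signAligned ψ φ` their eigenvectors satisfy `C_{n,j} (ψ - φ') =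
(C_n - C) ψ + C (ψ - φ') + (C_j - C_{n,j}) φ'`. Weyl's inequality gives `|C_j - C_{n,j}| ≤ ‖C -
C_n‖`, hence `C_{n,j} ≥ C_{k_n} / 2` as soon as `‖C - C_n‖ ≤ C_{k_n} / 2`. As the weights `t m` have
sum one, `sup_m ‖T r_m‖` is at most the sup-norm of the form of `T`; this is the second bound. For
the first bound, `C` and, almost surely, `C_n` vanish on the complement of `φ`, so their forms only
see the projections of the `r_m` on the closed span of `φ`, whose squared norms are at most `N`.

For the convergence, two almost sure rates are needed. The Poisson equation `U(x, y) - U(ρ x, ρ y) =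
β(x, y)` turns centred sums of `β (X i) (X i)` into a martingale with bounded increments plus
bounded boundary terms. Pinelis' inequality, applied in the Hilbert tensor square, then gives `‖C -
C_n‖ = O(√(ln n / n))`.

This does not control `sup_m ‖(C - C_n) r_m‖`, because `‖r_m‖` is bounded only by `(t m)^(-1/2)`.
Here (A4) enters: it forces `E[F m (X 0)²] ≤ M * t m`, so the mean squares of the corresponding sums
are summable in `m`. A summation along cubes yields the rate `n^(-1/4)`, uniformly in `m`. Finally
(A5) gives `‖φ_j‖_B = O(C_j^(-1/2))`. With `x_n → 0` the quotient in the rate condition, the three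
error terms are `O(√x_n)`, `O(x_n)` and `O(x_n)`. -/

noncomputable section

/-! ### Perturbation of eigenvalues and eigenvectors of operators in diagonal form. -/

section SpectralTheory

variable {E : Type*} [NormedAddCommGroup E] [InnerProductSpace ℝ E]

theorem HasSum.apply_eigenvector {T : E →L[ℝ] E} {c : ℕ → ℝ} {φ : ℕ → E} (hφ : Orthonormal ℝ φ)
    (hT : ∀ f, HasSum (fun j => (c j * ⟪f, φ j⟫_ℝ) • φ j) (T f)) (j : ℕ) :
    T (φ j) = c j • φ j := by
  refine (hT (φ j)).unique ?_
  have h := hasSum_single (f := fun i => (c i * ⟪φ j, φ i⟫_ℝ) • φ i) j (fun i hi => by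
    rw [hφ.2 hi.symm, mul_zero, zero_smul])
  simpa [hφ.1 j] using h

theorem HasSum.inner_apply_self {T : E →L[ℝ] E} {c : ℕ → ℝ} {φ : ℕ → E}
    (hT : ∀ f, HasSum (fun j => (c j * ⟪f, φ j⟫_ℝ) • φ j) (T f)) (f g : E) :
    HasSum (fun j => c j * ⟪f, φ j⟫_ℝ * ⟪g, φ j⟫_ℝ) ⟪T f, g⟫_ℝ := by
  have h := (hT f).mapL (innerSL ℝ g)
  simpa [inner_smul_right, real_inner_comm] using h

theorem Orthonormal.summable_inner_sq {φ : ℕ → E} (hφ : Orthonormal ℝ φ) (f : E) :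
    Summable fun j => ⟪f, φ j⟫_ℝ ^ 2 := by
  simpa [real_inner_comm] using hφ.inner_products_summable (x := f)

theorem Orthonormal.tsum_inner_sq_le {φ : ℕ → E} (hφ : Orthonormal ℝ φ) (f : E) :
    ∑' j, ⟪f, φ j⟫_ℝ ^ 2 ≤ ‖f‖ ^ 2 := by
  simpa [real_inner_comm] using hφ.tsum_inner_products_le (x := f)

/-- Dimension count: `j` linear conditions on `j + 1` coefficients leave a nonzero solution. -/
theorem exists_unit_combination_orthogonal (v w : ℕ → E) (j : ℕ) :
    ∃ a : Fin (j + 1) → ℝ, ∑ i, a i ^ 2 = 1 ∧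
      ∀ i < j, ⟪∑ l, a l • v l, w i⟫_ℝ = 0 := by
  let L : EuclideanSpace ℝ (Fin (j + 1)) →ₗ[ℝ] (Fin j → ℝ) :=
    { toFun := fun a i => ⟪∑ l, a l • v l, w i⟫_ℝ
      map_add' := fun a b => by
        ext i
        simp [add_smul, Finset.sum_add_distrib, inner_add_left]
      map_smul' := fun r a => by
        ext i
        simp [mul_smul, ← Finset.smul_sum, inner_smul_left] }
  have hker : LinearMap.ker L ≠ ⊥ := LinearMap.ker_ne_bot_of_finrank_lt (by simp)
  obtain ⟨b, hb, hb0⟩ := Submodule.exists_mem_ne_zero_of_ne_bot hker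
  have hn : ‖b‖ ≠ 0 := norm_ne_zero_iff.2 hb0
  refine ⟨fun i => (‖b‖⁻¹ • b) i, ?_, fun i hi => ?_⟩
  · have h1 : ‖‖b‖⁻¹ • b‖ = 1 := by
      rw [norm_smul, norm_inv, norm_norm, inv_mul_cancel₀ hn]
    have h2 := EuclideanSpace.real_norm_sq_eq (‖b‖⁻¹ • b)
    rw [h1] at h2
    simpa using h2.symm
  · have h3 : L (‖b‖⁻¹ • b) = 0 := by rw [map_smul, LinearMap.mem_ker.1 hb, smul_zero]
    exact congrFun h3 ⟨i, hi⟩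

/-- The Courant–Fischer argument for one half of Weyl's inequality: a unit vector `u` in the span of
`φ 0, …, φ j` that is orthogonal to `ψ 0, …, ψ (j - 1)` has `⟪T u, u⟫ ≥ c j` and `⟪S u, u⟫ ≤ d j`.
Since `ψ` need not be complete, only Bessel's inequality is available for the second estimate,
whence the condition `0 ≤ d j`. -/
theorem eigenvalue_le_add_norm_sub {T S : E →L[ℝ] E} {c d : ℕ → ℝ} {φ ψ : ℕ → E}
    (hφ : Orthonormal ℝ φ) (hc : Antitone c)
    (hT : ∀ f, HasSum (fun j => (c j * ⟪f, φ j⟫_ℝ) • φ j) (T f))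
    (hψ : Orthonormal ℝ ψ) (hd : Antitone d) (hd0 : ∀ j, 0 ≤ d j)
    (hS : ∀ f, HasSum (fun j => (d j * ⟪f, ψ j⟫_ℝ) • ψ j) (S f)) (j : ℕ) :
    c j ≤ d j + ‖T - S‖ := by
  obtain ⟨a, ha, hw⟩ := exists_unit_combination_orthogonal φ ψ j
  have hφ' : Orthonormal ℝ (fun l : Fin (j + 1) => φ l) := hφ.comp _ Fin.val_injective
  set u : E := ∑ l, a l • φ l with hu
  have hTu : T u = ∑ l : Fin (j + 1), (a l * c l) • φ l := by
    simp only [hu, map_sum, map_smul, HasSum.apply_eigenvector hφ hT, smul_smul]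
  have hnorm : ⟪u, u⟫_ℝ = 1 := by
    rw [hu, hφ'.inner_sum]
    simpa [sq] using ha
  have hnu : ‖u‖ = 1 := by
    rw [real_inner_self_eq_norm_sq] at hnorm
    nlinarith [norm_nonneg u]
  have h1 : c j ≤ ⟪T u, u⟫_ℝ := by
    rw [hTu, hu, hφ'.inner_sum]
    calc c j = ∑ l : Fin (j + 1), a l ^ 2 * c j := by rw [← Finset.sum_mul, ha, one_mul]
      _ ≤ ∑ l : Fin (j + 1), a l ^ 2 * c l := by
          gcongr with l
          exact hc (Nat.lt_succ_iff.1 l.2)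
      _ = _ := Finset.sum_congr rfl fun l _ => by simp; ring
  have h2 : ⟪S u, u⟫_ℝ ≤ d j := by
    have hs := HasSum.inner_apply_self hS u u
    have hq := hψ.summable_inner_sq u
    calc ⟪S u, u⟫_ℝ ≤ ∑' i, d j * ⟪u, ψ i⟫_ℝ ^ 2 := by
          refine hasSum_le (fun i => ?_) hs (hq.mul_left _).hasSum
          rcases lt_or_ge i j with hi | hi
          · simp [hw i hi]
          · nlinarith [hd hi, sq_nonneg ⟪u, ψ i⟫_ℝ]
      _ = d j * ∑' i, ⟪u, ψ i⟫_ℝ ^ 2 := tsum_mul_left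
      _ ≤ d j * 1 := by
          refine mul_le_mul_of_nonneg_left ((hψ.tsum_inner_sq_le u).trans ?_) (hd0 j)
          rw [hnu, one_pow]
      _ = d j := mul_one _
  have h3 : ⟪(T - S) u, u⟫_ℝ ≤ ‖T - S‖ := by
    refine (real_inner_le_norm _ _).trans ?_
    have := (T - S).le_opNorm u
    rw [hnu] at this ⊢
    linarith
  rw [sub_apply, inner_sub_left] at h3
  linarith

/-- A Davis–Kahan estimate. The residual of `ψ` equals that of its component `χ` orthogonal to `φ
j`, on which `T - c j` is bounded below by `g`. The value `0`, taken by `T` off the span of `φ`,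
also counts as spectrum; this is why `g ≤ c j` is required. The factor `√2` comes from `2 - 2|a| ≤ 2
(1 - a²) = 2 ‖χ‖²`. -/
theorem norm_sub_signAligned_le {T : E →L[ℝ] E} {c : ℕ → ℝ} {φ : ℕ → E}
    (hφ : Orthonormal ℝ φ) (hT : ∀ f, HasSum (fun j => (c j * ⟪f, φ j⟫_ℝ) • φ j) (T f))
    {j : ℕ} {g : ℝ} (hg : 0 < g) (hgj : g ≤ c j) (hgap : ∀ i, i ≠ j → g ≤ |c i - c j|)
    {ψ : E} (hψ : ‖ψ‖ = 1) {r : ℝ} (hr : ‖T ψ - c j • ψ‖ ≤ r) :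
    ‖ψ - signAligned ψ (φ j)‖ ≤ √2 * (g⁻¹ * r) := by
  set a := ⟪ψ, φ j⟫_ℝ with ha
  set χ := ψ - a • φ j with hχ
  have hφj : ⟪φ j, φ j⟫_ℝ = 1 := by simp [hφ.1 j]
  have hψψ : ⟪ψ, ψ⟫_ℝ = 1 := by simp [hψ]
  have hχj : ⟪χ, φ j⟫_ℝ = 0 := by rw [hχ, inner_sub_left, inner_smul_left, hφj, ← ha]; simp
  have hχχ : ‖χ‖ ^ 2 = 1 - a ^ 2 := by
    rw [← real_inner_self_eq_norm_sq]
    nth_rw 2 [hχ]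
    rw [inner_sub_right, inner_smul_right, hχj, hχ, inner_sub_left, inner_smul_left,
      real_inner_comm, hψψ, real_inner_comm, ← ha]
    simp; ring
  have hTχ : T ψ - c j • ψ = T χ - c j • χ := by
    rw [hχ, map_sub, map_smul, HasSum.apply_eigenvector hφ hT, smul_sub, smul_comm a (c j)]
    abel
  have hsq := hφ.summable_inner_sq χ
  have h1 : HasSum (fun i => c i * ⟪χ, φ i⟫_ℝ ^ 2) ⟪T χ, χ⟫_ℝ := by
    simpa [mul_assoc, sq] using HasSum.inner_apply_self hT χ χ
  have h2 : HasSum (fun i => c i ^ 2 * ⟪χ, φ i⟫_ℝ ^ 2) ⟪T χ, T χ⟫_ℝ := by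
    have h := HasSum.inner_apply_self hT χ (T χ)
    convert! h using 2 with i
    have h4 : ⟪T χ, φ i⟫_ℝ = c i * ⟪χ, φ i⟫_ℝ := by
      refine (HasSum.inner_apply_self hT χ (φ i)).unique ?_
      have h := hasSum_single (f := fun l => c l * ⟪χ, φ l⟫_ℝ * ⟪φ i, φ l⟫_ℝ) i (fun l hl => by
        rw [hφ.2 hl.symm, mul_zero])
      simpa [hφ.1 i] using h
    rw [h4]; ring
  have h3 : g ^ 2 * ‖χ‖ ^ 2 ≤ ‖T χ - c j • χ‖ ^ 2 := by
    have e : ‖T χ - c j • χ‖ ^ 2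
        = ⟪T χ, T χ⟫_ℝ - 2 * c j * ⟪T χ, χ⟫_ℝ + c j ^ 2 * ‖χ‖ ^ 2 := by
      rw [norm_sub_sq_real, norm_smul, inner_smul_right, real_inner_self_eq_norm_sq, mul_pow,
        Real.norm_eq_abs, sq_abs]
      ring
    -- The terms of this series are `((c i - c j)² - g²) ⟪χ, φ i⟫²`, nonnegative for `i ≠ j` and
    -- zero for `i = j`. The part of `χ` off the span of `φ` is added through Bessel's inequality
    -- with weight `c j² - g² ≥ 0`.
    have hs := (h2.sub (h1.mul_left (2 * c j))).add (hsq.hasSum.mul_left (c j ^ 2 - g ^ 2))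
    have hpos : 0 ≤ ⟪T χ, T χ⟫_ℝ - 2 * c j * ⟪T χ, χ⟫_ℝ
        + (c j ^ 2 - g ^ 2) * ∑' i, ⟪χ, φ i⟫_ℝ ^ 2 := by
      refine hs.nonneg fun i => ?_
      by_cases hi : i = j
      · subst hi; simp [hχj]
      · have : g ^ 2 ≤ (c i - c j) ^ 2 := by
          rw [← sq_abs (c i - c j)]
          exact pow_le_pow_left₀ hg.le (hgap i hi) 2
        nlinarith [sq_nonneg ⟪χ, φ i⟫_ℝ]
    have hbes := hφ.tsum_inner_sq_le χ
    have : 0 ≤ c j ^ 2 - g ^ 2 := by nlinarith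
    rw [e]
    nlinarith
  have h4 : g * ‖χ‖ ≤ r := by
    refine le_trans ?_ hr
    rw [hTχ]
    refine abs_le_of_sq_le_sq' ?_ (norm_nonneg _) |>.2
    rwa [mul_pow]
  have h5 : ‖χ‖ ≤ g⁻¹ * r := by rwa [le_inv_mul_iff₀ hg]
  have ha1 : |a| ≤ 1 := by
    have := abs_real_inner_le_norm ψ (φ j)
    rwa [hψ, hφ.1 j, one_mul] at this
  have h6 : ‖ψ - signAligned ψ (φ j)‖ ^ 2 ≤ 2 * ‖χ‖ ^ 2 := by
    have : ‖ψ - signAligned ψ (φ j)‖ ^ 2 = 2 - 2 * |a| := by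
      rw [norm_sub_sq_real, signAligned, inner_smul_right, norm_smul, hφ.1 j, hψ, ← ha]
      split_ifs with h
      · rw [abs_of_nonneg h]; norm_num; ring
      · rw [abs_of_neg (not_le.1 h)]; norm_num; ring
    rw [this, hχχ]
    nlinarith [abs_nonneg a, sq_abs a]
  calc ‖ψ - signAligned ψ (φ j)‖ = √(‖ψ - signAligned ψ (φ j)‖ ^ 2) :=
        (Real.sqrt_sq (norm_nonneg _)).symm
    _ ≤ √(2 * ‖χ‖ ^ 2) := Real.sqrt_le_sqrt h6
    _ = √2 * ‖χ‖ := by rw [Real.sqrt_mul (by norm_num), Real.sqrt_sq (norm_nonneg _)]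
    _ ≤ _ := by gcongr

theorem IsEmpiricalSystem.hasSum [CompleteSpace E] {T : E →L[ℝ] E} {n : ℕ} {c : ℕ → ℝ} {φ : ℕ → E}
    (h : IsEmpiricalSystem T n c φ) (f : E) :
    HasSum (fun j => (c j * ⟪f, φ j⟫_ℝ) • φ j) (T f) := by
  let b := HilbertBasis.mk h.orthonormal h.complete.ge
  have hb : ⇑b = φ := HilbertBasis.coe_mk _ _
  have h1 := (b.hasSum_repr f).mapL T
  convert! h1 using 2 with j
  rw [b.repr_apply_apply, map_smul, hb, h.eigen, smul_smul, real_inner_comm, mul_comm]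

theorem IsSpectralSystem.strictAnti {T : E →L[ℝ] E} {c : ℕ → ℝ} {φ : ℕ → E}
    (h : IsSpectralSystem T c φ)
    (hsimple : ∀ j, Module.finrank ℝ (Module.End.eigenspace T.toLinearMap (c j)) = 1) (j : ℕ) :
    c (j + 1) < c j := by
  refine lt_of_le_of_ne (h.antitone j.le_succ) fun heq => ?_
  have hmem : ∀ i, c i = c j → φ i ∈ Module.End.eigenspace T.toLinearMap (c j) := fun i hi => by
    rw [Module.End.mem_eigenspace_iff]
    exact (HasSum.apply_eigenvector h.orthonormal h.hasSum i).trans (by rw [hi])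
  have hne : (⟨φ j, hmem j rfl⟩ : Module.End.eigenspace T.toLinearMap (c j)) ≠ 0 := fun h0 =>
    h.orthonormal.ne_zero j (congrArg Subtype.val h0)
  obtain ⟨r, hr⟩ := (finrank_eq_one_iff_of_nonzero' _ hne).1 (hsimple j) ⟨φ (j + 1), hmem _ heq⟩
  have hr' : r • φ j = φ (j + 1) := congrArg Subtype.val hr
  have h0 : ⟪φ j, φ (j + 1)⟫_ℝ = 0 := h.orthonormal.2 (by simp)
  have h1 : r = 0 := by
    rw [← hr', inner_smul_right] at h0
    simpa [h.orthonormal.1 j] using h0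
  exact h.orthonormal.ne_zero (j + 1) (by rw [← hr', h1, zero_smul])

theorem inv_sub_le_Lam (c : ℕ → ℝ) {j k : ℕ} (hj : j < k) : (c j - c (j + 1))⁻¹ ≤ Lam c k :=
  le_ciSup (f := fun i : Fin k => (c i - c (i + 1))⁻¹) (Set.finite_range _).bddAbove ⟨j, hj⟩

/-- The gap used is the one just below the smaller of the two indices, which is less than `k` even
when `i` is not. -/
theorem inv_Lam_le_abs_sub {c : ℕ → ℝ} (hc : ∀ j, c (j + 1) < c j) {i j k : ℕ} (hj : j < k)
    (hij : i ≠ j) : (Lam c k)⁻¹ ≤ |c i - c j| := by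
  have hanti : Antitone c := antitone_nat_of_succ_le fun n => (hc n).le
  have key : ∀ l < k, (Lam c k)⁻¹ ≤ c l - c (l + 1) := fun l hl =>
    inv_le_of_inv_le₀ (sub_pos.2 (hc l)) (inv_sub_le_Lam c hl)
  rcases lt_or_gt_of_ne hij with h | h
  · refine (key i (h.trans hj)).trans (le_trans ?_ (le_abs_self _))
    linarith [hanti (Nat.succ_le_of_lt h)]
  · refine (key j hj).trans (le_trans ?_ (neg_le_abs _))
    linarith [hanti (Nat.succ_le_of_lt h)]

theorem enorm_le_hsNorm (T : E →L[ℝ] E) : ‖T‖ₑ ≤ hsNorm T := by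
  have key : ∀ v : E, ‖v‖ = 1 → ‖T v‖ₑ ≤ hsNorm T := fun v hv => by
    have ho : Orthonormal ℝ (fun _ : Fin 1 => v) :=
      ⟨fun _ => hv, fun i j hij => (hij (Subsingleton.elim _ _)).elim⟩
    calc ‖T v‖ₑ = (‖T v‖ₑ ^ (2 : ℝ)) ^ (1 / 2 : ℝ) := by
          rw [← ENNReal.rpow_mul]; norm_num
      _ ≤ hsNorm T := by
          refine ENNReal.rpow_le_rpow ?_ (by norm_num)
          refine le_iSup_of_le 1 (le_iSup_of_le (fun _ => v) (le_iSup_of_le ho ?_))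
          simp
  by_cases htop : hsNorm T = ⊤
  · rw [htop]; exact le_top
  rw [← ofReal_norm]
  refine ENNReal.ofReal_le_of_le_toReal ?_
  refine T.opNorm_le_of_unit_norm ENNReal.toReal_nonneg fun v hv => ?_
  have := key v hv
  rw [← ofReal_norm] at this
  exact (ENNReal.ofReal_le_iff_le_toReal htop).1 this

end SpectralTheory

/-! ### Riesz vectors of the norming functionals and estimates in the norm of `B`. -/

namespace KuelbsSystem

variable {B : Type*} [NormedAddCommGroup B] [NormedSpace ℝ B] (K : KuelbsSystem B)

theorem norm_emb_le (x : B) : ‖K.emb x‖ ≤ ‖x‖ := by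
  have h : ‖K.toL2 x‖ ≤ 1 * ‖x‖ := K.toL2.le_of_opNorm_le (LinearMap.mkContinuous_norm_le _ zero_le_one _) x
  rw [one_mul] at h
  exact h

/-- The extension of `F m` to `Htilde`, as a continuous linear functional. -/
def FextL (m : ℕ) : K.Htilde →L[ℝ] ℝ :=
  LinearMap.mkContinuous
    { toFun := K.Fext m
      map_add' := fun f g => add_div _ _ _
      map_smul' := fun r f => mul_div_assoc _ _ _ } (√(K.t m))⁻¹
    (fun f => by
      have h : |(f : lp (fun _ : ℕ => ℝ) 2) m| ≤ ‖f‖ :=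
        lp.norm_apply_le_norm (p := 2) (by norm_num) (f : lp (fun _ : ℕ => ℝ) 2) m
      change |(f : lp (fun _ : ℕ => ℝ) 2) m / √(K.t m)| ≤ _
      rw [abs_div, abs_of_nonneg (Real.sqrt_nonneg _), div_eq_inv_mul]
      exact mul_le_mul_of_nonneg_left h (by positivity))

/-- The vector of `Htilde` that represents `F m`. -/
def riesz (m : ℕ) : K.Htilde := (InnerProductSpace.toDual ℝ K.Htilde).symm (K.FextL m)

theorem inner_riesz (m : ℕ) (f : K.Htilde) : ⟪K.riesz m, f⟫_ℝ = K.Fext m f := by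
  rw [riesz, InnerProductSpace.toDual_symm_apply]
  rfl

theorem inner_riesz_emb (m : ℕ) (x : B) : ⟪K.riesz m, K.emb x⟫_ℝ = K.F m x := by
  rw [inner_riesz, Fext_emb]

theorem hasSum_inner (f g : K.Htilde) :
    HasSum (fun l => K.t l * (K.Fext l f * K.Fext l g)) ⟪f, g⟫_ℝ := by
  have h := lp.hasSum_inner (𝕜 := ℝ) (f : lp (fun _ : ℕ => ℝ) 2) (g : lp (fun _ : ℕ => ℝ) 2)
  convert! h using 2 with l
  have ht := K.t_pos l
  rw [Fext, Fext, div_mul_div_comm, Real.mul_self_sqrt ht.le, mul_div_cancel₀ _ ht.ne']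
  simp [mul_comm]

theorem norm_le_of_forall_abs_F_le {x : B} {r : ℝ} (h : ∀ m, |K.F m x| ≤ r) : ‖x‖ ≤ r :=
  (K.norming x).2 (by rintro _ ⟨m, rfl⟩; exact h m)

/-- A weighted `ℓ²` norm with weights of sum one is at most the supremum norm. -/
theorem norm_le_of_forall_abs_Fext_le {f : K.Htilde} {r : ℝ} (hr : 0 ≤ r)
    (h : ∀ m, |K.Fext m f| ≤ r) : ‖f‖ ≤ r := by
  refine abs_le_of_sq_le_sq' ?_ hr |>.2
  rw [← real_inner_self_eq_norm_sq]
  have h1 := K.hasSum_inner f f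
  have h2 := K.t_sum.mul_right (r ^ 2)
  rw [one_mul] at h2
  refine hasSum_le (fun l => mul_le_mul_of_nonneg_left ?_ (K.t_pos l).le) h1 h2
  rw [← sq, ← sq_abs]
  exact pow_le_pow_left₀ (abs_nonneg _) (h l) 2

theorem normB_le {f : K.Htilde} {x : B} (h : K.emb x = f) : K.normB f ≤ ‖x‖ₑ :=
  iInf₂_le x h

theorem normHSq_emb (x : B) :
    K.normHSq (K.emb x) = ∑' m, ENNReal.ofReal (K.F m x ^ 2) := by
  refine le_antisymm (iInf_le_of_le x (iInf_le_of_le rfl le_rfl)) (le_iInf₂ fun y hy => ?_)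
  rw [K.emb_injective hy]

theorem normDualSq_emb (x : B) :
    K.normDualSq (K.emb x) = ∑' m, ENNReal.ofReal (K.F m x ^ 2 / K.t m) := by
  refine le_antisymm (iInf_le_of_le x (iInf_le_of_le rfl le_rfl)) (le_iInf₂ fun y hy => ?_)
  rw [K.emb_injective hy]

/-- The `B`-norm of `T f` is controlled by the vectors `T (riesz m)`. -/
theorem norm_le_of_emb_eq_apply {T : K.Htilde →L[ℝ] K.Htilde}
    (hT : ∀ f g, ⟪T f, g⟫_ℝ = ⟪f, T g⟫_ℝ) {r : ℝ} (hr : ∀ m, ‖T (K.riesz m)‖ ≤ r) {x : B}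
    {f : K.Htilde} (hx : K.emb x = T f) : ‖x‖ ≤ r * ‖f‖ := by
  refine K.norm_le_of_forall_abs_F_le fun m => ?_
  rw [← inner_riesz_emb, hx, ← hT]
  exact (abs_real_inner_le_norm _ _).trans (mul_le_mul_of_nonneg_right (hr m) (norm_nonneg _))

/-- This rests on `d (ψ - φ') = (D - C) ψ + C (ψ - φ') + (c - d) φ'`, where `φ'` is the aligned
eigenvector. The first two summands are values of symmetric operators with range in `B`, so
`norm_le_of_emb_eq_apply` bounds them; the last is a multiple of `y`. -/
theorem exists_emb_eq_sub_signAligned {C D : K.Htilde →L[ℝ] K.Htilde}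
    (hC : ∀ f g, ⟪C f, g⟫_ℝ = ⟪f, C g⟫_ℝ) (hD : ∀ f g, ⟪D f, g⟫_ℝ = ⟪f, D g⟫_ℝ)
    (hCB : ∀ f, ∃ x, K.emb x = C f) (hDB : ∀ f, ∃ x, K.emb x = D f)
    {c d : ℝ} (hd : 0 < d) {φ ψ : K.Htilde} (hφ : C φ = c • φ) (hψ : D ψ = d • ψ) (hψ1 : ‖ψ‖ = 1)
    {y : B} (hy : K.emb y = φ) {α κ : ℝ} (hα : ∀ m, ‖(C - D) (K.riesz m)‖ ≤ α)
    (hκ : ∀ m, ‖C (K.riesz m)‖ ≤ κ) :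
    ∃ x, K.emb x = ψ - signAligned ψ φ ∧
      ‖x‖ ≤ d⁻¹ * (α + ‖ψ - signAligned ψ φ‖ * κ + ‖y‖ * |c - d|) := by
  set s : ℝ := if 0 ≤ ⟪ψ, φ⟫_ℝ then (1 : ℝ) else -1 with hs
  have hs1 : |s| = 1 := by rw [hs]; split_ifs <;> simp
  have hsφ : signAligned ψ φ = s • φ := rfl
  obtain ⟨x₁, hx₁⟩ := hCB ψ
  obtain ⟨x₂, hx₂⟩ := hDB ψ
  obtain ⟨x₃, hx₃⟩ := hCB (ψ - signAligned ψ φ)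
  have h12 : K.emb (x₁ - x₂) = (C - D) ψ := by rw [map_sub, hx₁, hx₂, sub_apply]
  have hn1 := K.norm_le_of_emb_eq_apply (T := C - D)
    (fun f g => by rw [sub_apply, sub_apply, inner_sub_left, inner_sub_right, hC, hD]) hα h12
  have hn2 := K.norm_le_of_emb_eq_apply hC hκ hx₃
  refine ⟨d⁻¹ • (x₂ - x₁ + x₃ + ((c - d) * s) • y), ?_, ?_⟩
  · rw [map_smul, map_add, map_add, map_sub, hx₁, hx₂, hx₃, map_smul, hy, hψ, map_sub, hsφ,
      map_smul, hφ]
    rw [inv_smul_eq_iff₀ hd.ne']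
    module
  · rw [norm_smul, Real.norm_eq_abs, abs_of_pos (inv_pos.2 hd)]
    refine mul_le_mul_of_nonneg_left ?_ (inv_pos.2 hd).le
    refine (norm_add₃_le).trans ?_
    rw [norm_smul, Real.norm_eq_abs, abs_mul, hs1, mul_one, norm_sub_rev, mul_comm |c - d|]
    rw [hψ1, mul_one] at hn1
    linarith

end KuelbsSystem

/-! ### Theoretical and empirical covariance operators and their quadratic forms. -/

section CovarianceOperators

variable {Ω : Type*} [MeasurableSpace Ω] {P : Measure Ω} [IsProbabilityMeasure P]
  {B : Type*} [NormedAddCommGroup B] [NormedSpace ℝ B]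
  [SecondCountableTopology B] [MeasurableSpace B] [BorelSpace B] (K : KuelbsSystem B)
  {X : ℤ → Ω → B} {R : ℝ}

set_option maxSynthPendingDepth 5

omit [NormedSpace ℝ B] in
theorem integrable_comp_of_norm_le {E : Type*} [NormedAddCommGroup E] {x : Ω → B}
    (hx : Measurable x) (hR : ∀ᵐ ω ∂P, ‖x ω‖ ≤ R) {G : B → E} (hG : Continuous G) {M : ℝ}
    (hM : ∀ b, ‖b‖ ≤ R → ‖G b‖ ≤ M) : Integrable (fun ω => G (x ω)) P := by
  refine Integrable.of_bound (C := M) (hG.stronglyMeasurable.comp_measurable hx).aestronglyMeasurable ?_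
  filter_upwards [hR] with ω h using hM _ h

theorem integrable_rankOne (hx : Measurable (X 0)) (hR : ∀ᵐ ω ∂P, ‖X 0 ω‖ ≤ R) :
    Integrable (fun ω => InnerProductSpace.rankOne ℝ (K.emb (X 0 ω)) (K.emb (X 0 ω))) P := by
  refine integrable_comp_of_norm_le (M := R * R) hx hR
    (G := fun b => InnerProductSpace.rankOne ℝ (K.emb b) (K.emb b))
    (((InnerProductSpace.rankOne ℝ).continuous.comp K.emb.continuous).clm_apply K.emb.continuous) fun b hb => ?_
  rw [InnerProductSpace.norm_rankOne]
  have h := (K.norm_emb_le b).trans hb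
  exact mul_le_mul h h (norm_nonneg _) ((norm_nonneg _).trans h)

/-- The Bochner integral of `⟪X 0, f⟫ X 0` already exists in the complete space `B`, and `emb`
commutes with it. -/
theorem exists_emb_eq_covOp [CompleteSpace B] (hx : Measurable (X 0)) (hR : ∀ᵐ ω ∂P, ‖X 0 ω‖ ≤ R)
    (f : K.Htilde) : ∃ x, K.emb x = covOp K P X f := by
  refine ⟨∫ ω, ⟪K.emb (X 0 ω), f⟫_ℝ • X 0 ω ∂P, ?_⟩
  have hi : Integrable (fun ω => ⟪K.emb (X 0 ω), f⟫_ℝ • X 0 ω) P := by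
    refine integrable_comp_of_norm_le (M := R * ‖f‖ * R) hx hR
      (G := fun b => ⟪K.emb b, f⟫_ℝ • b) (by fun_prop) fun b hb => ?_
    rw [norm_smul]
    have h := (K.norm_emb_le b).trans hb
    have hR0 := (norm_nonneg _).trans h
    refine mul_le_mul ?_ hb (norm_nonneg _) (by positivity)
    exact (norm_inner_le_norm _ _).trans (by gcongr)
  rw [← ContinuousLinearMap.integral_comp_comm _ hi, covOp,
    ContinuousLinearMap.integral_apply (integrable_rankOne K hx hR)]
  simp

theorem inner_covOp (hx : Measurable (X 0)) (hR : ∀ᵐ ω ∂P, ‖X 0 ω‖ ≤ R)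
    (f g : K.Htilde) :
    ⟪covOp K P X f, g⟫_ℝ = ∫ ω, ⟪K.emb (X 0 ω), f⟫_ℝ * ⟪K.emb (X 0 ω), g⟫_ℝ ∂P := by
  have hi := integrable_rankOne K hx hR
  rw [covOp, ContinuousLinearMap.integral_apply hi, real_inner_comm, ← integral_inner
    (hi.apply_continuousLinearMap f)]
  simp [inner_smul_right, real_inner_comm]

omit [MeasurableSpace Ω] [SecondCountableTopology B] [MeasurableSpace B] [BorelSpace B] in
theorem empCovOp_apply (n : ℕ) (ω : Ω) (f : K.Htilde) :
    empCovOp K X n ω f = (n : ℝ)⁻¹ • ∑ i ∈ Finset.range n, ⟪K.emb (X i ω), f⟫_ℝ • K.emb (X i ω) := by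
  simp [empCovOp]

omit [MeasurableSpace Ω] [SecondCountableTopology B] [MeasurableSpace B] [BorelSpace B] in
theorem exists_emb_eq_empCovOp (n : ℕ) (ω : Ω) (f : K.Htilde) :
    ∃ x, K.emb x = empCovOp K X n ω f :=
  ⟨(n : ℝ)⁻¹ • ∑ i ∈ Finset.range n, ⟪K.emb (X i ω), f⟫_ℝ • X i ω, by
    simp [empCovOp_apply]⟩

omit [MeasurableSpace Ω] [SecondCountableTopology B] [MeasurableSpace B] [BorelSpace B] in
theorem inner_empCovOp (n : ℕ) (ω : Ω) (f g : K.Htilde) :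
    ⟪empCovOp K X n ω f, g⟫_ℝ =
      (n : ℝ)⁻¹ * ∑ i ∈ Finset.range n, ⟪K.emb (X i ω), f⟫_ℝ * ⟪K.emb (X i ω), g⟫_ℝ := by
  simp [empCovOp_apply, inner_smul_left, sum_inner]

theorem covOp_symm (hx : Measurable (X 0)) (hR : ∀ᵐ ω ∂P, ‖X 0 ω‖ ≤ R) (f g : K.Htilde) :
    ⟪covOp K P X f, g⟫_ℝ = ⟪f, covOp K P X g⟫_ℝ := by
  rw [real_inner_comm _ f, inner_covOp K hx hR, inner_covOp K hx hR]
  simp_rw [mul_comm]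

omit [MeasurableSpace Ω] [SecondCountableTopology B] [MeasurableSpace B] [BorelSpace B] in
theorem empCovOp_symm (n : ℕ) (ω : Ω) (f g : K.Htilde) :
    ⟪empCovOp K X n ω f, g⟫_ℝ = ⟪f, empCovOp K X n ω g⟫_ℝ := by
  rw [real_inner_comm _ f, inner_empCovOp, inner_empCovOp]
  simp_rw [mul_comm]

theorem covForm_eq (hx : Measurable (X 0)) (hR : ∀ᵐ ω ∂P, ‖X 0 ω‖ ≤ R) (l m : ℕ) :
    covForm K P X l m = ⟪covOp K P X (K.riesz l), K.riesz m⟫_ℝ := by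
  rw [inner_covOp K hx hR]
  simp_rw [real_inner_comm (K.riesz _), KuelbsSystem.inner_riesz_emb]
  rfl

omit [MeasurableSpace Ω] [SecondCountableTopology B] [MeasurableSpace B] [BorelSpace B] in
theorem empCovForm_eq (n : ℕ) (ω : Ω) (l m : ℕ) :
    empCovForm K X n ω l m = ⟪empCovOp K X n ω (K.riesz l), K.riesz m⟫_ℝ := by
  rw [inner_empCovOp]
  simp_rw [real_inner_comm (K.riesz _), KuelbsSystem.inner_riesz_emb]
  rfl

end CovarianceOperators

/-! ### Exponential inequality for Hilbert-valued martingales with bounded increments. -/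

section Pinelis

/-- As a power series in `z²`, `cosh z` has nonnegative coefficients, so it is convex in `z²`. -/
theorem Real.cosh_le_of_sq_eq {a b θ z : ℝ} (hθ0 : 0 ≤ θ) (hθ1 : θ ≤ 1)
    (hz : z ^ 2 = θ * a ^ 2 + (1 - θ) * b ^ 2) :
    Real.cosh z ≤ θ * Real.cosh a + (1 - θ) * Real.cosh b := by
  refine hasSum_le (fun n => ?_) (Real.hasSum_cosh z)
    (((Real.hasSum_cosh a).mul_left θ).add ((Real.hasSum_cosh b).mul_left (1 - θ)))
  have h := (convexOn_pow (𝕜 := ℝ) n).2 (Set.mem_Ici.2 (sq_nonneg a)) (Set.mem_Ici.2 (sq_nonneg b)) hθ0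
    (sub_nonneg.2 hθ1) (by ring)
  simp only [smul_eq_mul] at h
  rw [← mul_div_assoc, ← mul_div_assoc, ← add_div, pow_mul, pow_mul, pow_mul, hz]
  gcongr

theorem Real.exp_sub_le_exp_sq {s : ℝ} (hs : 0 ≤ s) : Real.exp s - s ≤ Real.exp (s ^ 2) := by
  rcases le_total s 1 with h | h
  · have h1 := (abs_le.1 (Real.abs_exp_sub_one_sub_id_le (abs_le.2 ⟨by linarith, h⟩))).2
    have h2 := Real.add_one_le_exp (s ^ 2)
    linarith
  · have : Real.exp s ≤ Real.exp (s ^ 2) := Real.exp_le_exp.2 (by nlinarith)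
    linarith

theorem Real.sinh_le_self_mul_cosh {r : ℝ} (hr : 0 ≤ r) : Real.sinh r ≤ r * Real.cosh r := by
  refine hasSum_le (fun n => ?_) (Real.hasSum_sinh r) ((Real.hasSum_cosh r).mul_left r)
  rw [pow_succ', mul_div_assoc]
  gcongr
  exact Nat.le_succ _

theorem Real.sinh_div_self_le_cosh {r : ℝ} (hr : 0 ≤ r) : Real.sinh r / r ≤ Real.cosh r :=
  div_le_of_le_mul₀ hr (Real.cosh_pos r).le (by
    rw [mul_comm]; exact Real.sinh_le_self_mul_cosh hr)

theorem Real.sinh_div_self_nonneg {r : ℝ} (hr : 0 ≤ r) : 0 ≤ Real.sinh r / r :=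
  div_nonneg (Real.sinh_nonneg_iff.2 hr) hr

variable {E : Type*} [NormedAddCommGroup E] [InnerProductSpace ℝ E]

/-- With `r = ‖x‖`, `s = ‖y‖` and `u` the cosine of the angle, `‖x + y‖²` is the mean of `(r + s)²`
and `(r - s)²` with weights `(1 ± u) / 2`. Convexity gives `cosh r cosh s + u sinh r sinh s`. The
part `u s sinh r`, linear in `y`, is kept, since it integrates to zero for martingale increments;
the rest, `u sinh r (sinh s - s)`, is at most `cosh r (sinh s - s)`. -/
theorem cosh_norm_add_le (x y : E) :
    Real.cosh ‖x + y‖ ≤ Real.cosh ‖x‖ * (Real.exp ‖y‖ - ‖y‖)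
      + Real.sinh ‖x‖ / ‖x‖ * ⟪x, y⟫_ℝ := by
  have hy0 := norm_nonneg y
  rcases (norm_nonneg x).eq_or_lt with hx | hx
  · have hx0 : x = 0 := norm_eq_zero.1 hx.symm
    subst hx0
    have h1 := Real.cosh_add_sinh ‖y‖
    have h2 := Real.self_le_sinh_iff.2 hy0
    simp
    linarith
  rcases hy0.eq_or_lt with hy | hy
  · have hy0 : y = 0 := norm_eq_zero.1 hy.symm
    subst hy0
    simp
  set r := ‖x‖
  set s := ‖y‖
  set u := ⟪x, y⟫_ℝ / (r * s) with hu
  have hrs : 0 < r * s := mul_pos hx hy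
  have hur : u * (r * s) = ⟪x, y⟫_ℝ := div_mul_cancel₀ _ hrs.ne'
  have habs : |u| ≤ 1 := by
    rw [hu, abs_div, abs_of_pos hrs, div_le_one hrs]
    exact abs_real_inner_le_norm x y
  obtain ⟨hu1, hu2⟩ := abs_le.1 habs
  have h1 := Real.cosh_le_of_sq_eq (a := r + s) (b := r - s) (θ := (1 + u) / 2) (z := ‖x + y‖)
    (by linarith) (by linarith) (by rw [norm_add_sq_real, ← hur]; ring)
  rw [Real.cosh_add, Real.cosh_sub] at h1
  have h2 : Real.sinh r / r * ⟪x, y⟫_ℝ = u * s * Real.sinh r := by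
    rw [← hur]; field_simp
  have h3 := Real.self_le_sinh_iff.2 hy.le
  have h4 : Real.sinh r ≤ Real.cosh r := Real.sinh_lt_cosh r |>.le
  have h5 : 0 ≤ Real.sinh r := Real.sinh_nonneg_iff.2 hx.le
  have h6 := Real.cosh_add_sinh s
  rw [h2, ← h6]
  have h7 : u * (Real.sinh r * (Real.sinh s - s)) ≤ 1 * (Real.cosh r * (Real.sinh s - s)) :=
    mul_le_mul hu2 (mul_le_mul_of_nonneg_right h4 (sub_nonneg.2 h3))
      (mul_nonneg h5 (sub_nonneg.2 h3)) zero_le_one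
  linarith

variable {Ω : Type*} [MeasurableSpace Ω] {P : Measure Ω} [IsProbabilityMeasure P]

omit [InnerProductSpace ℝ E] in
theorem integrable_cosh_norm {M : Ω → E} (hM : AEStronglyMeasurable M P) {K : ℝ}
    (hK : ∀ᵐ ω ∂P, ‖M ω‖ ≤ K) : Integrable (fun ω => Real.cosh ‖M ω‖) P := by
  refine Integrable.of_bound (C := Real.cosh K)
    (Real.continuous_cosh.comp_aestronglyMeasurable hM.norm) ?_
  filter_upwards [hK] with ω h
  rw [Real.norm_eq_abs, abs_of_pos (Real.cosh_pos _), Real.cosh_le_cosh, abs_norm,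
    abs_of_nonneg ((norm_nonneg _).trans h)]
  exact h

theorem integral_cosh_norm_add_le {M D : Ω → E} (hM : AEStronglyMeasurable M P)
    (hD : AEStronglyMeasurable D P) {K d : ℝ} (hK : ∀ᵐ ω ∂P, ‖M ω‖ ≤ K)
    (hd : ∀ᵐ ω ∂P, ‖D ω‖ ≤ d)
    (horth : ∫ ω, Real.sinh ‖M ω‖ / ‖M ω‖ * ⟪M ω, D ω⟫_ℝ ∂P = 0) :
    ∫ ω, Real.cosh ‖M ω + D ω‖ ∂P ≤ Real.exp (d ^ 2) * ∫ ω, Real.cosh ‖M ω‖ ∂P := by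
  have hMD : ∀ᵐ ω ∂P, ‖M ω + D ω‖ ≤ K + d := by
    filter_upwards [hK, hd] with ω h1 h2 using (norm_add_le _ _).trans (add_le_add h1 h2)
  have hmeas : AEStronglyMeasurable (fun ω => Real.sinh ‖M ω‖ / ‖M ω‖ * ⟪M ω, D ω⟫_ℝ) P := by
    refine AEStronglyMeasurable.mul ?_ (hM.inner hD)
    exact ((Real.measurable_sinh.comp_aemeasurable hM.norm.aemeasurable).div
      hM.norm.aemeasurable).aestronglyMeasurable
  have hint : Integrable (fun ω => Real.sinh ‖M ω‖ / ‖M ω‖ * ⟪M ω, D ω⟫_ℝ) P := by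
    refine Integrable.of_bound (C := Real.cosh K * (K * d)) hmeas ?_
    filter_upwards [hK, hd] with ω h1 h2
    have hK0 := (norm_nonneg _).trans h1
    rw [norm_mul, Real.norm_eq_abs, abs_of_nonneg (Real.sinh_div_self_nonneg (norm_nonneg _))]
    refine mul_le_mul ((Real.sinh_div_self_le_cosh (norm_nonneg _)).trans ?_) ?_ (norm_nonneg _)
      (Real.cosh_pos _).le
    · rwa [Real.cosh_le_cosh, abs_norm, abs_of_nonneg hK0]
    · exact (norm_inner_le_norm _ _).trans (mul_le_mul h1 h2 (norm_nonneg _) hK0)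
  have hcosh := integrable_cosh_norm hM hK
  calc ∫ ω, Real.cosh ‖M ω + D ω‖ ∂P
      ≤ ∫ ω, (Real.exp (d ^ 2) * Real.cosh ‖M ω‖
          + Real.sinh ‖M ω‖ / ‖M ω‖ * ⟪M ω, D ω⟫_ℝ) ∂P := by
        refine integral_mono_ae (integrable_cosh_norm (hM.add hD) hMD)
          ((hcosh.const_mul _).add hint) ?_
        filter_upwards [hd] with ω h
        refine (cosh_norm_add_le _ _).trans (add_le_add_left ?_ _)
        rw [mul_comm]
        refine mul_le_mul_of_nonneg_right ?_ (Real.cosh_pos _).le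
        refine (Real.exp_sub_le_exp_sq (norm_nonneg _)).trans (Real.exp_le_exp.2 ?_)
        exact pow_le_pow_left₀ (norm_nonneg _) h 2
    _ = _ := by rw [integral_add (hcosh.const_mul _) hint, horth, add_zero, integral_const_mul]

/-- Pinelis' inequality for a martingale with bounded increments in a Hilbert space. -/
theorem measure_le_norm_le_of_martingale {M D : ℕ → Ω → E} (hM0 : ∀ ω, M 0 ω = 0)
    (hMD : ∀ n ω, M (n + 1) ω = M n ω + D n ω) (hD : ∀ n, AEStronglyMeasurable (D n) P) {d : ℝ}
    (hd : ∀ n, ∀ᵐ ω ∂P, ‖D n ω‖ ≤ d)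
    (horth : ∀ n, ∀ h : ℝ → ℝ, Measurable h → (∃ K, ∀ᵐ ω ∂P, |h ‖M n ω‖| ≤ K) →
      ∫ ω, h ‖M n ω‖ * ⟪M n ω, D n ω⟫_ℝ ∂P = 0) (n : ℕ) {l : ℝ} (hl : 0 < l) (r : ℝ) :
    P {ω | r ≤ ‖M n ω‖} ≤ ENNReal.ofReal (2 * Real.exp (-(l * r) + n * (l * d) ^ 2)) := by
  have hM : ∀ n, AEStronglyMeasurable (M n) P := fun n => by
    induction n with
    | zero => exact aestronglyMeasurable_const (b := (0 : E)) |>.congr (.of_forall fun ω => (hM0 ω).symm)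
    | succ n ih => exact (ih.add (hD n)).congr (.of_forall fun ω => (hMD n ω).symm)
  have hbd : ∀ n : ℕ, ∀ᵐ ω ∂P, ‖M n ω‖ ≤ n * d := fun n => by
    induction n with
    | zero => exact .of_forall fun ω => by simp [hM0]
    | succ n ih =>
      filter_upwards [ih, hd n] with ω h1 h2
      rw [hMD]
      push_cast
      linarith [norm_add_le (M n ω) (D n ω)]
  have hlM : ∀ n : ℕ, ∀ᵐ ω ∂P, ‖l • M n ω‖ ≤ l * (n * d) := fun n => by
    filter_upwards [hbd n] with ω h
    rw [norm_smul, Real.norm_eq_abs, abs_of_pos hl]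
    gcongr
  have hexp : ∀ n : ℕ, ∫ ω, Real.cosh ‖l • M n ω‖ ∂P ≤ Real.exp (n * (l * d) ^ 2) := fun n => by
    induction n with
    | zero => simp [hM0]
    | succ n ih =>
      have hld : ∀ᵐ ω ∂P, ‖l • D n ω‖ ≤ l * d := by
        filter_upwards [hd n] with ω h
        rw [norm_smul, Real.norm_eq_abs, abs_of_pos hl]
        gcongr
      have hz : ∫ ω, Real.sinh ‖l • M n ω‖ / ‖l • M n ω‖ * ⟪l • M n ω, l • D n ω⟫_ℝ ∂P = 0 := by
        -- Orthogonality of the increment is needed only against radial multiples of `M n`; this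
        -- multiplier is the one from the `cosh` inequality for `l • M n`.
        have h1 := horth n (fun s => l ^ 2 * (Real.sinh (l * s) / (l * s)))
          (((Real.measurable_sinh.comp (measurable_id.const_mul l)).div
            (measurable_id.const_mul l)).const_mul _)
          ⟨l ^ 2 * Real.cosh (l * (n * d)), by
            filter_upwards [hbd n] with ω h
            have h0 : 0 ≤ l * ‖M n ω‖ := by positivity
            rw [abs_mul, abs_of_nonneg (sq_nonneg l), abs_of_nonneg (Real.sinh_div_self_nonneg h0)]
            refine mul_le_mul_of_nonneg_left ?_ (sq_nonneg l)
            refine (Real.sinh_div_self_le_cosh h0).trans ?_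
            have h2 : l * ‖M n ω‖ ≤ l * (n * d) := by gcongr
            rwa [Real.cosh_le_cosh, abs_of_nonneg h0, abs_of_nonneg (h0.trans h2)]⟩
        rw [← h1]
        refine integral_congr_ae (.of_forall fun ω => ?_)
        simp only [norm_smul, Real.norm_eq_abs, abs_of_pos hl, inner_smul_left, inner_smul_right]
        simp
        ring
      have h2 := integral_cosh_norm_add_le ((hM n).const_smul l) ((hD n).const_smul l) (hlM n) hld hz
      simp only [Pi.smul_apply] at h2
      simp only [hMD, smul_add]
      refine h2.trans ((mul_le_mul_of_nonneg_left ih (Real.exp_pos _).le).trans_eq ?_)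
      rw [← Real.exp_add]
      push_cast
      ring_nf
  have hmk := mul_meas_ge_le_integral_of_nonneg (μ := P)
    (f := fun ω => 2 * Real.cosh ‖l • M n ω‖)
    (.of_forall fun ω => by have := Real.cosh_pos ‖l • M n ω‖; positivity)
    ((integrable_cosh_norm ((hM n).const_smul l) (hlM n)).const_mul 2) (Real.exp (l * r))
  rw [integral_const_mul] at hmk
  have hsub : P.real {ω | r ≤ ‖M n ω‖} ≤ P.real {ω | Real.exp (l * r) ≤ 2 * Real.cosh ‖l • M n ω‖} := by
    refine measureReal_mono fun ω hω => ?_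
    simp only [Set.mem_ofPred_eq] at hω ⊢
    rw [Real.cosh_eq, norm_smul, Real.norm_eq_abs, abs_of_pos hl]
    have h1 : Real.exp (l * r) ≤ Real.exp (l * ‖M n ω‖) := Real.exp_le_exp.2 (by gcongr)
    have h2 := Real.exp_pos (-(l * ‖M n ω‖))
    linarith
  rw [← ofReal_measureReal]
  refine ENNReal.ofReal_le_ofReal ?_
  have hpos := Real.exp_pos (l * r)
  have h3 : Real.exp (l * r) * P.real {ω | r ≤ ‖M n ω‖} ≤ 2 * Real.exp (n * (l * d) ^ 2) :=
    (mul_le_mul_of_nonneg_left hsub hpos.le).trans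
      (hmk.trans (mul_le_mul_of_nonneg_left (hexp n) zero_le_two))
  rw [Real.exp_add, Real.exp_neg]
  rw [← le_div_iff₀' hpos] at h3
  refine h3.trans_eq ?_
  field_simp

/-- With `l = √(log n / n)` the exponent in Pinelis' inequality is `-(2 + d²) log n + d² log n = -2
log n`, so the probabilities are `O(n⁻²)` and Borel–Cantelli applies. -/
theorem ae_eventually_norm_le_of_martingale {M D : ℕ → Ω → E} (hM0 : ∀ ω, M 0 ω = 0)
    (hMD : ∀ n ω, M (n + 1) ω = M n ω + D n ω) (hD : ∀ n, AEStronglyMeasurable (D n) P) {d : ℝ}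
    (hd : ∀ n, ∀ᵐ ω ∂P, ‖D n ω‖ ≤ d)
    (horth : ∀ n, ∀ h : ℝ → ℝ, Measurable h → (∃ K, ∀ᵐ ω ∂P, |h ‖M n ω‖| ≤ K) →
      ∫ ω, h ‖M n ω‖ * ⟪M n ω, D n ω⟫_ℝ ∂P = 0) :
    ∀ᵐ ω ∂P, ∀ᶠ n : ℕ in atTop, ‖M n ω‖ ≤ (2 + d ^ 2) * √(n * Real.log n) := by
  have hbound : ∀ n : ℕ, 2 ≤ n → P {ω | (2 + d ^ 2) * √(n * Real.log n) ≤ ‖M n ω‖}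
      ≤ ENNReal.ofReal (2 * (1 / (n : ℝ) ^ 2)) := fun n hn => by
    have hn1 : (1 : ℝ) < n := by exact_mod_cast hn
    have hn0 : (0 : ℝ) < n := by linarith
    have hlog : 0 < Real.log n := Real.log_pos hn1
    have h := measure_le_norm_le_of_martingale hM0 hMD hD hd horth n
      (l := √(Real.log n / n)) (Real.sqrt_pos.2 (by positivity)) ((2 + d ^ 2) * √(n * Real.log n))
    refine h.trans (ENNReal.ofReal_le_ofReal ?_)
    have e1 : √(Real.log n / n) * √(n * Real.log n) = Real.log n := by
      rw [← Real.sqrt_mul (by positivity)]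
      have : Real.log n / n * (n * Real.log n) = Real.log n ^ 2 := by field_simp
      rw [this, Real.sqrt_sq hlog.le]
    have e2 : √(Real.log n / n) ^ 2 = Real.log n / n := Real.sq_sqrt (by positivity)
    have e3 : -(√(Real.log n / n) * ((2 + d ^ 2) * √(n * Real.log n)))
        + n * (√(Real.log n / n) * d) ^ 2 = -(2 * Real.log n) := by
      rw [mul_left_comm, e1, mul_pow, e2]
      field_simp
      ring
    rw [e3, Real.exp_neg, mul_comm 2 (Real.log _), Real.exp_mul, Real.exp_log hn0]
    simp
  have hsum : ∑' n : ℕ, P {ω | (2 + d ^ 2) * √(n * Real.log n) ≤ ‖M n ω‖ ∧ 2 ≤ n} ≠ ⊤ := by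
    have h1 : Summable fun n : ℕ => 2 * (1 / (n : ℝ) ^ 2) :=
      (Real.summable_one_div_nat_pow.2 one_lt_two).mul_left 2
    refine ne_top_of_le_ne_top h1.tsum_ofReal_ne_top (ENNReal.tsum_le_tsum fun n => ?_)
    by_cases hn : 2 ≤ n
    · simpa [hn] using hbound n hn
    · simp [hn]
  filter_upwards [ae_eventually_notMem hsum] with ω hω
  filter_upwards [hω, eventually_ge_atTop 2] with n h1 h2
  simp only [not_and] at h1
  by_contra h3
  exact h1 (not_le.1 h3).le h2

end Pinelis

/-! ### Geometric decay of the powers of the autocorrelation operator. -/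

section PowerBound

variable {B : Type*} [NormedAddCommGroup B] [NormedSpace ℝ B]

theorem exists_norm_pow_le_geometric {ρ : B →L[ℝ] B} {j : ℕ} (hj : 1 ≤ j) (hρ : ‖ρ ^ j‖ < 1) :
    ∃ A a : ℝ, 0 ≤ A ∧ 0 < a ∧ a < 1 ∧ ∀ h, ‖ρ ^ h‖ ≤ A * a ^ h := by
  -- The maximum with `0` keeps `q` positive even when `ρ ^ j = 0`, so that division by powers of `a
  -- = q^(1/j)` is legitimate below.
  obtain ⟨q, hq0, hq⟩ := exists_between (max_lt hρ one_pos)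
  have hq0' : 0 < q := (le_max_right _ _).trans_lt hq0
  have hρq : ‖ρ ^ j‖ ≤ q := ((le_max_left _ _).trans_lt hq0).le
  set a : ℝ := q ^ (1 / (j : ℝ)) with ha
  have ha0 : 0 < a := Real.rpow_pos_of_pos hq0' _
  have ha1 : a < 1 := Real.rpow_lt_one hq0'.le hq (by positivity)
  have haj : a ^ j = q := by
    rw [ha, one_div, Real.rpow_inv_natCast_pow hq0'.le (by omega)]
  set A : ℝ := ∑ r ∈ Finset.range j, ‖ρ ^ r‖ / a ^ r with hA
  have hA0 : 0 ≤ A := Finset.sum_nonneg fun r _ => by positivity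
  refine ⟨A, a, hA0, ha0, ha1, fun h => ?_⟩
  induction h using Nat.strong_induction_on with
  | _ h ih =>
    rcases lt_or_ge h j with hlt | hge
    · rw [← div_le_iff₀ (pow_pos ha0 h)]
      exact Finset.single_le_sum (f := fun r => ‖ρ ^ r‖ / a ^ r) (fun r _ => by positivity)
        (Finset.mem_range.2 hlt)
    · have h1 := ih (h - j) (by omega)
      have h2 : ρ ^ h = ρ ^ j * ρ ^ (h - j) := by rw [← pow_add, Nat.add_sub_cancel' hge]
      have h3 : a ^ h = q * a ^ (h - j) := by rw [← haj, ← pow_add, Nat.add_sub_cancel' hge]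
      rw [h2, h3]
      calc _ ≤ ‖ρ ^ j‖ * ‖ρ ^ (h - j)‖ := norm_mul_le _ _
        _ ≤ q * (A * a ^ (h - j)) := mul_le_mul hρq h1 (norm_nonneg _) hq0'.le
        _ = _ := by ring

end PowerBound

/-! ### The process as a function of the past noise, and independence of past and present. -/

theorem measurable_limUnder_sum_pow {Ω : Type*} [MeasurableSpace Ω] {B : Type*}
    [NormedAddCommGroup B] [NormedSpace ℝ B] [CompleteSpace B] [SecondCountableTopology B]
    [MeasurableSpace B] [BorelSpace B] (ρ : B →L[ℝ] B) {η : ℕ → Ω → B}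
    (hη : ∀ h, Measurable (η h)) :
    Measurable fun ω => limUnder atTop fun m : ℕ => ∑ h ∈ Finset.range m, (ρ ^ h) (η h ω) :=
  (StronglyMeasurable.limUnder fun _ => (Finset.measurable_fun_sum _ fun h _ =>
    (ρ ^ h).continuous.measurable.comp (hη h)).stronglyMeasurable).measurable

namespace IsStandardARB1

variable {Ω : Type*} [MeasurableSpace Ω] {P : Measure Ω} [IsProbabilityMeasure P]
  {B : Type*} [NormedAddCommGroup B] [NormedSpace ℝ B] [CompleteSpace B]
  [SecondCountableTopology B] [MeasurableSpace B] [BorelSpace B]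
  {ρ : B →L[ℝ] B} {ε X : ℤ → Ω → B} {R : ℝ}

omit [IsProbabilityMeasure P] [CompleteSpace B] [SecondCountableTopology B] [BorelSpace B] in
theorem map_eq (hX : IsStandardARB1 P ρ ε X) (n : ℤ) : P.map (X n) = P.map (X 0) := by
  have h := congrArg (fun μ => μ.map (fun x : ℤ → B => x 0)) (hX.stationary n)
  have h1 : Measurable fun ω n => X n ω := measurable_pi_lambda _ hX.measurable
  have h2 : Measurable fun ω i => X (i + n) ω := measurable_pi_lambda _ fun i => hX.measurable _
  simp only [Measure.map_map (measurable_pi_apply 0) h1, Measure.map_map (measurable_pi_apply 0) h2]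
    at h
  simpa [Function.comp_def] using h

omit [IsProbabilityMeasure P] [CompleteSpace B] [SecondCountableTopology B] in
theorem ae_norm_le (hX : IsStandardARB1 P ρ ε X) (hR : ∀ᵐ ω ∂P, ‖X 0 ω‖ ≤ R) (n : ℤ) :
    ∀ᵐ ω ∂P, ‖X n ω‖ ≤ R := by
  have hm : MeasurableSet {b : B | ‖b‖ ≤ R} := measurableSet_le measurable_norm measurable_const
  have h0 : ∀ᵐ b ∂(P.map (X 0)), ‖b‖ ≤ R := (ae_map_iff (hX.measurable 0).aemeasurable hm).2 hR
  rw [← hX.map_eq n] at h0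
  exact (ae_map_iff (hX.measurable n).aemeasurable hm).1 h0

omit [IsProbabilityMeasure P] [CompleteSpace B] in
theorem integral_comp_eq {E : Type*} [NormedAddCommGroup E] [NormedSpace ℝ E]
    (hX : IsStandardARB1 P ρ ε X) {G : B → E} (hG : Continuous G) (n : ℤ) :
    ∫ ω, G (X n ω) ∂P = ∫ ω, G (X 0 ω) ∂P := by
  rw [← integral_map (hX.measurable n).aemeasurable hG.stronglyMeasurable.aestronglyMeasurable,
    ← integral_map (hX.measurable 0).aemeasurable hG.stronglyMeasurable.aestronglyMeasurable,
    hX.map_eq n]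

omit [IsProbabilityMeasure P] [CompleteSpace B] [SecondCountableTopology B] in
theorem ae_norm_noise_le (hX : IsStandardARB1 P ρ ε X) (hR : ∀ᵐ ω ∂P, ‖X 0 ω‖ ≤ R) (n : ℤ) :
    ∀ᵐ ω ∂P, ‖ε n ω‖ ≤ R + ‖ρ‖ * R := by
  filter_upwards [hX.ae_norm_le hR n, hX.ae_norm_le hR (n - 1), hX.state n] with ω h1 h2 h3
  have h4 : ε n ω = X n ω - ρ (X (n - 1) ω) := by rw [h3]; abel
  rw [h4]
  refine (norm_sub_le _ _).trans (add_le_add h1 ((ρ.le_opNorm _).trans ?_))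
  gcongr

-- Iterating the state equation `m` times leaves the remainder `ρ^m X_{n-m}`, which is at most `A
-- a^m R` because the process is almost surely bounded.
omit [IsProbabilityMeasure P] [CompleteSpace B] [SecondCountableTopology B] in
theorem ae_tendsto_sum (hX : IsStandardARB1 P ρ ε X) (hR : ∀ᵐ ω ∂P, ‖X 0 ω‖ ≤ R) (n : ℤ) :
    ∀ᵐ ω ∂P, Tendsto (fun m : ℕ => ∑ h ∈ Finset.range m, (ρ ^ h) (ε (n - h) ω)) atTop
      (𝓝 (X n ω)) := by
  obtain ⟨j, hj, hρj⟩ := hX.contraction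
  obtain ⟨A, a, hA, ha0, ha1, hpow⟩ := exists_norm_pow_le_geometric hj hρj
  filter_upwards [ae_all_iff.2 hX.state, ae_all_iff.2 (hX.ae_norm_le hR)] with ω hs hb
  have hrep : ∀ m : ℕ, X n ω - ∑ h ∈ Finset.range m, (ρ ^ h) (ε (n - h) ω)
      = (ρ ^ m) (X (n - m) ω) := fun m => by
    induction m with
    | zero => simp
    | succ m ih =>
      rw [Finset.sum_range_succ, ← sub_sub, ih, hs (n - m), map_add, add_sub_cancel_right, pow_succ]
      have : n - (m : ℤ) - 1 = n - ((m + 1 : ℕ) : ℤ) := by push_cast; ring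
      rw [this]
      rfl
  rw [tendsto_iff_norm_sub_tendsto_zero]
  have h0 : Tendsto (fun m : ℕ => A * a ^ m * R) atTop (𝓝 0) := by
    simpa using ((tendsto_pow_atTop_nhds_zero_of_lt_one ha0.le ha1).const_mul A).mul_const R
  refine squeeze_zero (fun _ => norm_nonneg _) (fun m => ?_) h0
  rw [norm_sub_rev, hrep]
  exact ((ρ ^ m).le_opNorm _).trans (mul_le_mul (hpow m) (hb _) (norm_nonneg _) (by positivity))

omit [IsProbabilityMeasure P] in
/-- The observations before time `n`, latest first, are independent of the noise at time `n`. -/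
theorem indepFun_past_noise (hX : IsStandardARB1 P ρ ε X) (hR : ∀ᵐ ω ∂P, ‖X 0 ω‖ ≤ R) (n : ℤ) :
    IndepFun (fun ω (j : ℕ) => X (n - 1 - j) ω) (ε n) P := by
  -- The observations equal the moving-average series only almost surely. This version is a genuine
  -- limit of functions of the noise, hence measurable for the σ-algebra of the noise before `n`.
  let Y : Ω → ℕ → B := fun ω j =>
    limUnder atTop fun m : ℕ => ∑ h ∈ Finset.range m, (ρ ^ h) (ε (n - 1 - j - h) ω)
  have hYX : Y =ᵐ[P] fun ω (j : ℕ) => X (n - 1 - j) ω := by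
    filter_upwards [ae_all_iff.2 (hX.ae_tendsto_sum hR)] with ω h
    funext j
    exact (h _).limUnder_eq
  let m : ℤ → MeasurableSpace Ω := fun i => MeasurableSpace.comap (ε i) inferInstance
  have hind : Indep (⨆ i ∈ Set.Iio n, m i) (⨆ i ∈ ({n} : Set ℤ), m i) P :=
    indep_iSup_of_disjoint (fun i => (hX.noise.measurable i).comap_le) hX.noise.indep (by simp)
  refine IndepFun.congr ?_ hYX (ae_eq_refl (ε n))
  refine indep_of_indep_of_le_left (indep_of_indep_of_le_right hind ?_) ?_
  · exact le_iSup₂_of_le n rfl le_rfl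
  · rw [← measurable_iff_comap_le]
    refine @measurable_pi_lambda _ _ _ (⨆ i ∈ Set.Iio n, m i) _ _ fun j => ?_
    refine @measurable_limUnder_sum_pow Ω (⨆ i ∈ Set.Iio n, m i) _ _ _ _ _ _ _ ρ _ fun h => ?_
    have hle : m (n - 1 - j - h) ≤ ⨆ i ∈ Set.Iio n, m i :=
      le_iSup₂_of_le (n - 1 - j - h) (Set.mem_Iio.2 (by omega)) le_rfl
    exact (comap_measurable _).mono hle le_rfl

theorem integral_past_noise_eq_zero {E : Type*} [NormedAddCommGroup E] [NormedSpace ℝ E]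
    (hX : IsStandardARB1 P ρ ε X) (hR : ∀ᵐ ω ∂P, ‖X 0 ω‖ ≤ R) (n : ℤ) {f : (ℕ → B) × B → E}
    (hf : StronglyMeasurable f) (h0 : ∀ y, ∫ ω, f (y, ε n ω) ∂P = 0) :
    ∫ ω, f (fun j : ℕ => X (n - 1 - j) ω, ε n ω) ∂P = 0 := by
  have hpm : Measurable fun ω (j : ℕ) => X (n - 1 - j) ω :=
    measurable_pi_lambda _ fun j => hX.measurable _
  have hεm := hX.noise.measurable n
  have hprod := (indepFun_iff_map_prod_eq_prod_map_map hpm.aemeasurable hεm.aemeasurable).1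
    (hX.indepFun_past_noise hR n)
  -- No integrability assumption is needed: the Bochner integral of a non-integrable function is
  -- `0`. Otherwise the claim is Fubini for the product law, with the past frozen.
  by_cases hi : Integrable (fun ω => f (fun j : ℕ => X (n - 1 - j) ω, ε n ω)) P
  swap
  · exact integral_undef hi
  have hi' : Integrable f ((P.map fun ω (j : ℕ) => X (n - 1 - j) ω).prod (P.map (ε n))) := by
    rw [← hprod]
    exact (integrable_map_measure hf.aestronglyMeasurable (hpm.prodMk hεm).aemeasurable).2 hi
  have : IsProbabilityMeasure (P.map (ε n)) := Measure.isProbabilityMeasure_map hεm.aemeasurable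
  rw [← integral_map (f := f) (hpm.prodMk hεm).aemeasurable hf.aestronglyMeasurable, hprod,
    integral_prod _ hi']
  refine integral_eq_zero_of_ae (.of_forall fun y => ?_)
  change ∫ e, f (y, e) ∂(P.map (ε n)) = 0
  rw [integral_map hεm.aemeasurable]
  · exact h0 y
  · exact (hf.comp_measurable measurable_prodMk_left).aestronglyMeasurable

end IsStandardARB1

/-! ### The Poisson equation for quadratic functions of the process. -/

section PoissonEquation

set_option maxSynthPendingDepth 5

variable {B : Type*} [NormedAddCommGroup B] [NormedSpace ℝ B]
  {E : Type*} [NormedAddCommGroup E] [NormedSpace ℝ E]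

/-- The solution `∑ h, β (ρ^h x) (ρ^h y)` of the Poisson equation `U (x, y) - U (ρ x, ρ y) = β (x, y)`
for a bounded bilinear map `β`. -/
def poissonForm (ρ : B →L[ℝ] B) (β : B →L[ℝ] B →L[ℝ] E) : B →L[ℝ] B →L[ℝ] E :=
  ∑' h : ℕ, β.bilinearComp (ρ ^ h) (ρ ^ h)

variable [CompleteSpace E] {ρ : B →L[ℝ] B} {A a : ℝ}

theorem hasSum_poissonForm (hA : 0 ≤ A) (ha0 : 0 ≤ a) (ha1 : a < 1)
    (hpow : ∀ h, ‖ρ ^ h‖ ≤ A * a ^ h) (β : B →L[ℝ] B →L[ℝ] E) (x y : B) :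
    HasSum (fun h : ℕ => β ((ρ ^ h) x) ((ρ ^ h) y)) (poissonForm ρ β x y) := by
  have hs : Summable fun h : ℕ => β.bilinearComp (ρ ^ h) (ρ ^ h) := by
    have hg : Summable fun h : ℕ => ‖β‖ * (A * A) * (a * a) ^ h :=
      (summable_geometric_of_lt_one (by positivity) (by nlinarith)).mul_left _
    refine Summable.of_norm_bounded hg fun h => ?_
    refine ContinuousLinearMap.opNorm_le_bound₂ _ (by positivity) fun x y => ?_
    rw [ContinuousLinearMap.bilinearComp_apply]
    have hx := (ρ ^ h).le_of_opNorm_le (hpow h) x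
    have hy := (ρ ^ h).le_of_opNorm_le (hpow h) y
    calc _ ≤ ‖β‖ * ‖(ρ ^ h) x‖ * ‖(ρ ^ h) y‖ := β.le_opNorm₂ _ _
      _ ≤ ‖β‖ * (A * a ^ h * ‖x‖) * (A * a ^ h * ‖y‖) := by gcongr
      _ = ‖β‖ * (A * A) * (a * a) ^ h * ‖x‖ * ‖y‖ := by rw [mul_pow]; ring
  have h1 := (hs.hasSum.mapL (ContinuousLinearMap.apply ℝ (B →L[ℝ] E) x)).mapL
    (ContinuousLinearMap.apply ℝ E y)
  exact h1

/-- Replacing `(x, y)` by `(ρ x, ρ y)` shifts the series by one, so only the term `h = 0` survives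
in the difference. -/
theorem poissonForm_sub (hA : 0 ≤ A) (ha0 : 0 ≤ a) (ha1 : a < 1)
    (hpow : ∀ h, ‖ρ ^ h‖ ≤ A * a ^ h) (β : B →L[ℝ] B →L[ℝ] E) (x y : B) :
    poissonForm ρ β x y - poissonForm ρ β (ρ x) (ρ y) = β x y := by
  have h1 := hasSum_poissonForm hA ha0 ha1 hpow β x y
  have h2 := hasSum_poissonForm hA ha0 ha1 hpow β (ρ x) (ρ y)
  have h3 := (hasSum_nat_add_iff' 1).2 h1
  have h4 : ∀ h : ℕ, β ((ρ ^ (h + 1)) x) ((ρ ^ (h + 1)) y) = β ((ρ ^ h) (ρ x)) ((ρ ^ h) (ρ y)) :=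
    fun h => by rw [pow_succ]; rfl
  simp only [h4] at h3
  have h5 := h3.unique h2
  rw [← h5]
  simp

end PoissonEquation

/-! ### Martingale approximation of centred quadratic sums. -/

namespace IsStandardARB1

variable {Ω : Type*} [MeasurableSpace Ω] {P : Measure Ω} [IsProbabilityMeasure P]
  {B : Type*} [NormedAddCommGroup B] [NormedSpace ℝ B] [CompleteSpace B]
  [SecondCountableTopology B] [MeasurableSpace B] [BorelSpace B]
  {ρ : B →L[ℝ] B} {ε X : ℤ → Ω → B} {R : ℝ}
  {E : Type*} [NormedAddCommGroup E]

omit [CompleteSpace B] in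
theorem integrable_comp (hX : IsStandardARB1 P ρ ε X) (hR : ∀ᵐ ω ∂P, ‖X 0 ω‖ ≤ R) (n : ℤ)
    {G : B → E} (hG : Continuous G) {M : ℝ} (hM : ∀ b, ‖b‖ ≤ R → ‖G b‖ ≤ M) :
    Integrable (fun ω => G (X n ω)) P := by
  refine Integrable.of_bound (C := M)
    (hG.stronglyMeasurable.comp_measurable (hX.measurable n)).aestronglyMeasurable ?_
  filter_upwards [hX.ae_norm_le hR n] with ω h using hM _ h

omit [CompleteSpace B] in
theorem integrable_comp_noise (hX : IsStandardARB1 P ρ ε X) (hR : ∀ᵐ ω ∂P, ‖X 0 ω‖ ≤ R) (n : ℤ)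
    {G : B → E} (hG : Continuous G) {M : ℝ} (hM : ∀ b, ‖b‖ ≤ R + ‖ρ‖ * R → ‖G b‖ ≤ M) :
    Integrable (fun ω => G (ε n ω)) P := by
  refine Integrable.of_bound (C := M)
    (hG.stronglyMeasurable.comp_measurable (hX.noise.measurable n)).aestronglyMeasurable ?_
  filter_upwards [hX.ae_norm_noise_le hR n] with ω h using hM _ h

variable [InnerProductSpace ℝ E]

omit [CompleteSpace B] [SecondCountableTopology B] [MeasurableSpace B] [BorelSpace B] in
theorem norm_bilin_le (β : B →L[ℝ] B →L[ℝ] E) {x y : B} {r s : ℝ} (hx : ‖x‖ ≤ r) (hy : ‖y‖ ≤ s) :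
    ‖β x y‖ ≤ ‖β‖ * r * s := by
  have hr := (norm_nonneg x).trans hx
  exact (β.le_opNorm₂ _ _).trans (by gcongr)

variable [CompleteSpace E]

omit [SecondCountableTopology B] [BorelSpace B] in
theorem integral_bilin_noise (hX : IsStandardARB1 P ρ ε X) (n : ℤ)
    (L : B →L[ℝ] E) : Integrable (fun ω => L (ε n ω)) P ∧ ∫ ω, L (ε n ω) ∂P = 0 := by
  have hi : Integrable (ε n) P := (hX.noise.memLp n).integrable (by norm_num)
  refine ⟨L.integrable_comp hi, ?_⟩
  rw [ContinuousLinearMap.integral_comp_comm _ hi, hX.noise.mean_zero, map_zero]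

/-- The covariance relation of the state equation, in integrated form. -/
theorem integral_bilin_eq (hX : IsStandardARB1 P ρ ε X) (hR : ∀ᵐ ω ∂P, ‖X 0 ω‖ ≤ R) (n : ℤ)
    (U : B →L[ℝ] B →L[ℝ] E) :
    ∫ ω, U (X 0 ω) (X 0 ω) ∂P
      = ∫ ω, U (ρ (X 0 ω)) (ρ (X 0 ω)) ∂P + ∫ ω, U (ε n ω) (ε n ω) ∂P := by
  have hR0 : 0 ≤ R := by
    obtain ⟨ω, hω⟩ := hR.exists
    exact (norm_nonneg _).trans hω
  have hc : ∀ W : B →L[ℝ] B →L[ℝ] E, Continuous fun b => W b b := fun W => by fun_prop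
  have i1 : Integrable (fun ω => U (ρ (X (n - 1) ω)) (ρ (X (n - 1) ω))) P := by
    refine hX.integrable_comp hR (n - 1) (G := fun b => U (ρ b) (ρ b)) (by fun_prop)
      (M := ‖U‖ * (‖ρ‖ * R) * (‖ρ‖ * R)) fun b hb => ?_
    have : ‖ρ b‖ ≤ ‖ρ‖ * R := (ρ.le_opNorm b).trans (by gcongr)
    exact norm_bilin_le U this this
  have i2 : Integrable (fun ω => U (ε n ω) (ε n ω)) P :=
    hX.integrable_comp_noise hR n (hc U) fun b hb => norm_bilin_le U hb hb
  have i0 : Integrable (fun ω => U (X n ω) (X n ω)) P :=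
    hX.integrable_comp hR n (hc U) fun b hb => norm_bilin_le U hb hb
  -- The cross terms vanish, as the noise is centred and independent of the past.
  have hcross : ∫ ω, (U (ρ (X (n - 1) ω)) (ε n ω) + U (ε n ω) (ρ (X (n - 1) ω))) ∂P = 0 := by
    have h := hX.integral_past_noise_eq_zero hR n
      (f := fun p => U (ρ (p.1 0)) p.2 + U p.2 (ρ (p.1 0)))
      (Continuous.stronglyMeasurable (by fun_prop)) (fun y => by
        obtain ⟨j1, j2⟩ := hX.integral_bilin_noise n (U (ρ (y 0)))
        obtain ⟨j3, j4⟩ := hX.integral_bilin_noise n (U.flip (ρ (y 0)))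
        simp only [ContinuousLinearMap.flip_apply] at j3 j4
        rw [integral_add j1 j3, j2, j4, add_zero])
    simpa using h
  have hst : ∀ᵐ ω ∂P, U (X n ω) (X n ω) - U (ρ (X (n - 1) ω)) (ρ (X (n - 1) ω)) - U (ε n ω) (ε n ω)
      = U (ρ (X (n - 1) ω)) (ε n ω) + U (ε n ω) (ρ (X (n - 1) ω)) := by
    filter_upwards [hX.state n] with ω h
    rw [h]
    simp only [map_add, add_apply]
    abel
  have h1 := integral_congr_ae hst
  have i01 : Integrable
    (fun ω => U (X n ω) (X n ω) - U (ρ (X (n - 1) ω)) (ρ (X (n - 1) ω))) P := i0.sub i1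
  rw [hcross, integral_sub i01 i2, integral_sub i0 i1,
    hX.integral_comp_eq (hc U) n,
    hX.integral_comp_eq (G := fun b => U (ρ b) (ρ b)) (by fun_prop) (n - 1)] at h1
  rw [← sub_eq_zero, ← sub_sub]
  exact h1

/-- The increments of the martingale that approximates `∑ i, (β (X i) (X i) - E β (X 0) (X 0))`;
`U` is the solution of the Poisson equation for `β`. -/
def increment (_ : IsStandardARB1 P ρ ε X) (U : B →L[ℝ] B →L[ℝ] E) (n : ℤ) (ω : Ω) : E :=
  U (X n ω) (X n ω) - U (ρ (X (n - 1) ω)) (ρ (X (n - 1) ω)) - ∫ ω, U (ε n ω) (ε n ω) ∂P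

/-- The state equation writes the increment as `U(ρ X, ε) + U(ε, ρ X) + U(ε, ε) - E U(ε, ε)`, which
has mean zero for every frozen value of the past. -/
theorem integral_inner_past_increment (hX : IsStandardARB1 P ρ ε X)
    (hR : ∀ᵐ ω ∂P, ‖X 0 ω‖ ≤ R) (U : B →L[ℝ] B →L[ℝ] E) (n : ℤ) {G : (ℕ → B) → E}
    (hG : StronglyMeasurable G) :
    ∫ ω, ⟪G (fun j : ℕ => X (n - 1 - j) ω), hX.increment U n ω⟫_ℝ ∂P = 0 := by
  set κ := ∫ ω, U (ε n ω) (ε n ω) ∂P with hκ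
  have h := hX.integral_past_noise_eq_zero hR n
    (f := fun p => ⟪G p.1, U (ρ (p.1 0)) p.2 + U p.2 (ρ (p.1 0)) + U p.2 p.2 - κ⟫_ℝ)
    ((hG.comp_measurable measurable_fst).inner (Continuous.stronglyMeasurable (by fun_prop)))
    (fun y => by
      obtain ⟨j1, j2⟩ := hX.integral_bilin_noise n (U (ρ (y 0)))
      obtain ⟨j3, j4⟩ := hX.integral_bilin_noise n (U.flip (ρ (y 0)))
      simp only [ContinuousLinearMap.flip_apply] at j3 j4
      have j5 : Integrable (fun ω => U (ε n ω) (ε n ω)) P :=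
        hX.integrable_comp_noise hR n (G := fun b => U b b) (by fun_prop)
          fun b hb => norm_bilin_le U hb hb
      have j6 : Integrable (fun ω => U (ρ (y 0)) (ε n ω) + U (ε n ω) (ρ (y 0))) P := j1.add j3
      have j7 : Integrable
        (fun ω => U (ρ (y 0)) (ε n ω) + U (ε n ω) (ρ (y 0)) + U (ε n ω) (ε n ω)) P := j6.add j5
      have j8 : Integrable (fun ω => U (ρ (y 0)) (ε n ω) + U (ε n ω) (ρ (y 0))
        + U (ε n ω) (ε n ω) - κ) P := j7.sub (integrable_const κ)
      dsimp only
      rw [integral_inner j8, integral_sub j7 (integrable_const κ), integral_add j6 j5,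
        integral_add j1 j3, j2, j4, ← hκ]
      simp)
  rw [← h]
  refine integral_congr_ae ?_
  filter_upwards [hX.state n] with ω hs
  have : hX.increment U n ω = U (ρ (X (n - 1) ω)) (ε n ω) + U (ε n ω) (ρ (X (n - 1) ω))
      + U (ε n ω) (ε n ω) - κ := by
    rw [increment, ← hκ, hs]
    simp only [map_add, add_apply]
    abel
  simp only [this, Nat.cast_zero, sub_zero]

/-- The martingale `∑ i < n, increment (i + 1)`. -/
def martingale (hX : IsStandardARB1 P ρ ε X) (U : B →L[ℝ] B →L[ℝ] E) (n : ℕ) (ω : Ω) : E :=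
  ∑ i ∈ Finset.range n, hX.increment U (i + 1) ω

theorem martingale_orthogonal (hX : IsStandardARB1 P ρ ε X) (hR : ∀ᵐ ω ∂P, ‖X 0 ω‖ ≤ R)
    (U : B →L[ℝ] B →L[ℝ] E) (n : ℕ) {h : ℝ → ℝ} (hh : Measurable h) :
    ∫ ω, h ‖hX.martingale U n ω‖ * ⟪hX.martingale U n ω, hX.increment U (n + 1) ω⟫_ℝ ∂P = 0 := by
  -- The coordinate `y j` stands for `X (n - j)`, so `X (i + 1)` is read at `n - i - 1` and `X i` at
  -- `n - i`; the truncated subtractions are exact because `i < n`.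
  let g : (ℕ → B) → E := fun y => ∑ i ∈ Finset.range n,
    (U (y (n - i - 1)) (y (n - i - 1)) - U (ρ (y (n - i))) (ρ (y (n - i)))
      - ∫ ω, U (ε ((i : ℤ) + 1) ω) (ε ((i : ℤ) + 1) ω) ∂P)
  have hg : StronglyMeasurable g := Continuous.stronglyMeasurable (by fun_prop)
  have hgm : ∀ ω, g (fun j : ℕ => X ((n : ℤ) + 1 - 1 - j) ω) = hX.martingale U n ω := fun ω => by
    refine Finset.sum_congr rfl fun i hi => ?_
    have hin := Finset.mem_range.1 hi
    have e1 : (n : ℤ) + 1 - 1 - ((n - i - 1 : ℕ) : ℤ) = i + 1 := by omega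
    have e2 : (n : ℤ) + 1 - 1 - ((n - i : ℕ) : ℤ) = i + 1 - 1 := by omega
    simp only [increment, e1, e2]
  have hG : StronglyMeasurable fun y => h ‖g y‖ • g y :=
    (hh.comp hg.norm.measurable).stronglyMeasurable.smul hg
  have key := hX.integral_inner_past_increment hR U (n + 1) hG
  simp only [hgm] at key
  simpa [inner_smul_left] using key

/-- By stationarity the noise mean of `U` is `E[U(X, X) - U(ρ X, ρ X)]`, and the Poisson equation
identifies the integrand with `β`. Thus the constant that centres the increments also centres the
sums. -/
theorem integral_poissonForm_noise (hX : IsStandardARB1 P ρ ε X) (hR : ∀ᵐ ω ∂P, ‖X 0 ω‖ ≤ R)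
    {A a : ℝ} (hA : 0 ≤ A) (ha0 : 0 ≤ a) (ha1 : a < 1) (hpow : ∀ h, ‖ρ ^ h‖ ≤ A * a ^ h)
    (β : B →L[ℝ] B →L[ℝ] E) (n : ℤ) :
    ∫ ω, poissonForm ρ β (ε n ω) (ε n ω) ∂P = ∫ ω, β (X 0 ω) (X 0 ω) ∂P := by
  set U := poissonForm ρ β with hU
  have hsub : ∀ x, U x x - U (ρ x) (ρ x) = β x x := fun x => poissonForm_sub hA ha0 ha1 hpow β x x
  have h1 := hX.integral_bilin_eq hR n U
  have hR0 : 0 ≤ R := by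
    obtain ⟨ω, hω⟩ := hR.exists
    exact (norm_nonneg _).trans hω
  have i0 : Integrable (fun ω => U (X 0 ω) (X 0 ω)) P :=
    hX.integrable_comp hR 0 (G := fun b => U b b) (by fun_prop) fun b hb => norm_bilin_le U hb hb
  have i1 : Integrable (fun ω => U (ρ (X 0 ω)) (ρ (X 0 ω))) P := by
    refine hX.integrable_comp hR 0 (G := fun b => U (ρ b) (ρ b)) (by fun_prop)
      (M := ‖U‖ * (‖ρ‖ * R) * (‖ρ‖ * R)) fun b hb => ?_
    have : ‖ρ b‖ ≤ ‖ρ‖ * R := (ρ.le_opNorm b).trans (by gcongr)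
    exact norm_bilin_le U this this
  simp only [← hsub]
  rw [integral_sub i0 i1, h1]
  abel

/-- Each centred term is the increment at `i + 1` plus `U(X i, X i) - U(X (i + 1), X (i + 1))`, and
the latter telescopes. The last term `i = n` is left as it stands, so that the martingale stops at
time `n`. -/
theorem sum_sub_eq_martingale (hX : IsStandardARB1 P ρ ε X) (hR : ∀ᵐ ω ∂P, ‖X 0 ω‖ ≤ R)
    {A a : ℝ} (hA : 0 ≤ A) (ha0 : 0 ≤ a) (ha1 : a < 1) (hpow : ∀ h, ‖ρ ^ h‖ ≤ A * a ^ h)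
    (β : B →L[ℝ] B →L[ℝ] E) (n : ℕ) (ω : Ω) :
    ∑ i ∈ Finset.range (n + 1), (β (X i ω) (X i ω) - ∫ ω, β (X 0 ω) (X 0 ω) ∂P)
      = poissonForm ρ β (X 0 ω) (X 0 ω) - poissonForm ρ β (X n ω) (X n ω) + β (X n ω) (X n ω)
        + hX.martingale (poissonForm ρ β) n ω - ∫ ω, β (X 0 ω) (X 0 ω) ∂P := by
  induction n with
  | zero => simp [martingale]
  | succ n ih =>
    rw [Finset.sum_range_succ, ih, martingale, martingale, Finset.sum_range_succ, increment,
      hX.integral_poissonForm_noise hR hA ha0 ha1 hpow]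
    have h2 := poissonForm_sub hA ha0 ha1 hpow β (X n ω) (X n ω)
    have e : ((n : ℤ) + 1 - 1) = n := by ring
    rw [e, ← h2]
    push_cast
    abel

end IsStandardARB1

/-! ### Law of large numbers with rate. -/

namespace IsStandardARB1

variable {Ω : Type*} [MeasurableSpace Ω] {P : Measure Ω} [IsProbabilityMeasure P]
  {B : Type*} [NormedAddCommGroup B] [NormedSpace ℝ B] [CompleteSpace B]
  [SecondCountableTopology B] [MeasurableSpace B] [BorelSpace B]
  {ρ : B →L[ℝ] B} {ε X : ℤ → Ω → B} {R : ℝ}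

section

variable {E : Type*} [NormedAddCommGroup E] [InnerProductSpace ℝ E] [CompleteSpace E]

omit [IsProbabilityMeasure P] [CompleteSpace B] [CompleteSpace E] in
theorem aestronglyMeasurable_increment (hX : IsStandardARB1 P ρ ε X)
    (U : B →L[ℝ] B →L[ℝ] E) (n : ℤ) : AEStronglyMeasurable (hX.increment U n) P := by
  have h1 : StronglyMeasurable fun ω => U (X n ω) (X n ω) :=
    (Continuous.stronglyMeasurable (f := fun b => U b b) (by fun_prop)).comp_measurable
      (hX.measurable n)
  have h2 : StronglyMeasurable fun ω => U (ρ (X (n - 1) ω)) (ρ (X (n - 1) ω)) :=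
    (Continuous.stronglyMeasurable (f := fun b => U (ρ b) (ρ b)) (by fun_prop)).comp_measurable
      (hX.measurable (n - 1))
  exact ((h1.sub h2).sub stronglyMeasurable_const).aestronglyMeasurable

omit [CompleteSpace B] [SecondCountableTopology B] [CompleteSpace E] in
theorem ae_norm_increment_le (hX : IsStandardARB1 P ρ ε X) (hR : ∀ᵐ ω ∂P, ‖X 0 ω‖ ≤ R)
    (U : B →L[ℝ] B →L[ℝ] E) (n : ℤ) :
    ∀ᵐ ω ∂P, ‖hX.increment U n ω‖ ≤ ‖U‖ * R * R + ‖U‖ * (‖ρ‖ * R) * (‖ρ‖ * R)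
      + ‖U‖ * (R + ‖ρ‖ * R) * (R + ‖ρ‖ * R) := by
  have h1 : ‖∫ ω, U (ε n ω) (ε n ω) ∂P‖ ≤ ‖U‖ * (R + ‖ρ‖ * R) * (R + ‖ρ‖ * R) := by
    refine (norm_integral_le_of_norm_le_const (C := ‖U‖ * (R + ‖ρ‖ * R) * (R + ‖ρ‖ * R)) ?_).trans
      (by simp)
    filter_upwards [hX.ae_norm_noise_le hR n] with ω h using norm_bilin_le U h h
  filter_upwards [hX.ae_norm_le hR n, hX.ae_norm_le hR (n - 1)] with ω h2 h3
  have h4 : ‖ρ (X (n - 1) ω)‖ ≤ ‖ρ‖ * R := (ρ.le_opNorm _).trans (by gcongr)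
  refine (norm_sub_le _ _).trans (add_le_add ((norm_sub_le _ _).trans ?_) h1)
  exact add_le_add (norm_bilin_le U h2 h2) (norm_bilin_le U h4 h4)

omit [IsProbabilityMeasure P] [CompleteSpace B] [SecondCountableTopology B] [MeasurableSpace B]
  [BorelSpace B] [CompleteSpace E] in
theorem martingale_succ {_ : MeasurableSpace B} (hX : IsStandardARB1 P ρ ε X)
    (U : B →L[ℝ] B →L[ℝ] E) (n : ℕ) (ω : Ω) :
    hX.martingale U (n + 1) ω = hX.martingale U n ω + hX.increment U (n + 1) ω :=
  Finset.sum_range_succ _ _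

/-- Law of large numbers with rate for bounded quadratic functions of the observations. -/
theorem ae_eventually_norm_sum_le (hX : IsStandardARB1 P ρ ε X) (hR : ∀ᵐ ω ∂P, ‖X 0 ω‖ ≤ R)
    (β : B →L[ℝ] B →L[ℝ] E) :
    ∃ K : ℝ, ∀ᵐ ω ∂P, ∀ᶠ n : ℕ in atTop,
      ‖∑ i ∈ Finset.range n, (β (X i ω) (X i ω) - ∫ ω, β (X 0 ω) (X 0 ω) ∂P)‖
        ≤ K * √(n * Real.log n) := by
  obtain ⟨j, hj, hρj⟩ := hX.contraction
  obtain ⟨A, a, hA, ha0, ha1, hpow⟩ := exists_norm_pow_le_geometric hj hρj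
  set U := poissonForm ρ β
  set κ := ∫ ω, β (X 0 ω) (X 0 ω) ∂P
  set d := ‖U‖ * R * R + ‖U‖ * (‖ρ‖ * R) * (‖ρ‖ * R) + ‖U‖ * (R + ‖ρ‖ * R) * (R + ‖ρ‖ * R)
  have hM := ae_eventually_norm_le_of_martingale (P := P) (M := hX.martingale U)
    (D := fun n => hX.increment U (n + 1)) (d := d) (fun ω => by simp [martingale])
    (fun n ω => hX.martingale_succ U n ω) (fun n => hX.aestronglyMeasurable_increment U _)
    (fun n => hX.ae_norm_increment_le hR U _) (fun n h hh _ => hX.martingale_orthogonal hR U n hh)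
  refine ⟨‖U‖ * R * R + ‖U‖ * R * R + ‖β‖ * R * R + ‖κ‖ + (2 + d ^ 2), ?_⟩
  filter_upwards [hM, ae_all_iff.2 (hX.ae_norm_le hR)] with ω h1 h2
  -- The martingale decomposition concerns sums of `n + 1` terms. For `n ≥ 3` the square root
  -- exceeds `1`, so the bounded boundary terms are absorbed in the constant.
  rw [← map_add_atTop_eq_nat 1, eventually_map]
  filter_upwards [h1, eventually_ge_atTop 3] with n h3 hn
  have hn' : (3 : ℝ) ≤ n := by exact_mod_cast hn
  have hlog : 1 ≤ Real.log n := by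
    rw [Real.le_log_iff_exp_le (by linarith)]
    linarith [Real.exp_one_lt_d9]
  have hlog' : Real.log n ≤ Real.log ((n + 1 : ℕ) : ℝ) :=
    Real.log_le_log (by linarith) (by push_cast; linarith)
  have hsq : √(n * Real.log n) ≤ √((n + 1 : ℕ) * Real.log (n + 1 : ℕ)) :=
    Real.sqrt_le_sqrt (by push_cast at hlog' ⊢; gcongr; linarith)
  have hone : 1 ≤ √((n + 1 : ℕ) * Real.log (n + 1 : ℕ)) := by
    refine le_trans ?_ hsq
    rw [Real.one_le_sqrt]
    nlinarith
  rw [hX.sum_sub_eq_martingale hR hA ha0.le ha1 hpow]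
  have hR0 : 0 ≤ R := (norm_nonneg _).trans (h2 0)
  have e1 := norm_bilin_le U (h2 0) (h2 0)
  have e2 := norm_bilin_le U (h2 n) (h2 n)
  have e3 := norm_bilin_le β (h2 n) (h2 n)
  have e4 : ‖U (X 0 ω) (X 0 ω) - U (X n ω) (X n ω) + β (X n ω) (X n ω) + hX.martingale U n ω - κ‖
      ≤ ‖U‖ * R * R + ‖U‖ * R * R + ‖β‖ * R * R + (2 + d ^ 2) * √(n * Real.log n) + ‖κ‖ := by
    refine (norm_sub_le _ _).trans (add_le_add_left ((norm_add_le _ _).trans (add_le_add ?_ h3)) _)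
    exact (norm_add_le _ _).trans (add_le_add ((norm_sub_le _ _).trans (add_le_add e1 e2)) e3)
  refine e4.trans ?_
  have e5 : (2 + d ^ 2) * √(n * Real.log n)
      ≤ (2 + d ^ 2) * √((n + 1 : ℕ) * Real.log (n + 1 : ℕ)) := by gcongr
  have e6 : 0 ≤ ‖U‖ * R * R + ‖U‖ * R * R + ‖β‖ * R * R + ‖κ‖ := by positivity
  nlinarith

end

end IsStandardARB1

/-! ### Passage to the operator norm through the Hilbert tensor square. -/

open scoped TensorProduct in
set_option maxSynthPendingDepth 5 in
/-- The completed tensor square of a Hilbert space. -/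
theorem exists_hilbert_tensor_square.{u} (H : Type u) [NormedAddCommGroup H] [InnerProductSpace ℝ H] :
    ∃ (E : Type u) (_ : NormedAddCommGroup E) (_ : InnerProductSpace ℝ E) (_ : CompleteSpace E)
      (β : H →L[ℝ] H →L[ℝ] E),
      (∀ x y, ‖β x y‖ ≤ ‖x‖ * ‖y‖) ∧
        ∀ u v x y, ⟪β u v, β x y⟫_ℝ = ⟪x, u⟫_ℝ * ⟪y, v⟫_ℝ := by
  refine ⟨UniformSpace.Completion (H ⊗[ℝ] H), inferInstance, inferInstance, inferInstance,
    LinearMap.mkContinuous₂ (LinearMap.mk₂ ℝ (fun x y => ((x ⊗ₜ[ℝ] y : H ⊗[ℝ] H) :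
      UniformSpace.Completion (H ⊗[ℝ] H)))
      (fun x y z => by rw [TensorProduct.add_tmul, UniformSpace.Completion.coe_add])
      (fun r x y => by rw [← TensorProduct.smul_tmul', UniformSpace.Completion.coe_smul])
      (fun x y z => by rw [TensorProduct.tmul_add, UniformSpace.Completion.coe_add])
      (fun r x y => by rw [TensorProduct.tmul_smul, UniformSpace.Completion.coe_smul])) 1
      (fun x y => ?_), fun x y => ?_, fun u v x y => ?_⟩
  · simp
  · simp
  · simp [real_inner_comm]

section TensorForm

variable {B : Type*} [NormedAddCommGroup B] [NormedSpace ℝ B] (K : KuelbsSystem B)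

variable {Ω : Type*} [MeasurableSpace Ω] {P : Measure Ω} [IsProbabilityMeasure P]
  [SecondCountableTopology B] [MeasurableSpace B] [BorelSpace B] {X : ℤ → Ω → B} {R : ℝ}

/-- The martingale inequality needs a Hilbert norm, which the operator norm is not. Pairing with
elementary tensors, `⟪(C - C_n) u, v⟫ = -n⁻¹ ⟪β u v, s⟫`, shows that the tensor norm of the sum `s`
dominates. -/
theorem norm_covOp_sub_empCovOp_le {E : Type*} [NormedAddCommGroup E] [InnerProductSpace ℝ E]
    [CompleteSpace E] {β : K.Htilde →L[ℝ] K.Htilde →L[ℝ] E} (hβ : ∀ x y, ‖β x y‖ ≤ ‖x‖ * ‖y‖)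
    (hββ : ∀ u v x y, ⟪β u v, β x y⟫_ℝ = ⟪x, u⟫_ℝ * ⟪y, v⟫_ℝ)
    (hx : Measurable (X 0)) (hR : ∀ᵐ ω ∂P, ‖X 0 ω‖ ≤ R) {n : ℕ} (hn : n ≠ 0) (ω : Ω) :
    ‖covOp K P X - empCovOp K X n ω‖ ≤ (n : ℝ)⁻¹ * ‖∑ i ∈ Finset.range n,
      (β (K.emb (X i ω)) (K.emb (X i ω)) - ∫ ω, β (K.emb (X 0 ω)) (K.emb (X 0 ω)) ∂P)‖ := by
  set s := ∑ i ∈ Finset.range n,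
    (β (K.emb (X i ω)) (K.emb (X i ω)) - ∫ ω, β (K.emb (X 0 ω)) (K.emb (X 0 ω)) ∂P) with hs
  have hn' : (n : ℝ) ≠ 0 := by exact_mod_cast hn
  have hint : Integrable (fun ω => β (K.emb (X 0 ω)) (K.emb (X 0 ω))) P := by
    refine integrable_comp_of_norm_le (M := R * R) hx hR (G := fun b => β (K.emb b) (K.emb b))
      (by fun_prop) fun b hb => (hβ _ _).trans ?_
    have h := (K.norm_emb_le b).trans hb
    exact mul_le_mul h h (norm_nonneg _) ((norm_nonneg _).trans h)
  have key : ∀ u v : K.Htilde, ⟪(covOp K P X - empCovOp K X n ω) u, v⟫_ℝ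
      = -((n : ℝ)⁻¹ * ⟪β u v, s⟫_ℝ) := fun u v => by
    rw [hs, inner_sum]
    simp_rw [inner_sub_right, hββ]
    rw [← integral_inner hint, Finset.sum_sub_distrib, sub_apply, inner_sub_left,
      inner_covOp K hx hR, inner_empCovOp]
    simp_rw [hββ]
    rw [Finset.sum_const, Finset.card_range, nsmul_eq_mul, mul_sub, ← mul_assoc,
      inv_mul_cancel₀ hn', one_mul]
    ring
  refine ContinuousLinearMap.opNorm_le_bound _ (by positivity) fun u => ?_
  set v := (covOp K P X - empCovOp K X n ω) u with hv
  have h1 : ‖v‖ ^ 2 ≤ (n : ℝ)⁻¹ * ‖s‖ * ‖u‖ * ‖v‖ := by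
    have h2 := key u v
    rw [← hv, real_inner_self_eq_norm_sq] at h2
    rw [h2, neg_mul_eq_mul_neg, mul_assoc, mul_assoc]
    refine mul_le_mul_of_nonneg_left ?_ (by positivity)
    refine (neg_le_abs _).trans ((abs_real_inner_le_norm _ _).trans ?_)
    rw [mul_comm]
    exact mul_le_mul_of_nonneg_left (hβ _ _) (norm_nonneg _)
  rcases (norm_nonneg v).eq_or_lt with h0 | h0
  · rw [← h0]; positivity
  · nlinarith

end TensorForm

namespace IsStandardARB1

variable {Ω : Type*} [MeasurableSpace Ω] {P : Measure Ω} [IsProbabilityMeasure P]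
  {B : Type*} [NormedAddCommGroup B] [NormedSpace ℝ B] [CompleteSpace B]
  [SecondCountableTopology B] [MeasurableSpace B] [BorelSpace B] (K : KuelbsSystem B)
  {ρ : B →L[ℝ] B} {ε X : ℤ → Ω → B} {R : ℝ}

/-- The almost sure rate of the empirical autocovariance operator in the operator norm. -/
theorem ae_eventually_norm_covOp_sub_le (hX : IsStandardARB1 P ρ ε X)
    (hR : ∀ᵐ ω ∂P, ‖X 0 ω‖ ≤ R) :
    ∃ L : ℝ, ∀ᵐ ω ∂P, ∀ᶠ n : ℕ in atTop,
      ‖covOp K P X - empCovOp K X n ω‖ ≤ L * √(Real.log n / n) := by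
  obtain ⟨E, _, _, _, β, hβ, hββ⟩ := exists_hilbert_tensor_square K.Htilde
  obtain ⟨L, hL⟩ := hX.ae_eventually_norm_sum_le hR (β.bilinearComp K.emb K.emb)
  refine ⟨L, ?_⟩
  filter_upwards [hL] with ω hω
  filter_upwards [hω, eventually_gt_atTop 0] with n h1 hn
  have hn' : (0 : ℝ) < n := by exact_mod_cast hn
  refine (norm_covOp_sub_empCovOp_le K hβ hββ (hX.measurable 0) hR hn.ne' ω).trans
    ((mul_le_mul_of_nonneg_left h1 (by positivity)).trans_eq ?_)
  have h2 : (n : ℝ) * Real.log n = n ^ 2 * (Real.log n / n) := by field_simp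
  rw [h2, Real.sqrt_mul (by positivity), Real.sqrt_sq hn'.le]
  field_simp

end IsStandardARB1

/-! ### Mean-square bounds that retain the second moment of a functional. -/

theorem tsum_mul_sq_le {w z : ℕ → ℝ} (hw : ∀ i, 0 ≤ w i) (hw0 : 0 < w 0) (hs : Summable w)
    (h1 : Summable fun i => w i * z i) (h2 : Summable fun i => w i * z i ^ 2) :
    (∑' i, w i * z i) ^ 2 ≤ (∑' i, w i) * ∑' i, w i * z i ^ 2 := by
  have hW : 0 < ∑' i, w i := hs.tsum_pos hw 0 hw0
  set W := ∑' i, w i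
  set S := ∑' i, w i * z i with hS
  set Q := ∑' i, w i * z i ^ 2
  have h := ((h2.hasSum.sub (h1.hasSum.mul_left (2 * (S / W)))).add
    (hs.hasSum.mul_left ((S / W) ^ 2))).nonneg fun i => by
      have : w i * z i ^ 2 - 2 * (S / W) * (w i * z i) + (S / W) ^ 2 * w i
          = w i * (z i - S / W) ^ 2 := by ring
      rw [this]
      exact mul_nonneg (hw i) (sq_nonneg _)
  have e : Q - 2 * (S / W) * S + (S / W) ^ 2 * W = Q - S ^ 2 / W := by field_simp; ring
  have h' : 0 ≤ Q - S ^ 2 / W := by rw [← e]; exact h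
  rw [sub_nonneg, div_le_iff₀ hW] at h'
  linarith

namespace IsStandardARB1

variable {Ω : Type*} [MeasurableSpace Ω] {P : Measure Ω} [IsProbabilityMeasure P]
  {B : Type*} [NormedAddCommGroup B] [NormedSpace ℝ B] [CompleteSpace B]
  [SecondCountableTopology B] [MeasurableSpace B] [BorelSpace B]
  {ρ : B →L[ℝ] B} {ε X : ℤ → Ω → B} {R : ℝ}

/-- The covariance of `X` is that of `ρ X` plus that of the noise, so applying `ρ` cannot increase a
second moment. This keeps the small factor `E[F(X)²]` through all terms of the Poisson series. -/
theorem integral_sq_pow_le (hX : IsStandardARB1 P ρ ε X) (hR : ∀ᵐ ω ∂P, ‖X 0 ω‖ ≤ R)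
    (g : B →L[ℝ] ℝ) (h : ℕ) :
    ∫ ω, g ((ρ ^ h) (X 0 ω)) ^ 2 ∂P ≤ ∫ ω, g (X 0 ω) ^ 2 ∂P := by
  have step : ∀ f : B →L[ℝ] ℝ, ∫ ω, f (ρ (X 0 ω)) ^ 2 ∂P ≤ ∫ ω, f (X 0 ω) ^ 2 ∂P := fun f => by
    have h1 := hX.integral_bilin_eq hR 0 ((ContinuousLinearMap.mul ℝ ℝ).bilinearComp f f)
    simp only [ContinuousLinearMap.bilinearComp_apply, ContinuousLinearMap.mul_apply', ← sq] at h1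
    rw [h1]
    exact le_add_of_nonneg_right (integral_nonneg fun ω => sq_nonneg _)
  induction h with
  | zero => simp
  | succ h ih =>
    refine le_trans ?_ ih
    have := step (g.comp (ρ ^ h))
    simp only [ContinuousLinearMap.comp_apply] at this
    rw [pow_succ]
    exact this

variable {E : Type*} [NormedAddCommGroup E] [InnerProductSpace ℝ E] [CompleteSpace E]
  {A a : ℝ} {β : B →L[ℝ] B →L[ℝ] E} {F : B →L[ℝ] ℝ} {q : ℝ}

omit [CompleteSpace B] [SecondCountableTopology B] [MeasurableSpace B] [BorelSpace B] in
theorem geometric_mul_sq_le (hA : 0 ≤ A) (ha0 : 0 < a) (ha1 : a < 1)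
    (hpow : ∀ h, ‖ρ ^ h‖ ≤ A * a ^ h) {x : B} (hx : ‖x‖ ≤ R) (h : ℕ) :
    a ^ h * F ((ρ ^ h) x) ^ 2 ≤ a ^ h * (‖F‖ * (A * R)) ^ 2 := by
  rw [← sq_abs]
  refine mul_le_mul_of_nonneg_left (pow_le_pow_left₀ (abs_nonneg _) ?_ 2) (by positivity)
  refine (F.le_opNorm _).trans (mul_le_mul_of_nonneg_left ?_ (norm_nonneg _))
  refine ((ρ ^ h).le_of_opNorm_le (hpow h) x).trans ?_
  exact mul_le_mul (mul_le_of_le_one_right hA (pow_le_one₀ ha0.le ha1.le)) hx (norm_nonneg _) hA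

-- In each term of the series one argument is estimated by its norm, which supplies the weight
-- `a^h`, and the other is kept inside `F`; Cauchy–Schwarz for the weights `a^h` concludes.
omit [CompleteSpace B] [SecondCountableTopology B] [MeasurableSpace B] [BorelSpace B] in
theorem norm_poissonForm_sq_le (hA : 0 ≤ A) (ha0 : 0 < a) (ha1 : a < 1)
    (hpow : ∀ h, ‖ρ ^ h‖ ≤ A * a ^ h) (hβ : ∀ x y, ‖β x y‖ ≤ |F x| * ‖y‖) {x : B}
    (hx : ‖x‖ ≤ R) :
    ‖poissonForm ρ β x x‖ ^ 2 ≤ (A * R) ^ 2 * (1 - a)⁻¹ * ∑' h : ℕ, a ^ h * F ((ρ ^ h) x) ^ 2 := by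
  have hR0 := (norm_nonneg x).trans hx
  have hgeo := summable_geometric_of_lt_one ha0.le ha1
  have s2 : Summable fun h : ℕ => a ^ h * |F ((ρ ^ h) x)| ^ 2 := by
    simp only [sq_abs]
    exact Summable.of_nonneg_of_le (fun h => by positivity)
      (geometric_mul_sq_le hA ha0 ha1 hpow hx) (hgeo.mul_right _)
  have s1 : Summable fun h : ℕ => a ^ h * |F ((ρ ^ h) x)| :=
    Summable.of_nonneg_of_le (fun h => by positivity) (fun h => by
      have : |F ((ρ ^ h) x)| ≤ 1 + |F ((ρ ^ h) x)| ^ 2 := by nlinarith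
      calc _ ≤ a ^ h * (1 + |F ((ρ ^ h) x)| ^ 2) := by gcongr
        _ = _ := by rw [mul_add, mul_one]) (hgeo.add s2)
  have hterm : ∀ h : ℕ, ‖β ((ρ ^ h) x) ((ρ ^ h) x)‖ ≤ A * R * (a ^ h * |F ((ρ ^ h) x)|) := fun h => by
    refine (hβ _ _).trans ?_
    have h1 : ‖(ρ ^ h) x‖ ≤ A * a ^ h * R :=
      ((ρ ^ h).le_of_opNorm_le (hpow h) x).trans (by gcongr)
    calc _ ≤ |F ((ρ ^ h) x)| * (A * a ^ h * R) := by gcongr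
      _ = _ := by ring
  have h2 : ‖poissonForm ρ β x x‖ ≤ A * R * ∑' h : ℕ, a ^ h * |F ((ρ ^ h) x)| :=
    (hasSum_poissonForm hA ha0.le ha1 hpow β x x).norm_le_of_bounded (s1.hasSum.mul_left _) hterm
  have h3 := tsum_mul_sq_le (w := fun h : ℕ => a ^ h) (z := fun h => |F ((ρ ^ h) x)|)
    (fun h => by positivity) (by simp) hgeo s1 s2
  rw [tsum_geometric_of_lt_one ha0.le ha1] at h3
  simp only [sq_abs] at h3
  calc _ ≤ (A * R * ∑' h : ℕ, a ^ h * |F ((ρ ^ h) x)|) ^ 2 := pow_le_pow_left₀ (norm_nonneg _) h2 2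
    _ = (A * R) ^ 2 * (∑' h : ℕ, a ^ h * |F ((ρ ^ h) x)|) ^ 2 := by ring
    _ ≤ (A * R) ^ 2 * ((1 - a)⁻¹ * ∑' h : ℕ, a ^ h * F ((ρ ^ h) x) ^ 2) := by gcongr
    _ = _ := by ring

theorem integral_norm_poissonForm_sq_le (hX : IsStandardARB1 P ρ ε X)
    (hR : ∀ᵐ ω ∂P, ‖X 0 ω‖ ≤ R) (hA : 0 ≤ A) (ha0 : 0 < a) (ha1 : a < 1)
    (hpow : ∀ h, ‖ρ ^ h‖ ≤ A * a ^ h) (hβ : ∀ x y, ‖β x y‖ ≤ |F x| * ‖y‖)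
    (hq : ∫ ω, F (X 0 ω) ^ 2 ∂P ≤ q) :
    ∫ ω, ‖poissonForm ρ β (X 0 ω) (X 0 ω)‖ ^ 2 ∂P ≤ (A * R * (1 - a)⁻¹) ^ 2 * q := by
  have hgeo := summable_geometric_of_lt_one ha0.le ha1
  have hi : ∀ h : ℕ, Integrable (fun ω => a ^ h * F ((ρ ^ h) (X 0 ω)) ^ 2) P := fun h => by
    refine hX.integrable_comp hR 0 (G := fun b => a ^ h * F ((ρ ^ h) b) ^ 2) (by fun_prop)
      (M := a ^ h * (‖F‖ * (‖ρ ^ h‖ * R)) ^ 2) fun b hb => ?_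
    rw [Real.norm_eq_abs, abs_of_nonneg (by positivity), ← sq_abs (F _)]
    have h1 : ‖(ρ ^ h) b‖ ≤ ‖ρ ^ h‖ * R := ((ρ ^ h).le_opNorm b).trans (by gcongr)
    have h2 : |F ((ρ ^ h) b)| ≤ ‖F‖ * (‖ρ ^ h‖ * R) := (F.le_opNorm _).trans (by gcongr)
    gcongr
  have hle : ∀ h : ℕ, ∫ ω, a ^ h * F ((ρ ^ h) (X 0 ω)) ^ 2 ∂P ≤ a ^ h * q := fun h => by
    rw [integral_const_mul]
    exact mul_le_mul_of_nonneg_left ((hX.integral_sq_pow_le hR F h).trans hq) (by positivity)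
  have hnn : ∀ h ω, 0 ≤ a ^ h * F ((ρ ^ h) (X 0 ω)) ^ 2 := fun h ω => by positivity
  have hsum : Summable fun h : ℕ => ∫ ω, ‖a ^ h * F ((ρ ^ h) (X 0 ω)) ^ 2‖ ∂P := by
    simp only [Real.norm_of_nonneg (hnn _ _)]
    exact Summable.of_nonneg_of_le (fun h => integral_nonneg (hnn h)) hle (hgeo.mul_right _)
  have hs := hasSum_integral_of_summable_integral_norm hi hsum
  have hint : ∫ ω, ∑' h : ℕ, a ^ h * F ((ρ ^ h) (X 0 ω)) ^ 2 ∂P ≤ (1 - a)⁻¹ * q :=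
    hasSum_le hle hs ((hasSum_geometric_of_lt_one ha0.le ha1).mul_right q)
  have hI : Integrable (fun ω => ∑' h : ℕ, a ^ h * F ((ρ ^ h) (X 0 ω)) ^ 2) P := by
    have hsm : ∀ ω, ‖X 0 ω‖ ≤ R → Summable fun h : ℕ => a ^ h * F ((ρ ^ h) (X 0 ω)) ^ 2 :=
      fun ω h0 => Summable.of_nonneg_of_le (fun h => hnn h ω)
        (geometric_mul_sq_le hA ha0 ha1 hpow h0) (hgeo.mul_right _)
    refine Integrable.of_bound (C := (1 - a)⁻¹ * (‖F‖ * (A * R)) ^ 2)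
      (aestronglyMeasurable_of_tendsto_ae atTop (f := fun N ω =>
        ∑ h ∈ Finset.range N, a ^ h * F ((ρ ^ h) (X 0 ω)) ^ 2)
        (fun N => Finset.aestronglyMeasurable_fun_sum _ fun h _ => (hi h).aestronglyMeasurable) ?_) ?_
    · filter_upwards [hR] with ω h0 using (hsm ω h0).hasSum.tendsto_sum_nat
    · filter_upwards [hR] with ω h0
      rw [Real.norm_of_nonneg (tsum_nonneg fun h => hnn h ω)]
      exact hasSum_le (geometric_mul_sq_le hA ha0 ha1 hpow h0) (hsm ω h0).hasSum
        ((hasSum_geometric_of_lt_one ha0.le ha1).mul_right _)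
  calc _ ≤ ∫ ω, (A * R) ^ 2 * (1 - a)⁻¹ * ∑' h : ℕ, a ^ h * F ((ρ ^ h) (X 0 ω)) ^ 2 ∂P := by
        refine integral_mono_of_nonneg (.of_forall fun ω => by positivity) (hI.const_mul _) ?_
        filter_upwards [hR] with ω h using norm_poissonForm_sq_le hA ha0 ha1 hpow hβ h
    _ ≤ (A * R) ^ 2 * (1 - a)⁻¹ * ((1 - a)⁻¹ * q) := by
        rw [integral_const_mul]
        have : 0 < 1 - a := by linarith
        gcongr
    _ = _ := by ring

/-- With `κ` the mean, `‖κ‖² = E⟪κ, Z⟫ ≤ (‖κ‖² + E‖Z‖²) / 2`. -/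
theorem norm_integral_sq_le {Z : Ω → E} {b : ℝ} (hZ : Integrable Z P)
    (hZ2 : Integrable (fun ω => ‖Z ω‖ ^ 2) P) (hb : ∫ ω, ‖Z ω‖ ^ 2 ∂P ≤ b) :
    ‖∫ ω, Z ω ∂P‖ ^ 2 ≤ b := by
  set κ := ∫ ω, Z ω ∂P with hκ
  have h1 : ‖κ‖ ^ 2 = ∫ ω, ⟪κ, Z ω⟫_ℝ ∂P := by
    rw [integral_inner hZ, real_inner_self_eq_norm_sq]
  have h2 : ∫ ω, ⟪κ, Z ω⟫_ℝ ∂P ≤ ∫ ω, (‖κ‖ ^ 2 / 2 + ‖Z ω‖ ^ 2 / 2) ∂P := by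
    refine integral_mono (hZ.const_inner κ) ((integrable_const _).add (hZ2.div_const 2)) fun ω => ?_
    have h3 := real_inner_le_norm κ (Z ω)
    simp only
    nlinarith [sq_nonneg (‖κ‖ - ‖Z ω‖)]
  rw [integral_add (integrable_const _) (hZ2.div_const 2)] at h2
  simp only [integral_div, integral_const, probReal_univ, one_smul] at h2
  linarith

omit [InnerProductSpace ℝ E] [CompleteSpace E] in
theorem integrable_norm_sq {Z : Ω → E} (hZ : AEStronglyMeasurable Z P) {b : ℝ}
    (hb : ∀ᵐ ω ∂P, ‖Z ω‖ ≤ b) : Integrable (fun ω => ‖Z ω‖ ^ 2) P := by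
  refine Integrable.of_bound (C := b ^ 2) (hZ.norm.pow 2) ?_
  filter_upwards [hb] with ω h
  rw [Real.norm_of_nonneg (sq_nonneg _)]
  exact pow_le_pow_left₀ (norm_nonneg _) h 2

/-- The mean square of the centred sums of a quadratic function that is controlled by the second
moment of a functional. -/
theorem integral_norm_sum_sq_le (hX : IsStandardARB1 P ρ ε X) (hR : ∀ᵐ ω ∂P, ‖X 0 ω‖ ≤ R)
    (hA : 0 ≤ A) (ha0 : 0 < a) (ha1 : a < 1) (hpow : ∀ h, ‖ρ ^ h‖ ≤ A * a ^ h)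
    (hβ : ∀ x y, ‖β x y‖ ≤ |F x| * ‖y‖) (hq : ∫ ω, F (X 0 ω) ^ 2 ∂P ≤ q) (n : ℕ) :
    ∫ ω, ‖∑ i ∈ Finset.range n, (β (X i ω) (X i ω) - ∫ ω, β (X 0 ω) (X 0 ω) ∂P)‖ ^ 2 ∂P
      ≤ 40 * ((A * R * (1 - a)⁻¹) ^ 2 + R ^ 2) * q * n := by
  rcases n with - | n
  · simp
  set U := poissonForm ρ β
  set κ := ∫ ω, β (X 0 ω) (X 0 ω) ∂P with hκ
  set u := (A * R * (1 - a)⁻¹) ^ 2 * q with hu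
  have hR0 : 0 ≤ R := by
    obtain ⟨ω, hω⟩ := hR.exists
    exact (norm_nonneg _).trans hω
  have hsm : ∀ (W : B →L[ℝ] B →L[ℝ] E) (i : ℤ), AEStronglyMeasurable (fun ω => W (X i ω) (X i ω)) P :=
    fun W i => ((Continuous.stronglyMeasurable (f := fun b => W b b)
      (by fun_prop)).comp_measurable (hX.measurable i)).aestronglyMeasurable
  have hbd : ∀ (W : B →L[ℝ] B →L[ℝ] E) (i : ℤ), ∀ᵐ ω ∂P, ‖W (X i ω) (X i ω)‖ ≤ ‖W‖ * R * R :=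
    fun W i => by filter_upwards [hX.ae_norm_le hR i] with ω h using norm_bilin_le W h h
  have hI2 : ∀ (W : B →L[ℝ] B →L[ℝ] E) (i : ℤ),
      Integrable (fun ω => ‖W (X i ω) (X i ω)‖ ^ 2) P := fun W i =>
    integrable_norm_sq (hsm W i) (hbd W i)
  have hU : ∀ i : ℤ, ∫ ω, ‖U (X i ω) (X i ω)‖ ^ 2 ∂P ≤ u := fun i => by
    rw [hX.integral_comp_eq (G := fun b => ‖U b b‖ ^ 2) (by fun_prop) i]
    exact hX.integral_norm_poissonForm_sq_le hR hA ha0 ha1 hpow hβ hq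
  have hF : Integrable (fun ω => F (X 0 ω) ^ 2) P := by
    refine hX.integrable_comp hR 0 (G := fun b => F b ^ 2) (by fun_prop)
      (M := (‖F‖ * R) ^ 2) fun b hb => ?_
    rw [Real.norm_of_nonneg (sq_nonneg _), ← sq_abs]
    have : |F b| ≤ ‖F‖ * R := (F.le_opNorm b).trans (by gcongr)
    gcongr
  have hB : ∀ i : ℤ, ∫ ω, ‖β (X i ω) (X i ω)‖ ^ 2 ∂P ≤ R ^ 2 * q := fun i => by
    rw [hX.integral_comp_eq (G := fun b => ‖β b b‖ ^ 2) (by fun_prop) i]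
    calc _ ≤ ∫ ω, R ^ 2 * F (X 0 ω) ^ 2 ∂P := by
          refine integral_mono_ae (hI2 β 0) (hF.const_mul _) ?_
          filter_upwards [hR] with ω h
          have h1 := (hβ (X 0 ω) (X 0 ω)).trans (mul_le_mul_of_nonneg_left h (abs_nonneg _))
          calc _ ≤ (|F (X 0 ω)| * R) ^ 2 := pow_le_pow_left₀ (norm_nonneg _) h1 2
            _ = _ := by rw [mul_pow, sq_abs, mul_comm]
      _ ≤ _ := by rw [integral_const_mul]; gcongr
  have hκ2 : ‖κ‖ ^ 2 ≤ R ^ 2 * q := norm_integral_sq_le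
    (Integrable.of_bound (hsm β 0) _ (hbd β 0)) (hI2 β 0) (hB 0)
  -- By the Poisson equation the increment is a sum of four terms, two with mean square at most `u`
  -- and two at most `R² q`; the factor `4` of Cauchy–Schwarz makes `8`. Keeping `U(ρ X, ρ X)` or
  -- the noise terms would not require new estimates only if they were controlled by `F`, so they
  -- are eliminated.
  have hD : ∀ i : ℤ, ∫ ω, ‖hX.increment U (i + 1) ω‖ ^ 2 ∂P ≤ 8 * (u + R ^ 2 * q) := fun i => by
    have hle : ∀ ω, ‖hX.increment U (i + 1) ω‖ ^ 2 ≤ 4 * (‖U (X (i + 1) ω) (X (i + 1) ω)‖ ^ 2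
        + ‖U (X i ω) (X i ω)‖ ^ 2 + ‖β (X i ω) (X i ω)‖ ^ 2 + ‖κ‖ ^ 2) := fun ω => by
      have e : hX.increment U (i + 1) ω
          = U (X (i + 1) ω) (X (i + 1) ω) - U (X i ω) (X i ω) + β (X i ω) (X i ω) - κ := by
        rw [increment, hX.integral_poissonForm_noise hR hA ha0.le ha1 hpow, add_sub_cancel_right,
          ← poissonForm_sub hA ha0.le ha1 hpow β (X i ω) (X i ω)]
        abel
      have h1 : ‖hX.increment U (i + 1) ω‖ ≤ ‖U (X (i + 1) ω) (X (i + 1) ω)‖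
          + ‖U (X i ω) (X i ω)‖ + ‖β (X i ω) (X i ω)‖ + ‖κ‖ := by
        rw [e]
        refine (norm_sub_le _ _).trans (add_le_add_left ((norm_add_le _ _).trans ?_) _)
        exact add_le_add_left (norm_sub_le _ _) _
      refine (pow_le_pow_left₀ (norm_nonneg _) h1 2).trans ?_
      generalize ‖U (X (i + 1) ω) (X (i + 1) ω)‖ = x₁
      generalize ‖U (X i ω) (X i ω)‖ = x₂
      generalize ‖β (X i ω) (X i ω)‖ = x₃
      generalize ‖κ‖ = x₄
      nlinarith [sq_nonneg (x₁ - x₂), sq_nonneg (x₁ - x₃), sq_nonneg (x₁ - x₄),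
        sq_nonneg (x₂ - x₃), sq_nonneg (x₂ - x₄), sq_nonneg (x₃ - x₄)]
    have j2 := (hI2 U (i + 1)).add (hI2 U i)
    have j3 := j2.add (hI2 β i)
    have j4 := j3.add (integrable_const (μ := P) (‖κ‖ ^ 2))
    refine (integral_mono_of_nonneg (.of_forall fun ω => by positivity) (j4.const_mul 4)
      (.of_forall hle)).trans ?_
    rw [integral_const_mul]
    have e1 := integral_add j3 (integrable_const (μ := P) (‖κ‖ ^ 2))
    have e2 := integral_add j2 (hI2 β i)
    have e3 := integral_add (hI2 U (i + 1)) (hI2 U i)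
    simp only [Pi.add_apply, integral_const, probReal_univ, one_smul] at e1 e2 e3 ⊢
    rw [e1, e2, e3]
    linarith [hU (i + 1), hU i, hB i]
  have hMb : ∀ m : ℕ, AEStronglyMeasurable (hX.martingale U m) P ∧
      ∃ b, ∀ᵐ ω ∂P, ‖hX.martingale U m ω‖ ≤ b := fun m => by
    induction m with
    | zero =>
      refine ⟨?_, 0, .of_forall fun ω => by simp [martingale]⟩
      exact aestronglyMeasurable_const (b := (0 : E)) |>.congr
        (.of_forall fun ω => by simp [martingale])
    | succ m ih =>
      obtain ⟨h1, b, hb⟩ := ih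
      obtain ⟨d, hd⟩ : ∃ d, ∀ᵐ ω ∂P, ‖hX.increment U (m + 1) ω‖ ≤ d :=
        ⟨_, hX.ae_norm_increment_le hR U (m + 1)⟩
      refine ⟨(h1.add (hX.aestronglyMeasurable_increment U (m + 1))).congr
        (.of_forall fun ω => (hX.martingale_succ U m ω).symm), b + d, ?_⟩
      filter_upwards [hb, hd] with ω h2 h3
      rw [hX.martingale_succ]
      exact (norm_add_le _ _).trans (add_le_add h2 h3)
  have hM : ∀ m : ℕ, ∫ ω, ‖hX.martingale U m ω‖ ^ 2 ∂P ≤ m * (8 * (u + R ^ 2 * q)) := fun m => by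
    induction m with
    | zero => simp [martingale]
    | succ m ih =>
      obtain ⟨h1, b, hb⟩ := hMb m
      have horth := hX.martingale_orthogonal hR U m (h := fun _ => 1) measurable_const
      simp only [one_mul] at horth
      have hDm := hX.aestronglyMeasurable_increment U (m + 1)
      have hDb := hX.ae_norm_increment_le hR U (m + 1)
      have k1 := integrable_norm_sq h1 hb
      have k2 := integrable_norm_sq hDm hDb
      have k3 : Integrable (fun ω => ⟪hX.martingale U m ω, hX.increment U (m + 1) ω⟫_ℝ) P := by
        refine (k1.add k2).mono' (h1.inner hDm) (.of_forall fun ω => ?_)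
        refine (norm_inner_le_norm _ _).trans ?_
        simp only [Pi.add_apply]
        nlinarith [sq_nonneg (‖hX.martingale U m ω‖ - ‖hX.increment U (m + 1) ω‖),
          sq_nonneg (‖hX.martingale U m ω‖), sq_nonneg (‖hX.increment U (m + 1) ω‖)]
      have k4 : Integrable (fun ω => ‖hX.martingale U m ω‖ ^ 2
          + 2 * ⟪hX.martingale U m ω, hX.increment U (m + 1) ω⟫_ℝ) P := k1.add (k3.const_mul 2)
      simp_rw [hX.martingale_succ, norm_add_sq_real]
      rw [integral_add k4 k2, integral_add k1 (k3.const_mul 2), integral_const_mul, horth]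
      push_cast
      linarith [hD m]
  obtain ⟨hMm, b, hMb'⟩ := hMb n
  -- Five terms cost a factor `5`, and the martingale contributes `8 n (u + R² q)`; this is the
  -- origin of `40`.
  have hle : ∀ ω, ‖∑ i ∈ Finset.range (n + 1), (β (X i ω) (X i ω) - κ)‖ ^ 2
      ≤ 5 * (‖U (X 0 ω) (X 0 ω)‖ ^ 2 + ‖U (X n ω) (X n ω)‖ ^ 2 + ‖β (X n ω) (X n ω)‖ ^ 2
        + ‖hX.martingale U n ω‖ ^ 2 + ‖κ‖ ^ 2) := fun ω => by
    have h1 : ‖∑ i ∈ Finset.range (n + 1), (β (X i ω) (X i ω) - κ)‖ ≤ ‖U (X 0 ω) (X 0 ω)‖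
        + ‖U (X n ω) (X n ω)‖ + ‖β (X n ω) (X n ω)‖ + ‖hX.martingale U n ω‖ + ‖κ‖ := by
      rw [hX.sum_sub_eq_martingale hR hA ha0.le ha1 hpow]
      refine (norm_sub_le _ _).trans (add_le_add_left ((norm_add_le _ _).trans ?_) _)
      refine add_le_add_left ((norm_add_le _ _).trans ?_) _
      exact add_le_add_left (norm_sub_le _ _) _
    refine (pow_le_pow_left₀ (norm_nonneg _) h1 2).trans ?_
    generalize ‖U (X 0 ω) (X 0 ω)‖ = x₁
    generalize ‖U (X n ω) (X n ω)‖ = x₂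
    generalize ‖β (X n ω) (X n ω)‖ = x₃
    generalize ‖hX.martingale U n ω‖ = x₄
    generalize ‖κ‖ = x₅
    nlinarith [sq_nonneg (x₁ - x₂), sq_nonneg (x₁ - x₃), sq_nonneg (x₁ - x₄),
      sq_nonneg (x₁ - x₅), sq_nonneg (x₂ - x₃), sq_nonneg (x₂ - x₄), sq_nonneg (x₂ - x₅),
      sq_nonneg (x₃ - x₄), sq_nonneg (x₃ - x₅), sq_nonneg (x₄ - x₅)]
  have j2 := (hI2 U 0).add (hI2 U n)
  have j3 := j2.add (hI2 β n)
  have j4 := j3.add (integrable_norm_sq hMm hMb')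
  have j5 := j4.add (integrable_const (μ := P) (‖κ‖ ^ 2))
  refine (integral_mono_of_nonneg (.of_forall fun ω => by positivity) (j5.const_mul 5)
    (.of_forall hle)).trans ?_
  rw [integral_const_mul]
  have e0 := integral_add j4 (integrable_const (μ := P) (‖κ‖ ^ 2))
  have e1 := integral_add j3 (integrable_norm_sq hMm hMb')
  have e2 := integral_add j2 (hI2 β n)
  have e3 := integral_add (hI2 U 0) (hI2 U n)
  simp only [Pi.add_apply, integral_const, probReal_univ, one_smul] at e0 e1 e2 e3 ⊢
  rw [e0, e1, e2, e3]
  have hq0 : 0 ≤ q := (integral_nonneg fun ω => sq_nonneg _).trans hq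
  have hu0 : 0 ≤ u + R ^ 2 * q := by positivity
  have := hM n
  have e4 : (40 : ℝ) * ((A * R * (1 - a)⁻¹) ^ 2 + R ^ 2) * q * (n + 1 : ℕ)
      = 40 * (u + R ^ 2 * q) * (n + 1) := by rw [hu]; push_cast; ring
  rw [e4]
  nlinarith [hU 0, hU n, hB n]

end IsStandardARB1

/-! ### Almost sure growth, uniform over a family of sequences. -/

theorem Nat.exists_cube_le_lt {n : ℕ} (hn : 1 ≤ n) : ∃ p, p ^ 3 ≤ n ∧ n < (p + 1) ^ 3 ∧ 1 ≤ p := by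
  induction n, hn using Nat.le_induction with
  | base => exact ⟨1, by norm_num⟩
  | succ n _ ih =>
    obtain ⟨p, h1, h2, h3⟩ := ih
    rcases Nat.lt_or_ge (n + 1) ((p + 1) ^ 3) with h | h
    · exact ⟨p, by omega, h, h3⟩
    · refine ⟨p + 1, h, ?_, by omega⟩
      have : (p + 1) ^ 3 < (p + 1 + 1) ^ 3 := Nat.pow_lt_pow_left (by omega) (by norm_num)
      omega

/-- A family of sequences with bounded increments and summable linear mean-square bounds grows
almost surely at most like `n ^ (3 / 4)`, uniformly over the family. -/
theorem ae_exists_forall_norm_le_rpow {Ω : Type*} [MeasurableSpace Ω] {P : Measure Ω}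
    {E : Type*} [NormedAddCommGroup E] {Z : ℕ → ℕ → Ω → E} {b : ℕ → ℝ} {d : ℝ} (hb : Summable b)
    (hZ : ∀ m n, AEStronglyMeasurable (Z m n) P)
    (hZ2 : ∀ m n, Integrable (fun ω => ‖Z m n ω‖ ^ 2) P)
    (hle : ∀ m n, ∫ ω, ‖Z m n ω‖ ^ 2 ∂P ≤ b m * n)
    (hinc : ∀ᵐ ω ∂P, ∀ m n, ‖Z m (n + 1) ω - Z m n ω‖ ≤ d) :
    ∀ᵐ ω ∂P, ∃ L : ℝ, ∀ n : ℕ, 1 ≤ n → ∀ m, ‖Z m n ω‖ ≤ L * (n : ℝ) ^ (3 / 4 : ℝ) := by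
  -- Cubes balance two demands: `∑ r^(-3/2) * r = ∑ (p + 1)^(-3/2)` converges, and consecutive cubes
  -- differ by `O(r^(2/3))`, which is within the target `r^(3/4)`.
  let r : ℕ → ℝ := fun p => (((p + 1) ^ 3 : ℕ) : ℝ)
  have hr : ∀ p, 0 < r p := fun p => by positivity
  let f : ℕ → ℕ → Ω → ℝ≥0∞ := fun p m ω =>
    ENNReal.ofReal (r p ^ (-(3 / 2) : ℝ) * ‖Z m ((p + 1) ^ 3) ω‖ ^ 2)
  have hfm : ∀ p m, AEMeasurable (f p m) P := fun p m =>
    (((hZ m _).norm.pow 2).aemeasurable.const_mul _).ennreal_ofReal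
  have hf : ∀ p m, ∫⁻ ω, f p m ω ∂P ≤ ENNReal.ofReal (r p ^ (-(1 / 2) : ℝ)) * ENNReal.ofReal (b m) := by
    intro p m
    rw [← ofReal_integral_eq_lintegral_ofReal ((hZ2 m _).const_mul _)
      (.of_forall fun ω => by have := hr p; positivity), integral_const_mul,
      ← ENNReal.ofReal_mul (by have := hr p; positivity)]
    refine ENNReal.ofReal_le_ofReal ?_
    have h1 := mul_le_mul_of_nonneg_left (hle m ((p + 1) ^ 3))
      (Real.rpow_nonneg (hr p).le (-(3 / 2) : ℝ))
    refine h1.trans_eq ?_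
    have h2 : r p ^ (-(1 / 2) : ℝ) = r p ^ (-(3 / 2) : ℝ) * r p := by
      rw [← Real.rpow_add_one (hr p).ne']; norm_num
    rw [h2]
    ring
  have hrs : Summable fun p => r p ^ (-(1 / 2) : ℝ) := by
    have h1 := (summable_nat_add_iff 1).2
      (Real.summable_one_div_nat_rpow.2 (by norm_num : (1 : ℝ) < 3 / 2))
    refine h1.congr fun p => ?_
    have h2 : r p = ((p + 1 : ℕ) : ℝ) ^ (3 : ℝ) := by
      rw [show (3 : ℝ) = (3 : ℕ) by norm_num, Real.rpow_natCast]
      push_cast [r]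
      rfl
    rw [h2, ← Real.rpow_mul (by positivity), one_div, ← Real.rpow_neg (by positivity)]
    norm_num
  -- Summing over `m` as well as `p` makes a single finite random variable dominate all members of
  -- the family.
  have hfin : ∫⁻ ω, ∑' p, ∑' m, f p m ω ∂P ≠ ⊤ := by
    rw [lintegral_tsum fun p => AEMeasurable.tsum fun m => hfm p m]
    have h1 : ∀ p, ∫⁻ ω, ∑' m, f p m ω ∂P
        ≤ ENNReal.ofReal (r p ^ (-(1 / 2) : ℝ)) * ∑' m, ENNReal.ofReal (b m) := fun p => by
      rw [lintegral_tsum fun m => hfm p m, ← ENNReal.tsum_mul_left]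
      exact ENNReal.tsum_le_tsum fun m => hf p m
    refine ne_top_of_le_ne_top ?_ (ENNReal.tsum_le_tsum h1)
    rw [ENNReal.tsum_mul_right]
    exact ENNReal.mul_ne_top hrs.tsum_ofReal_ne_top hb.tsum_ofReal_ne_top
  have hae := ae_lt_top' (AEMeasurable.tsum fun p => AEMeasurable.tsum fun m => hfm p m)
    hfin
  filter_upwards [hae, hinc] with ω hω hi
  set T := (∑' p, ∑' m, f p m ω).toReal with hT
  have hT0 : 0 ≤ T := ENNReal.toReal_nonneg
  have hd : 0 ≤ d := (norm_nonneg _).trans (hi 0 0)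
  have hcube : ∀ p m, ‖Z m ((p + 1) ^ 3) ω‖ ≤ √T * r p ^ (3 / 4 : ℝ) := fun p m => by
    have h1 : f p m ω ≤ ∑' p, ∑' m, f p m ω :=
      (ENNReal.le_tsum m).trans (ENNReal.le_tsum (f := fun p => ∑' m, f p m ω) p)
    have h2 : r p ^ (-(3 / 2) : ℝ) * ‖Z m ((p + 1) ^ 3) ω‖ ^ 2 ≤ T :=
      (ENNReal.ofReal_le_iff_le_toReal hω.ne).1 h1
    have h3 : ‖Z m ((p + 1) ^ 3) ω‖ ^ 2 ≤ T * r p ^ (3 / 2 : ℝ) := by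
      rw [Real.rpow_neg (hr p).le, inv_mul_le_iff₀ (Real.rpow_pos_of_pos (hr p) _)] at h2
      linarith
    have h4 : √(T * r p ^ (3 / 2 : ℝ)) = √T * r p ^ (3 / 4 : ℝ) := by
      rw [Real.sqrt_mul hT0, Real.sqrt_eq_rpow (r p ^ _), ← Real.rpow_mul (hr p).le]
      norm_num
    rw [← h4]
    exact Real.le_sqrt_of_sq_le h3
  refine ⟨√T + 6 * d, fun n hn m => ?_⟩
  obtain ⟨p, hp1, hp2, hp3⟩ := Nat.exists_cube_le_lt hn
  obtain ⟨p, rfl⟩ : ∃ s, p = s + 1 := ⟨p - 1, by omega⟩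
  have hgap : ∀ k : ℕ, ‖Z m ((p + 1) ^ 3 + k) ω - Z m ((p + 1) ^ 3) ω‖ ≤ k * d := fun k => by
    induction k with
    | zero => simp
    | succ k ih =>
      have h1 := norm_add_le (Z m ((p + 1) ^ 3 + k + 1) ω - Z m ((p + 1) ^ 3 + k) ω)
        (Z m ((p + 1) ^ 3 + k) ω - Z m ((p + 1) ^ 3) ω)
      rw [sub_add_sub_cancel] at h1
      have h2 := hi m ((p + 1) ^ 3 + k)
      rw [← add_assoc]
      push_cast
      linarith
  have hg := hgap (n - (p + 1) ^ 3)
  rw [Nat.add_sub_cancel' hp1] at hg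
  have hrn : r p ≤ n := Nat.cast_le.2 hp1
  have hq : ((n - (p + 1) ^ 3 : ℕ) : ℝ) ≤ 6 * r p ^ (3 / 4 : ℝ) := by
    have h1 : n - (p + 1) ^ 3 ≤ 6 * (p + 1) ^ 2 := by
      have : (p + 1 + 1) ^ 3 = (p + 1) ^ 3 + 3 * (p + 1) ^ 2 + 3 * (p + 1) + 1 := by ring
      have : p + 1 ≤ (p + 1) ^ 2 := by nlinarith
      omega
    have h2 : ((n - (p + 1) ^ 3 : ℕ) : ℝ) ≤ 6 * ((p + 1 : ℕ) : ℝ) ^ 2 := by exact_mod_cast h1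
    refine h2.trans (mul_le_mul_of_nonneg_left ?_ (by norm_num))
    have h3 : r p ^ (3 / 4 : ℝ) = ((p + 1 : ℕ) : ℝ) ^ (9 / 4 : ℝ) := by
      have : r p = ((p + 1 : ℕ) : ℝ) ^ (3 : ℝ) := by
        rw [show (3 : ℝ) = (3 : ℕ) by norm_num, Real.rpow_natCast]
        push_cast [r]
        rfl
      rw [this, ← Real.rpow_mul (by positivity)]
      norm_num
    rw [h3, ← Real.rpow_natCast]
    exact Real.rpow_le_rpow_of_exponent_le (by push_cast; linarith [(Nat.cast_nonneg p : (0 : ℝ) ≤ p)])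
      (by norm_num)
  have hrr : r p ^ (3 / 4 : ℝ) ≤ (n : ℝ) ^ (3 / 4 : ℝ) :=
    Real.rpow_le_rpow (hr p).le hrn (by norm_num)
  have h5 : ‖Z m n ω‖ ≤ ‖Z m ((p + 1) ^ 3) ω‖ + ‖Z m n ω - Z m ((p + 1) ^ 3) ω‖ := by
    have := norm_add_le (Z m ((p + 1) ^ 3) ω) (Z m n ω - Z m ((p + 1) ^ 3) ω)
    rwa [add_sub_cancel] at this
  calc ‖Z m n ω‖ ≤ √T * r p ^ (3 / 4 : ℝ) + 6 * r p ^ (3 / 4 : ℝ) * d :=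
        h5.trans (add_le_add (hcube p m) (hg.trans (mul_le_mul_of_nonneg_right hq hd)))
    _ = (√T + 6 * d) * r p ^ (3 / 4 : ℝ) := by ring
    _ ≤ _ := by gcongr

/-! ### Rate of the empirical covariance on the Riesz vectors. -/

section

variable {Ω : Type*} [MeasurableSpace Ω] {P : Measure Ω} [IsProbabilityMeasure P]
  {B : Type*} [NormedAddCommGroup B] [NormedSpace ℝ B] [CompleteSpace B]
  [SecondCountableTopology B] [MeasurableSpace B] [BorelSpace B] (K : KuelbsSystem B)
  {ρ : B →L[ℝ] B} {ε X : ℤ → Ω → B} {R : ℝ}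

omit [CompleteSpace B] in
theorem inner_covOp_riesz (hx : Measurable (X 0)) (hR : ∀ᵐ ω ∂P, ‖X 0 ω‖ ≤ R) (m : ℕ) :
    ⟪covOp K P X (K.riesz m), K.riesz m⟫_ℝ = ∫ ω, K.F m (X 0 ω) ^ 2 ∂P := by
  rw [← covForm_eq K hx hR, covForm]
  simp_rw [sq]

/-- The second moment of `F m (X 0)` is at most a multiple of `t m` when the reproducing kernel
Hilbert space embeds continuously into the dual of `Htilde`. -/
theorem integral_F_sq_le {c : ℕ → ℝ} {φ : ℕ → K.Htilde} (hx : Measurable (X 0))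
    (hR : ∀ᵐ ω ∂P, ‖X 0 ω‖ ≤ R) (hC : IsSpectralSystem (covOp K P X) c φ) {M : ℝ≥0}
    (hdual : ∀ f : K.Htilde, rkhsNormSq c φ f < ⊤ → K.normDualSq f ≤ M * rkhsNormSq c φ f) (m : ℕ) :
    ∫ ω, K.F m (X 0 ω) ^ 2 ∂P ≤ M * K.t m := by
  rw [← inner_covOp_riesz K hx hR]
  -- For this `f` both the squared norm in the reproducing kernel space and the value of `F m` are
  -- `q = E[F m (X 0)²]`. The embedding thus gives `q² / t m ≤ M q`.
  set f := covOp K P X (K.riesz m) with hf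
  set q := ⟪f, K.riesz m⟫_ℝ with hq
  have hs : HasSum (fun j => c j * ⟪K.riesz m, φ j⟫_ℝ ^ 2) q := by
    have h := HasSum.inner_apply_self hC.hasSum (K.riesz m) (K.riesz m)
    simp only [mul_assoc, ← sq] at h
    exact h
  have hq0 : 0 ≤ q := hs.nonneg fun j => mul_nonneg (hC.pos j).le (sq_nonneg _)
  have hmem : f ∈ (Submodule.span ℝ (Set.range φ)).topologicalClosure := by
    refine mem_closure_of_tendsto (hC.hasSum (K.riesz m)) (.of_forall fun s => ?_)
    exact Submodule.sum_mem _ fun j _ => Submodule.smul_mem _ _ (Submodule.subset_span ⟨j, rfl⟩)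
  have hfj : ∀ j, ⟪f, φ j⟫_ℝ = c j * ⟪K.riesz m, φ j⟫_ℝ := fun j => by
    rw [hf, covOp_symm K hx hR, HasSum.apply_eigenvector hC.orthonormal hC.hasSum,
      inner_smul_right]
  have hrk : rkhsNormSq c φ f = ENNReal.ofReal q := by
    rw [rkhsNormSq, if_pos hmem, ← hs.tsum_eq, ENNReal.ofReal_tsum_of_nonneg
      (fun j => mul_nonneg (hC.pos j).le (sq_nonneg _)) hs.summable]
    refine tsum_congr fun j => ?_
    rw [hfj]
    congr 1
    have := (hC.pos j).ne'
    field_simp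
  have h1 := hdual f (by rw [hrk]; exact ENNReal.ofReal_lt_top)
  obtain ⟨x, hxf⟩ := exists_emb_eq_covOp K hx hR (K.riesz m)
  have hFx : K.F m x = q := by
    rw [← K.inner_riesz_emb, hxf, hq, real_inner_comm]
  rw [hrk, hf, ← hxf, K.normDualSq_emb] at h1
  have h2 := (ENNReal.le_tsum (f := fun m => ENNReal.ofReal (K.F m x ^ 2 / K.t m)) m).trans h1
  rw [hFx, ← ENNReal.ofReal_coe_nnreal, ← ENNReal.ofReal_mul M.coe_nonneg,
    ENNReal.ofReal_le_ofReal_iff (mul_nonneg M.coe_nonneg hq0), div_le_iff₀ (K.t_pos m)] at h2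
  rcases hq0.eq_or_lt with h0 | h0
  · rw [← h0]
    exact mul_nonneg M.coe_nonneg (K.t_pos m).le
  · change q ^ 2 ≤ (M : ℝ) * q * K.t m at h2
    nlinarith

namespace IsStandardARB1

/-- For `J : B → H` of norm at most one, the sums of `F m (X i) • J (X i)`, centred, are almost
surely `O(n ^ (3 / 4))`, uniformly in `m`. -/
theorem ae_exists_norm_sum_smul_le (hX : IsStandardARB1 P ρ ε X)
    (hR : ∀ᵐ ω ∂P, ‖X 0 ω‖ ≤ R) {M : ℝ}
    (hM : ∀ m, ∫ ω, K.F m (X 0 ω) ^ 2 ∂P ≤ M * K.t m)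
    {H : Type*} [NormedAddCommGroup H] [InnerProductSpace ℝ H] [CompleteSpace H]
    (J : B →L[ℝ] H) (hJ : ∀ x, ‖J x‖ ≤ ‖x‖) :
    ∀ᵐ ω ∂P, ∃ L : ℝ, ∀ n : ℕ, 1 ≤ n → ∀ m,
      ‖∑ i ∈ Finset.range n, (K.F m (X i ω) • J (X i ω) - ∫ ω, K.F m (X 0 ω) • J (X 0 ω) ∂P)‖
        ≤ L * (n : ℝ) ^ (3 / 4 : ℝ) := by
  obtain ⟨j, hj, hρj⟩ := hX.contraction
  obtain ⟨A, a, hA, ha0, ha1, hpow⟩ := exists_norm_pow_le_geometric hj hρj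
  have hR0 : 0 ≤ R := by
    obtain ⟨ω, hω⟩ := hR.exists
    exact (norm_nonneg _).trans hω
  let β : ℕ → B →L[ℝ] B →L[ℝ] H := fun m =>
    (ContinuousLinearMap.lsmul ℝ ℝ).bilinearComp (K.F m) J
  have hβ : ∀ m x y, β m x y = K.F m x • J y := fun m x y => rfl
  have hβn : ∀ m x y, ‖β m x y‖ ≤ |K.F m x| * ‖y‖ := fun m x y => by
    rw [hβ, norm_smul, Real.norm_eq_abs]
    exact mul_le_mul_of_nonneg_left (hJ y) (abs_nonneg _)
  have hβR : ∀ m x, ‖x‖ ≤ R → ‖β m x x‖ ≤ R * R := fun m x hx =>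
    (hβn m x x).trans (mul_le_mul ((K.abs_F_le m x).trans hx) hx (norm_nonneg _) hR0)
  have hκR : ∀ m, ‖∫ ω, β m (X 0 ω) (X 0 ω) ∂P‖ ≤ R * R := fun m => by
    refine (norm_integral_le_of_norm_le_const (C := R * R) ?_).trans (by simp)
    filter_upwards [hR] with ω h using hβR m _ h
  have hall := ae_all_iff.2 (hX.ae_norm_le hR)
  let Z : ℕ → ℕ → Ω → H := fun m n ω =>
    ∑ i ∈ Finset.range n, (β m (X i ω) (X i ω) - ∫ ω, β m (X 0 ω) (X 0 ω) ∂P)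
  have hterm : ∀ m (i : ℤ) ω, ‖X i ω‖ ≤ R →
      ‖β m (X i ω) (X i ω) - ∫ ω, β m (X 0 ω) (X 0 ω) ∂P‖ ≤ 2 * (R * R) := fun m i ω h =>
    (norm_sub_le _ _).trans (by linarith [hβR m _ h, hκR m])
  have hZm : ∀ m n, AEStronglyMeasurable (Z m n) P := fun m n =>
    Finset.aestronglyMeasurable_fun_sum _ fun i _ =>
      ((Continuous.stronglyMeasurable (f := fun b => β m b b - ∫ ω, β m (X 0 ω) (X 0 ω) ∂P)
        (by fun_prop)).comp_measurable (hX.measurable i)).aestronglyMeasurable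
  -- The mean-square constants are proportional to `t m`, hence summable in `m`.
  refine ae_exists_forall_norm_le_rpow (P := P) (Z := Z)
    (b := fun m => 40 * ((A * R * (1 - a)⁻¹) ^ 2 + R ^ 2) * (M * K.t m)) (d := 2 * (R * R))
    ((K.t_sum.summable.mul_left M).mul_left _)
    hZm (fun m n => ?_)
    (fun m n => hX.integral_norm_sum_sq_le hR hA ha0 ha1 hpow (hβn m) (hM m) n) ?_
  · refine integrable_norm_sq (b := n * (2 * (R * R))) (hZm m n) ?_
    filter_upwards [hall] with ω h
    refine (norm_sum_le _ _).trans ((Finset.sum_le_card_nsmul _ _ (2 * (R * R))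
      fun (i : ℕ) _ => hterm m i ω (h i)).trans_eq ?_)
    rw [Finset.card_range, nsmul_eq_mul]
  · filter_upwards [hall] with ω h m n
    simp only [Z, Finset.sum_range_succ, add_sub_cancel_left]
    exact hterm m n ω (h n)

set_option maxSynthPendingDepth 5 in
/-- The almost sure rate of the empirical autocovariance operator on the vectors `riesz m`. -/
theorem ae_exists_norm_covOp_sub_riesz_le (hX : IsStandardARB1 P ρ ε X)
    (hR : ∀ᵐ ω ∂P, ‖X 0 ω‖ ≤ R) {M : ℝ}
    (hM : ∀ m, ∫ ω, K.F m (X 0 ω) ^ 2 ∂P ≤ M * K.t m) :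
    ∀ᵐ ω ∂P, ∃ L : ℝ, ∀ n : ℕ, 1 ≤ n → ∀ m,
      ‖(covOp K P X - empCovOp K X n ω) (K.riesz m)‖ ≤ L * (n : ℝ) ^ (-(1 / 4) : ℝ) := by
  have hκ : ∀ m, ∫ ω, K.F m (X 0 ω) • K.emb (X 0 ω) ∂P = covOp K P X (K.riesz m) := fun m => by
    rw [covOp, ContinuousLinearMap.integral_apply (integrable_rankOne K (hX.measurable 0) hR)]
    refine integral_congr_ae (.of_forall fun ω => ?_)
    dsimp only
    rw [InnerProductSpace.rankOne_apply, real_inner_comm, K.inner_riesz_emb]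
  filter_upwards [ae_exists_norm_sum_smul_le K hX hR hM K.emb K.norm_emb_le] with ω ⟨L, hL⟩
  refine ⟨L, fun n hn m => ?_⟩
  have hn' : (0 : ℝ) < n := by exact_mod_cast hn
  have h1 := hL n hn m
  rw [hκ, Finset.sum_sub_distrib, Finset.sum_const, Finset.card_range] at h1
  have e : (covOp K P X - empCovOp K X n ω) (K.riesz m) = -((n : ℝ)⁻¹ •
      (∑ i ∈ Finset.range n, K.F m (X i ω) • K.emb (X i ω) - n • covOp K P X (K.riesz m))) := by
    rw [sub_apply, empCovOp_apply]
    simp only [real_inner_comm (K.riesz m), K.inner_riesz_emb]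
    rw [smul_sub, ← Nat.cast_smul_eq_nsmul ℝ, inv_smul_smul₀ hn'.ne']
    abel
  rw [e, norm_neg, norm_smul, norm_inv, Real.norm_of_nonneg hn'.le]
  refine (mul_le_mul_of_nonneg_left h1 (by positivity)).trans_eq ?_
  have h2 : (n : ℝ) ^ (-(1 / 4) : ℝ) = (n : ℝ) ^ (3 / 4 : ℝ) * (n : ℝ)⁻¹ := by
    rw [← Real.rpow_neg_one, ← Real.rpow_add hn']
    norm_num
  rw [h2]
  ring

end IsStandardARB1

end

/-! ### Comparison of theoretical and empirical eigenelements. -/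

section Perturbation

variable {E : Type*} [NormedAddCommGroup E] [InnerProductSpace ℝ E]
  {T S : E →L[ℝ] E} {c d : ℕ → ℝ} {φ ψ : ℕ → E} {n j k : ℕ}

theorem abs_eigenvalue_sub_le [CompleteSpace E] (hT : IsSpectralSystem T c φ)
    (hS : IsEmpiricalSystem S n d ψ) (j : ℕ) : |c j - d j| ≤ ‖T - S‖ := by
  have h1 := eigenvalue_le_add_norm_sub hT.orthonormal hT.antitone hT.hasSum hS.orthonormal
    hS.antitone hS.nonneg hS.hasSum j
  have h2 := eigenvalue_le_add_norm_sub hS.orthonormal hS.antitone hS.hasSum hT.orthonormal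
    hT.antitone (fun j => (hT.pos j).le) hT.hasSum j
  rw [norm_sub_rev] at h2
  rw [abs_le]
  constructor <;> linarith

theorem half_le_eigenvalue [CompleteSpace E] (hT : IsSpectralSystem T c φ)
    (hS : IsEmpiricalSystem S n d ψ) (h : ‖T - S‖ ≤ c (k - 1) / 2) (hj : j < k) :
    c (k - 1) / 2 ≤ d j := by
  have h1 := (abs_le.1 (abs_eigenvalue_sub_le hT hS (k - 1))).2
  have h2 := hS.antitone (Nat.le_sub_one_of_lt hj)
  linarith

theorem inv_le_Lam (hc : ∀ j, c (j + 1) < c j) (hpos : ∀ j, 0 < c j) (hj : j < k) :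
    (c j)⁻¹ ≤ Lam c k :=
  le_trans (inv_anti₀ (sub_pos.2 (hc j)) (by linarith [hpos (j + 1)])) (inv_sub_le_Lam c hj)

/-- The residual is `(T - S) ψ_j - (c j - d j) ψ_j`, at most `2 ‖T - S‖` by Weyl's inequality. The
reciprocal of `Lam c k` serves as gap; it is below `c j` too, since `c j - c (j + 1) ≤ c j`. -/
theorem norm_sub_signAligned_le_Lam [CompleteSpace E] (hT : IsSpectralSystem T c φ)
    (hc : ∀ j, c (j + 1) < c j) (hS : IsEmpiricalSystem S n d ψ) (hj : j < k) :
    ‖ψ j - signAligned (ψ j) (φ j)‖ ≤ √2 * (Lam c k * (2 * ‖T - S‖)) := by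
  have hL : (c j)⁻¹ ≤ Lam c k := inv_le_Lam hc hT.pos hj
  have hL0 : 0 < Lam c k := (inv_pos.2 (hT.pos j)).trans_le hL
  have h := norm_sub_signAligned_le (j := j) hT.orthonormal hT.hasSum (inv_pos.2 hL0)
    (inv_le_of_inv_le₀ (hT.pos j) hL) (fun i hi => inv_Lam_le_abs_sub hc hj hi)
    (hS.orthonormal.1 j) (r := 2 * ‖T - S‖) (by
      have e : T (ψ j) - c j • ψ j = (T - S) (ψ j) - (c j - d j) • ψ j := by
        rw [sub_apply, hS.eigen, sub_smul]
        abel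
      have h1 := (T - S).le_opNorm (ψ j)
      have h2 := abs_eigenvalue_sub_le hT hS j
      rw [hS.orthonormal.1 j, mul_one] at h1
      rw [e]
      refine (norm_sub_le _ _).trans ?_
      rw [norm_smul, hS.orthonormal.1 j, mul_one, Real.norm_eq_abs]
      linarith)
  rwa [inv_inv] at h

/-- Here `p` is the orthogonal projection of `v` on the closed span of `φ`, which may be a proper
subspace. -/
theorem Orthonormal.exists_orthogonal_sub [CompleteSpace E] (hφ : Orthonormal ℝ φ) (v : E) :
    ∃ p, (∀ i, ⟪v - p, φ i⟫_ℝ = 0) ∧ HasSum (fun j => ⟪v, φ j⟫_ℝ ^ 2) (‖p‖ ^ 2) := by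
  have hs := hφ.summable_inner_sq v
  let f : lp (fun _ : ℕ => ℝ) 2 := ⟨fun j => ⟪v, φ j⟫_ℝ, by
    apply memℓp_gen
    simpa only [ENNReal.toReal_ofNat, Real.rpow_ofNat, Real.norm_eq_abs, sq_abs] using hs⟩
  have hp := hφ.orthogonalFamily.hasSum_linearIsometry f
  set p := hφ.orthogonalFamily.linearIsometry f with hpf
  have hp' : HasSum (fun j => ⟪v, φ j⟫_ℝ • φ j) p := by
    convert! hp using 2
  have hpi : ∀ i, ⟪p, φ i⟫_ℝ = ⟪v, φ i⟫_ℝ := fun i => by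
    have h1 := hp'.mapL (innerSL ℝ (φ i))
    have h2 := hasSum_single (f := fun j => innerSL ℝ (φ i) (⟪v, φ j⟫_ℝ • φ j)) i fun j hj => by
      simp [hφ.2 hj.symm]
    have h3 := h1.unique h2
    simp only [innerSL_apply_apply, inner_smul_right] at h3
    rw [real_inner_comm, h3]
    simp [hφ.1 i]
  refine ⟨p, fun i => by rw [inner_sub_left, hpi, sub_self], ?_⟩
  have h1 := hp'.mapL (innerSL ℝ p)
  simp only [innerSL_apply_apply, inner_smul_right, hpi, ← sq, real_inner_self_eq_norm_sq] at h1
  exact h1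

end Perturbation

/-! ### From bilinear forms to the norm of `B`. -/

section FormNorm

variable {B : Type*} [NormedAddCommGroup B] [NormedSpace ℝ B] (K : KuelbsSystem B)

theorem norm_apply_riesz_le {T : K.Htilde →L[ℝ] K.Htilde} {a : ℕ → ℕ → ℝ}
    (ha : ∀ l m, a l m = ⟪T (K.riesz l), K.riesz m⟫_ℝ) {r : ℝ} (hr : 0 ≤ r)
    (h : ∀ l m, |a l m| ≤ r) (l : ℕ) : ‖T (K.riesz l)‖ ≤ r :=
  K.norm_le_of_forall_abs_Fext_le hr fun m => by
    rw [← K.inner_riesz, real_inner_comm, ← ha]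
    exact h l m

theorem abs_le_toReal_formNorm {a : ℕ → ℕ → ℝ} (ha : formNorm a ≠ ⊤) (l m : ℕ) :
    |a l m| ≤ (formNorm a).toReal := by
  rw [← ENNReal.ofReal_le_iff_le_toReal ha, ← Real.norm_eq_abs, ofReal_norm]
  exact le_iSup₂ (f := fun l m => ‖a l m‖ₑ) l m

/-- The form of an operator that vanishes on the orthogonal complement of `φ` is bounded by
`N = supN K φ` times its operator norm. -/
theorem formNorm_le_supN_mul {T : K.Htilde →L[ℝ] K.Htilde}
    (hT : ∀ f g, ⟪T f, g⟫_ℝ = ⟪f, T g⟫_ℝ) {a : ℕ → ℕ → ℝ}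
    (ha : ∀ l m, a l m = ⟪T (K.riesz l), K.riesz m⟫_ℝ) {φ : ℕ → K.Htilde} {p : ℕ → K.Htilde}
    (hp : ∀ l, HasSum (fun j => ⟪K.riesz l, φ j⟫_ℝ ^ 2) (‖p l‖ ^ 2))
    (h0 : ∀ l, T (K.riesz l - p l) = 0) : formNorm a ≤ supN K φ * ‖T‖ₑ := by
  have hpN : ∀ l, ‖p l‖ₑ ^ 2 ≤ supN K φ := fun l => by
    refine le_trans (le_of_eq ?_) (le_iSup _ l)
    rw [← ofReal_norm, ← ENNReal.ofReal_pow (norm_nonneg _), ← (hp l).tsum_eq,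
      ENNReal.ofReal_tsum_of_nonneg (fun _ => sq_nonneg _) (hp l).summable]
    simp_rw [K.inner_riesz]
  refine iSup₂_le fun l m => ?_
  have h1 : a l m = ⟪T (p l), p m⟫_ℝ := by
    have e1 : T (K.riesz l) = T (p l) := sub_eq_zero.1 (by rw [← map_sub, h0])
    have e2 : T (K.riesz m) = T (p m) := sub_eq_zero.1 (by rw [← map_sub, h0])
    rw [ha, e1, hT, e2, ← hT]
  have h2 : ‖a l m‖ₑ ≤ ‖T‖ₑ * ‖p l‖ₑ * ‖p m‖ₑ := by
    rw [h1, ← ofReal_norm, ← ofReal_norm T, ← ofReal_norm (p l), ← ofReal_norm (p m),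
      ← ENNReal.ofReal_mul (norm_nonneg _), ← ENNReal.ofReal_mul (by positivity)]
    refine ENNReal.ofReal_le_ofReal ((norm_inner_le_norm _ _).trans ?_)
    exact mul_le_mul_of_nonneg_right (T.le_opNorm _) (norm_nonneg _)
  have h3 : ‖p l‖ₑ * ‖p m‖ₑ ≤ supN K φ := by
    rcases le_total ‖p l‖ₑ ‖p m‖ₑ with h | h
    · exact (mul_le_mul_left h _).trans (by rw [← sq]; exact hpN m)
    · exact (mul_le_mul_right h _).trans (by rw [← sq]; exact hpN l)
  rw [mul_assoc, mul_comm] at h2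
  exact h2.trans (mul_le_mul_left h3 _)

/-- Weyl's inequality is used twice: it keeps `d j` above half of `c (k - 1)`, which is the source
of the factor `2`, and it bounds `|c j - d j|`. -/
theorem normB_sub_signAligned_le {C D : K.Htilde →L[ℝ] K.Htilde}
    (hC : ∀ f g, ⟪C f, g⟫_ℝ = ⟪f, C g⟫_ℝ) (hD : ∀ f g, ⟪D f, g⟫_ℝ = ⟪f, D g⟫_ℝ)
    (hCB : ∀ f, ∃ x, K.emb x = C f) (hDB : ∀ f, ∃ x, K.emb x = D f)
    {c d : ℕ → ℝ} {φ ψ : ℕ → K.Htilde} {n j k : ℕ} (hCs : IsSpectralSystem C c φ)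
    (hDs : IsEmpiricalSystem D n d ψ) (hδ : ‖C - D‖ ≤ c (k - 1) / 2) (hj : j < k)
    {y : B} (hy : K.emb y = φ j) {α κ : ℝ} (hα : ∀ m, ‖(C - D) (K.riesz m)‖ ≤ α)
    (hκ : ∀ m, ‖C (K.riesz m)‖ ≤ κ) :
    K.normB (ψ j - signAligned (ψ j) (φ j)) ≤ ENNReal.ofReal
      (2 / c (k - 1) * (α + ‖ψ j - signAligned (ψ j) (φ j)‖ * κ + ‖y‖ * ‖C - D‖)) := by
  have hck := hCs.pos (k - 1)
  have hdj := half_le_eigenvalue hCs hDs hδ hj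
  have hα0 : 0 ≤ α := (norm_nonneg _).trans (hα 0)
  have hκ0 : 0 ≤ κ := (norm_nonneg _).trans (hκ 0)
  obtain ⟨x, hx, hxn⟩ := K.exists_emb_eq_sub_signAligned hC hD hCB hDB (by linarith)
    (HasSum.apply_eigenvector hCs.orthonormal hCs.hasSum j) (hDs.eigen j) (hDs.orthonormal.1 j)
    hy hα hκ
  refine (K.normB_le hx).trans ?_
  rw [← ofReal_norm]
  refine ENNReal.ofReal_le_ofReal (hxn.trans ?_)
  have h1 : (d j)⁻¹ ≤ 2 / c (k - 1) := by
    rw [← inv_div]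
    exact inv_anti₀ (by linarith) hdj
  have h2 := abs_eigenvalue_sub_le hCs hDs j
  gcongr

end FormNorm

/-! ### The kernel of the covariance, and consequences of the rate condition. -/

section

variable {Ω : Type*} [MeasurableSpace Ω] {P : Measure Ω} [IsProbabilityMeasure P]
  {B : Type*} [NormedAddCommGroup B] [NormedSpace ℝ B] [CompleteSpace B]
  [SecondCountableTopology B] [MeasurableSpace B] [BorelSpace B] (K : KuelbsSystem B)
  {ρ : B →L[ℝ] B} {ε X : ℤ → Ω → B} {R : ℝ} {c : ℕ → ℝ} {φ : ℕ → K.Htilde}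

theorem IsSpectralSystem.apply_eq_zero {E : Type*} [NormedAddCommGroup E] [InnerProductSpace ℝ E]
    {T : E →L[ℝ] E} {c : ℕ → ℝ} {φ : ℕ → E} (h : IsSpectralSystem T c φ) {w : E}
    (hw : ∀ i, ⟪w, φ i⟫_ℝ = 0) : T w = 0 := by
  have := h.hasSum w
  simp only [hw, mul_zero, zero_smul] at this
  exact this.unique hasSum_zero

-- If `C w = 0` then `E⟪X 0, w⟫² = ⟪C w, w⟫ = 0`, and stationarity carries this to every `i`. So the
-- empirical operators almost surely annihilate `w` as well.
omit [CompleteSpace B] in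
theorem IsStandardARB1.ae_inner_emb_eq_zero (hX : IsStandardARB1 P ρ ε X)
    (hR : ∀ᵐ ω ∂P, ‖X 0 ω‖ ≤ R) {w : K.Htilde} (hw : covOp K P X w = 0) (i : ℤ) :
    ∀ᵐ ω ∂P, ⟪K.emb (X i ω), w⟫_ℝ = 0 := by
  have h0 : ∀ᵐ ω ∂P, ⟪K.emb (X 0 ω), w⟫_ℝ = 0 := by
    have h1 := inner_covOp K (hX.measurable 0) hR w w
    rw [hw, inner_zero_left] at h1
    have hi : Integrable (fun ω => ⟪K.emb (X 0 ω), w⟫_ℝ * ⟪K.emb (X 0 ω), w⟫_ℝ) P :=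
      integrable_comp_of_norm_le (M := R * ‖w‖ * (R * ‖w‖)) (hX.measurable 0) hR
        (G := fun b => ⟪K.emb b, w⟫_ℝ * ⟪K.emb b, w⟫_ℝ) (by fun_prop) fun b hb => by
          have h := (norm_inner_le_norm (𝕜 := ℝ) (K.emb b) w).trans
            (mul_le_mul_of_nonneg_right ((K.norm_emb_le b).trans hb) (norm_nonneg _))
          rw [norm_mul]
          exact mul_le_mul h h (norm_nonneg _) ((norm_nonneg _).trans h)
    have h2 := (integral_eq_zero_iff_of_nonneg (fun ω => mul_self_nonneg _) hi).1 h1.symm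
    filter_upwards [h2] with ω h using mul_self_eq_zero.1 h
  have hm : MeasurableSet {b : B | ⟪K.emb b, w⟫_ℝ = 0} :=
    (isClosed_eq (by fun_prop) continuous_const).measurableSet
  have h3 := (ae_map_iff (hX.measurable 0).aemeasurable hm).2 h0
  rw [← hX.map_eq i] at h3
  exact (ae_map_iff (hX.measurable i).aemeasurable hm).1 h3

omit [CompleteSpace B] in
theorem formNorm_covForm_le (hx : Measurable (X 0)) (hR : ∀ᵐ ω ∂P, ‖X 0 ω‖ ≤ R)
    (hC : IsSpectralSystem (covOp K P X) c φ) :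
    formNorm (covForm K P X) ≤ supN K φ * ‖covOp K P X‖ₑ := by
  choose p hp0 hp using fun l => hC.orthonormal.exists_orthogonal_sub (K.riesz l)
  exact formNorm_le_supN_mul K (covOp_symm K hx hR) (covForm_eq K hx hR) hp
    fun l => hC.apply_eq_zero (hp0 l)

omit [CompleteSpace B] in
theorem IsStandardARB1.ae_formNorm_sub_le (hX : IsStandardARB1 P ρ ε X)
    (hR : ∀ᵐ ω ∂P, ‖X 0 ω‖ ≤ R) (hC : IsSpectralSystem (covOp K P X) c φ) :
    ∀ᵐ ω ∂P, ∀ n, formNorm (fun l m => covForm K P X l m - empCovForm K X n ω l m)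
      ≤ supN K φ * ‖covOp K P X - empCovOp K X n ω‖ₑ := by
  choose p hp0 hp using fun l => hC.orthonormal.exists_orthogonal_sub (K.riesz l)
  have hx := hX.measurable 0
  have hw : ∀ l, covOp K P X (K.riesz l - p l) = 0 := fun l => hC.apply_eq_zero (hp0 l)
  -- The null set may depend on the vector, so only the countably many defects `r_l - p_l` are used.
  have h := ae_all_iff.2 fun l => ae_all_iff.2 fun i => hX.ae_inner_emb_eq_zero K hR (hw l) i
  filter_upwards [h] with ω hω n
  refine formNorm_le_supN_mul K (fun f g => ?_) (fun l m => ?_) hp fun l => ?_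
  · rw [sub_apply, sub_apply, inner_sub_left, inner_sub_right, covOp_symm K hx hR, empCovOp_symm]
  · rw [covForm_eq K hx hR, empCovForm_eq, sub_apply, inner_sub_left]
  · rw [sub_apply, hw, empCovOp_apply]
    simp [hω l]

omit [CompleteSpace B] [SecondCountableTopology B] [MeasurableSpace B] [BorelSpace B] in
theorem abs_covForm_le (hR : ∀ᵐ ω ∂P, ‖X 0 ω‖ ≤ R) (l m : ℕ) : |covForm K P X l m| ≤ R * R := by
  rw [← Real.norm_eq_abs]
  refine (norm_integral_le_of_norm_le_const (C := R * R) ?_).trans (by simp)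
  filter_upwards [hR] with ω h
  rw [norm_mul]
  have h1 := fun m => (K.abs_F_le m (X 0 ω)).trans h
  exact mul_le_mul (h1 l) (h1 m) (abs_nonneg _) ((abs_nonneg _).trans (h1 l))

-- The norm of `B` is a supremum of the `|F m|`, hence at most the `ℓ²` norm of `H`; and each term
-- of the Hilbert–Schmidt sum is at most the whole.
omit [CompleteSpace B] [SecondCountableTopology B] [MeasurableSpace B] [BorelSpace B] in
theorem exists_norm_le_of_tsum_normHSq_lt_top (hpos : ∀ j, 0 < c j)
    (hHS : ∑' j, K.normHSq (√(c j) • φ j) < ⊤) {y : ℕ → B} (hy : ∀ j, K.emb (y j) = φ j) :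
    ∃ S : ℝ, 0 ≤ S ∧ ∀ j, ‖y j‖ ≤ S * (√(c j))⁻¹ := by
  refine ⟨√(∑' j, K.normHSq (√(c j) • φ j)).toReal, Real.sqrt_nonneg _, fun j => ?_⟩
  have hc := Real.sqrt_pos.2 (hpos j)
  have h1 : ‖√(c j) • y j‖ ≤ √(∑' j, K.normHSq (√(c j) • φ j)).toReal := by
    refine K.norm_le_of_forall_abs_F_le fun m => Real.le_sqrt_of_sq_le ?_
    rw [sq_abs, ← ENNReal.ofReal_le_iff_le_toReal hHS.ne]
    refine le_trans ?_ (ENNReal.le_tsum j)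
    rw [← hy, ← map_smul, K.normHSq_emb]
    exact ENNReal.le_tsum (f := fun m => ENNReal.ofReal (K.F m (√(c j) • y j) ^ 2)) m
  rw [norm_smul, Real.norm_of_nonneg hc.le, mul_comm] at h1
  rw [← div_eq_mul_inv, le_div_iff₀ hc]
  exact h1

/-- Consequences of the rate condition, with `x` the quotient of its two sides. -/
theorem rate_bounds {c c₀ l k Λ N x : ℝ} (hc : 0 < c) (hc₀ : c ≤ c₀) (hk : 1 ≤ k)
    (hΛ : c⁻¹ ≤ Λ) (hl : √(1 / N) ≤ l) (hN : 0 < N) (hx : x = c⁻¹ * √k * Λ * l) :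
    c⁻¹ * (Λ * l) ≤ x ∧ c⁻¹ * ((√c)⁻¹ * l) ≤ √c₀ * x ∧ c⁻¹ * N ^ (-(1 / 4) : ℝ) ≤ √x ∧
      l ≤ c * (c₀ * x) := by
  have hl0 : 0 ≤ l := (Real.sqrt_nonneg _).trans hl
  have hc₀' : 0 ≤ c₀ := hc.le.trans hc₀
  have hk1 : 1 ≤ √k := Real.one_le_sqrt.2 hk
  have hci : 0 < c⁻¹ := inv_pos.2 hc
  have hΛ0 : 0 < Λ := hci.trans_le hΛ
  have h1 : c⁻¹ * (Λ * l) ≤ x := by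
    rw [hx]
    have : c⁻¹ * (Λ * l) * 1 ≤ c⁻¹ * (Λ * l) * √k := by gcongr
    linarith
  have h2 : c⁻¹ * (c⁻¹ * l) ≤ x := le_trans (by gcongr) h1
  have hx0 : 0 ≤ x := le_trans (by positivity) h2
  have hsc : 0 < √c := Real.sqrt_pos.2 hc
  have hcc : √c * √c = c := Real.mul_self_sqrt hc.le
  refine ⟨h1, ?_, ?_, ?_⟩
  · calc c⁻¹ * ((√c)⁻¹ * l) = √c * (c⁻¹ * (c⁻¹ * l)) := by
          have : (√c)⁻¹ = √c * c⁻¹ := by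
            rw [eq_mul_inv_iff_mul_eq₀ hc.ne']
            nth_rw 2 [← hcc]
            field_simp
          rw [this]
          ring
      _ ≤ √c₀ * x := mul_le_mul (Real.sqrt_le_sqrt hc₀) h2 (by positivity) (Real.sqrt_nonneg _)
  -- After squaring, `c⁻² N^(-1/2) ≤ c⁻² l ≤ x`; so the weak rate `n^(-1/4)` is enough.
  · refine Real.le_sqrt_of_sq_le (le_trans ?_ h2)
    have h3 : (N ^ (-(1 / 4) : ℝ)) ^ 2 = √(1 / N) := by
      rw [Real.sqrt_eq_rpow, one_div N, Real.inv_rpow hN.le, ← Real.rpow_neg hN.le,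
        ← Real.rpow_natCast, ← Real.rpow_mul hN.le]
      norm_num
    rw [mul_pow, h3, sq, mul_assoc]
    gcongr
  · calc l = c * (c * (c⁻¹ * (c⁻¹ * l))) := by field_simp
      _ ≤ c * (c₀ * x) := by gcongr

theorem exists_tendsto_rate_bounds {c : ℕ → ℝ} (hpos : ∀ j, 0 < c j) (hanti : Antitone c)
    (hc : ∀ j, c (j + 1) < c j) {k : ℕ → ℕ} (hk : ∀ n, 2 ≤ n → 1 ≤ k n)
    (hrate : (fun n : ℕ => (c (k n - 1))⁻¹ * √(k n) * Lam c (k n))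
      =o[atTop] fun n : ℕ => √(n / Real.log n)) :
    ∃ x : ℕ → ℝ, Tendsto x atTop (𝓝 0) ∧ ∀ᶠ n : ℕ in atTop,
      (c (k n - 1))⁻¹ * (Lam c (k n) * √(Real.log n / n)) ≤ x n ∧
      (c (k n - 1))⁻¹ * ((√(c (k n - 1)))⁻¹ * √(Real.log n / n)) ≤ √(c 0) * x n ∧
      (c (k n - 1))⁻¹ * (n : ℝ) ^ (-(1 / 4) : ℝ) ≤ √(x n) ∧
      √(Real.log n / n) ≤ c (k n - 1) * (c 0 * x n) := by
  refine ⟨fun n => (c (k n - 1))⁻¹ * √(k n) * Lam c (k n) * √(Real.log n / n), ?_, ?_⟩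
  · refine hrate.tendsto_div_nhds_zero.congr fun n => ?_
    rw [div_eq_mul_inv, ← Real.sqrt_inv, inv_div]
  · filter_upwards [eventually_ge_atTop 3] with n hn
    have hkn := hk n (by omega)
    have hn0 : (0 : ℝ) < n := by positivity
    refine rate_bounds (hpos _) (hanti (Nat.zero_le _)) (by exact_mod_cast hkn)
      (inv_le_Lam hc hpos (Nat.sub_one_lt_of_lt hkn)) (Real.sqrt_le_sqrt ?_) hn0 rfl
    have h1 : 1 ≤ Real.log n := by
      rw [Real.le_log_iff_exp_le hn0]
      have : (3 : ℝ) ≤ n := by exact_mod_cast hn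
      linarith [Real.exp_one_lt_three]
    gcongr

omit [CompleteSpace B] [SecondCountableTopology B] [MeasurableSpace B] [BorelSpace B] in
/-- The bound of `sup_{j < k} ‖ψ j - signAligned (ψ j) (φ j)‖_B` through the forms `a` of `C - D` and
`b` of `C`. -/
theorem iSup_normB_sub_signAligned_le {C D : K.Htilde →L[ℝ] K.Htilde}
    (hC : ∀ f g, ⟪C f, g⟫_ℝ = ⟪f, C g⟫_ℝ) (hD : ∀ f g, ⟪D f, g⟫_ℝ = ⟪f, D g⟫_ℝ)
    (hCB : ∀ f, ∃ x, K.emb x = C f) (hDB : ∀ f, ∃ x, K.emb x = D f)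
    {d : ℕ → ℝ} {ψ : ℕ → K.Htilde} {n k : ℕ} (hCs : IsSpectralSystem C c φ)
    (hDs : IsEmpiricalSystem D n d ψ) (hδ : ‖C - D‖ ≤ c (k - 1) / 2)
    {y : ℕ → B} (hy : ∀ j, K.emb (y j) = φ j) {a b : ℕ → ℕ → ℝ}
    (ha : ∀ l m, a l m = ⟪(C - D) (K.riesz l), K.riesz m⟫_ℝ)
    (hb : ∀ l m, b l m = ⟪C (K.riesz l), K.riesz m⟫_ℝ) (hb' : formNorm b ≠ ⊤) :
    (⨆ j : Fin k, K.normB (ψ j - signAligned (ψ j) (φ j))) ≤ ENNReal.ofReal (2 / c (k - 1)) *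
      (formNorm a + (⨆ j : Fin k, ‖ψ j - signAligned (ψ j) (φ j)‖ₑ) * formNorm b
        + (⨆ j : Fin k, K.normB (φ j)) * hsNorm (C - D)) := by
  have h2c : 0 < 2 / c (k - 1) := div_pos two_pos (hCs.pos _)
  -- If the form is unbounded, the right-hand side is infinite, because its prefactor is positive.
  by_cases htop : formNorm a = ⊤
  · rw [htop, top_add, top_add, ENNReal.mul_top (ENNReal.ofReal_pos.2 h2c).ne']
    exact le_top
  refine iSup_le fun j => ?_
  refine (normB_sub_signAligned_le K hC hD hCB hDB hCs hDs hδ j.2 (hy j)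
    (norm_apply_riesz_le K ha ENNReal.toReal_nonneg (abs_le_toReal_formNorm htop))
    (norm_apply_riesz_le K hb ENNReal.toReal_nonneg (abs_le_toReal_formNorm hb'))).trans ?_
  rw [ENNReal.ofReal_mul h2c.le, ENNReal.ofReal_add (by positivity) (by positivity),
    ENNReal.ofReal_add (by positivity) (by positivity), ENNReal.ofReal_mul (norm_nonneg _),
    ENNReal.ofReal_mul (norm_nonneg _), ENNReal.ofReal_toReal htop, ENNReal.ofReal_toReal hb',
    ofReal_norm, ofReal_norm]
  refine mul_le_mul_right (add_le_add (add_le_add le_rfl (mul_le_mul_left ?_ _))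
    (mul_le_mul' ?_ ((ofReal_norm (C - D)).trans_le (enorm_le_hsNorm _)))) _
  · exact le_iSup (fun j : Fin k => ‖ψ j - signAligned (ψ j) (φ j)‖ₑ) j
  · refine le_trans (le_of_eq ?_) (le_iSup (fun j : Fin k => K.normB (φ j)) j)
    rw [← hy, K.normB_emb]

omit [CompleteSpace B] [SecondCountableTopology B] [MeasurableSpace B] [BorelSpace B] in
/-- The bound of `sup_{j < k} ‖ψ j - signAligned (ψ j) (φ j)‖_B` through the gaps of the
eigenvalues. -/
theorem iSup_normB_sub_signAligned_le_ofReal {C D : K.Htilde →L[ℝ] K.Htilde}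
    (hC : ∀ f g, ⟪C f, g⟫_ℝ = ⟪f, C g⟫_ℝ) (hD : ∀ f g, ⟪D f, g⟫_ℝ = ⟪f, D g⟫_ℝ)
    (hCB : ∀ f, ∃ x, K.emb x = C f) (hDB : ∀ f, ∃ x, K.emb x = D f)
    {d : ℕ → ℝ} {ψ : ℕ → K.Htilde} {n k : ℕ} (hCs : IsSpectralSystem C c φ)
    (hc : ∀ j, c (j + 1) < c j)
    (hDs : IsEmpiricalSystem D n d ψ) (hδ : ‖C - D‖ ≤ c (k - 1) / 2)
    {y : ℕ → B} (hy : ∀ j, K.emb (y j) = φ j) {S : ℝ} (hS0 : 0 ≤ S)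
    (hS : ∀ j, ‖y j‖ ≤ S * (√(c j))⁻¹) {α κ δ : ℝ} (hα : ∀ m, ‖(C - D) (K.riesz m)‖ ≤ α)
    (hκ : ∀ m, ‖C (K.riesz m)‖ ≤ κ) (hδ' : ‖C - D‖ ≤ δ) :
    (⨆ j : Fin k, K.normB (ψ j - signAligned (ψ j) (φ j))) ≤ ENNReal.ofReal (2 / c (k - 1) *
      (α + √2 * (Lam c k * (2 * δ)) * κ + S * (√(c (k - 1)))⁻¹ * δ)) := by
  refine iSup_le fun j => (normB_sub_signAligned_le K hC hD hCB hDB hCs hDs hδ j.2 (hy j)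
    hα hκ).trans (ENNReal.ofReal_le_ofReal ?_)
  have hcn := hCs.pos (k - 1)
  have hκ0 : 0 ≤ κ := (norm_nonneg _).trans (hκ 0)
  have hΛ : 0 ≤ Lam c k := (inv_nonneg.2 (hCs.pos j).le).trans (inv_le_Lam hc hCs.pos j.2)
  have h1 : ‖ψ j - signAligned (ψ j) (φ j)‖ ≤ √2 * (Lam c k * (2 * δ)) :=
    (norm_sub_signAligned_le_Lam hCs hc hDs j.2).trans (by gcongr)
  have h2 : ‖y j‖ ≤ S * (√(c (k - 1)))⁻¹ := (hS j).trans (mul_le_mul_of_nonneg_left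
    (inv_anti₀ (Real.sqrt_pos.2 hcn) (Real.sqrt_le_sqrt (hCs.antitone (Nat.le_sub_one_of_lt j.2))))
    hS0)
  gcongr

end

end

/-! ### Assembly of the two bounds and of the convergence. -/

set_option maxHeartbeats 400000 in
theorem lemma7 {Ω : Type*} [MeasurableSpace Ω] (P : Measure Ω) [IsProbabilityMeasure P]
    {B : Type*} [NormedAddCommGroup B] [NormedSpace ℝ B] [CompleteSpace B]
    [SecondCountableTopology B] [MeasurableSpace B] [BorelSpace B]
    (K : KuelbsSystem B)
    -- the process, and the spectral systems of its autocovariance operators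
    (ρ : B →L[ℝ] B) (ε X : ℤ → Ω → B) (hX : IsStandardARB1 P ρ ε X)
    (c : ℕ → ℝ) (φ : ℕ → K.Htilde) (hC : IsSpectralSystem (covOp K P X) c φ)
    (cn : ℕ → Ω → ℕ → ℝ) (φn : ℕ → Ω → ℕ → K.Htilde)
    (hCn : ∀ n, 2 ≤ n → ∀ᵐ ω ∂P, IsEmpiricalSystem (empCovOp K X n ω) n (cn n ω) (φn n ω))
    (k : ℕ → ℕ)
    -- bounded observations, one-dimensional eigenspaces
    (hbdd : ∃ R : ℝ, ∀ᵐ ω ∂P, ‖X 0 ω‖ ≤ R)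
    (hsimple : ∀ j,
      Module.finrank ℝ (Module.End.eigenspace (covOp K P X).toLinearMap (c j)) = 1)
    -- the truncation order
    (hk_pos : ∀ n, 2 ≤ n → 1 ≤ k n)
    (hk_eig : ∀ n, 2 ≤ n → ∀ᵐ ω ∂P, 0 < cn n ω (k n - 1))
    (hk_top : Tendsto k atTop atTop)
    (hk_div : Tendsto (fun n => (k n : ℝ) / n) atTop (𝓝 0))
    -- the autocorrelation operator is approximated by its truncated expansions
    (hρ : Tendsto
      (fun i : ℕ => ⨆ x ∈ Metric.closedBall (0 : B) 1,
        K.normB (K.emb (ρ x) - ∑ j ∈ Finset.range i, ⟪K.emb (ρ x), φ j⟫_ℝ • φ j))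
      atTop (𝓝 0))
    -- the reproducing kernel Hilbert space embeds continuously into the dual of `Htilde`
    (hdual : ∃ M : ℝ≥0, ∀ f : K.Htilde, rkhsNormSq c φ f < ⊤ →
      K.normDualSq f ≤ M * rkhsNormSq c φ f)
    -- its embedding into `H` is Hilbert–Schmidt (`√(c j) • φ j` is its orthonormal basis)
    (hHS : ∑' j, K.normHSq (√(c j) • φ j) < ⊤)
    -- the rate condition
    (hrate : (fun n : ℕ => (c (k n - 1))⁻¹ * √(k n) * Lam c (k n))
      =o[atTop] fun n : ℕ => √(n / Real.log n)) :
    -- the explicit bound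
    (∀ᵐ ω ∂P, ∀ᶠ n in atTop,
      (⨆ j : Fin (k n), K.normB (φn n ω j - signAligned (φn n ω j) (φ j)))
        ≤ ENNReal.ofReal (2 / c (k n - 1)) *
          (max (supN K φ) (supN K φ ^ (1 / 2 : ℝ)) *
              (‖covOp K P X - empCovOp K X n ω‖ₑ
                + 2 * max (‖covOp K P X‖ₑ ^ (1 / 2 : ℝ)) (‖empCovOp K X n ω‖ₑ ^ (1 / 2 : ℝ))
                  * (⨆ (l : ℕ) (m : ℕ), ‖K.Fext l (signAligned (φn n ω m) (φ m))‖ₑ)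
                  * ((k n : ℝ≥0∞) * 8 * ENNReal.ofReal (Lam c (k n)) ^ 2
                        * ‖empCovOp K X n ω - covOp K P X‖ₑ ^ 2
                      + ∑' m : ℕ, ‖φn n ω (k n + m)
                          - signAligned (φn n ω (k n + m)) (φ (k n + m))‖ₑ ^ 2) ^ (1 / 2 : ℝ))
            + (⨆ j : Fin (k n), ‖φn n ω j - signAligned (φn n ω j) (φ j)‖ₑ)
                * supN K φ * hsNorm (covOp K P X)
            + supV K φ * hsNorm (covOp K P X - empCovOp K X n ω))) ∧
    -- the same bound with `‖c - c_n‖_{B × B}`, `‖c‖_{B × B}` and `sup_{j ≤ k n} ‖φ j‖_B` in place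
    -- of their estimates through `N` and `V`
    (∀ᵐ ω ∂P, ∀ᶠ n in atTop,
      (⨆ j : Fin (k n), K.normB (φn n ω j - signAligned (φn n ω j) (φ j)))
        ≤ ENNReal.ofReal (2 / c (k n - 1)) *
          (formNorm (fun l m => covForm K P X l m - empCovForm K X n ω l m)
            + (⨆ j : Fin (k n), ‖φn n ω j - signAligned (φn n ω j) (φ j)‖ₑ)
                * formNorm (covForm K P X)
            + (⨆ j : Fin (k n), K.normB (φ j)) * hsNorm (covOp K P X - empCovOp K X n ω))) ∧
    -- almost sure uniform convergence in the norm of `B`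
    (∀ᵐ ω ∂P, Tendsto
      (fun n => ⨆ j : Fin (k n), K.normB (φn n ω j - signAligned (φn n ω j) (φ j)))
      atTop (𝓝 0)) := by
  obtain ⟨R, hR⟩ := hbdd
  obtain ⟨M, hM⟩ := hdual
  have hx := hX.measurable 0
  have hR0 : 0 ≤ R := by
    obtain ⟨ω, hω⟩ := hR.exists
    exact (norm_nonneg _).trans hω
  have hstrict := hC.strictAnti hsimple
  have hCsymm := covOp_symm K hx hR
  -- The eigenvectors lie in `B`, since `C` takes values there and `c j ≠ 0`.
  have hy : ∀ j, ∃ y, K.emb y = φ j := fun j => by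
    obtain ⟨x, hxj⟩ := exists_emb_eq_covOp K hx hR (φ j)
    refine ⟨(c j)⁻¹ • x, ?_⟩
    rw [map_smul, hxj, HasSum.apply_eigenvector hC.orthonormal hC.hasSum,
      inv_smul_smul₀ (hC.pos j).ne']
  choose y hy using hy
  obtain ⟨S, hS0, hS⟩ := exists_norm_le_of_tsum_normHSq_lt_top K hC.pos hHS hy
  obtain ⟨L, hL⟩ := hX.ae_eventually_norm_covOp_sub_le K hR
  have hrieszRate := hX.ae_exists_norm_covOp_sub_riesz_le K hR
    (fun m => integral_F_sq_le K hx hR hC hM m)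
  have hCn' : ∀ᵐ ω ∂P, ∀ n, 2 ≤ n → IsEmpiricalSystem (empCovOp K X n ω) n (cn n ω) (φn n ω) :=
    ae_all_iff.2 fun n => by
      by_cases hn : 2 ≤ n
      · filter_upwards [hCn n hn] with ω h using fun _ => h
      · exact .of_forall fun ω h => absurd h hn
  set l : ℕ → ℝ := fun n => √(Real.log n / n) with hl
  obtain ⟨x, hx0, hrates⟩ := exists_tendsto_rate_bounds hC.pos hC.antitone hstrict hk_pos hrate
  have hδ : ∀ᵐ ω ∂P, ∀ᶠ n in atTop,
      ‖covOp K P X - empCovOp K X n ω‖ ≤ |L| * l n ∧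
      ‖covOp K P X - empCovOp K X n ω‖ ≤ c (k n - 1) / 2 := by
    filter_upwards [hL] with ω hω
    have h0 : Tendsto (fun n => |L| * (c 0 * x n)) atTop (𝓝 0) := by
      simpa using (hx0.const_mul (c 0)).const_mul |L|
    -- The last of the rate bounds makes `√(log n / n)` negligible against `c (k n - 1)`, so that
    -- the smallest of the empirical eigenvalues involved is eventually at least half of its limit
    -- counterpart.
    filter_upwards [hω, hrates, h0.eventually_le_const (by norm_num : (0 : ℝ) < 1 / 2)]
      with n h1 ⟨_, _, _, h2⟩ h3
    have h4 : ‖covOp K P X - empCovOp K X n ω‖ ≤ |L| * l n :=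
      h1.trans (mul_le_mul_of_nonneg_right (le_abs_self L) (Real.sqrt_nonneg _))
    refine ⟨h4, h4.trans ((mul_le_mul_of_nonneg_left h2 (abs_nonneg L)).trans ?_)⟩
    have h5 := mul_le_mul_of_nonneg_left h3 (hC.pos (k n - 1)).le
    linarith
  have hformC : formNorm (covForm K P X) ≠ ⊤ := by
    refine ne_top_of_le_ne_top (ENNReal.ofReal_ne_top (r := R * R)) (iSup₂_le fun l m => ?_)
    rw [← ofReal_norm]
    exact ENNReal.ofReal_le_ofReal (abs_covForm_le K hR l m)
  have second : ∀ᵐ ω ∂P, ∀ᶠ n in atTop,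
      (⨆ j : Fin (k n), K.normB (φn n ω j - signAligned (φn n ω j) (φ j)))
        ≤ ENNReal.ofReal (2 / c (k n - 1)) *
          (formNorm (fun l m => covForm K P X l m - empCovForm K X n ω l m)
            + (⨆ j : Fin (k n), ‖φn n ω j - signAligned (φn n ω j) (φ j)‖ₑ)
                * formNorm (covForm K P X)
            + (⨆ j : Fin (k n), K.normB (φ j)) * hsNorm (covOp K P X - empCovOp K X n ω)) := by
    filter_upwards [hδ, hCn'] with ω hω hD
    filter_upwards [hω, eventually_ge_atTop 2] with n ⟨_, hδn⟩ hn
    exact iSup_normB_sub_signAligned_le K hCsymm (empCovOp_symm K n ω) (exists_emb_eq_covOp K hx hR)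
      (exists_emb_eq_empCovOp K n ω) hC (hD n hn) hδn hy
      (fun l m => by rw [covForm_eq K hx hR, empCovForm_eq, sub_apply, inner_sub_left])
      (covForm_eq K hx hR) hformC
  refine ⟨?_, second, ?_⟩
  · filter_upwards [second, hX.ae_formNorm_sub_le K hR hC] with ω hω hform
    filter_upwards [hω] with n hn
    refine hn.trans (mul_le_mul_right (add_le_add (add_le_add ?_ ?_) ?_) _)
    -- `N * ‖C - C_n‖` already dominates the form norm; the remaining summand of the bracket is
    -- nonnegative and only enlarges the bound.
    · exact (hform n).trans (mul_le_mul' (le_max_left _ _) le_self_add)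
    · rw [mul_assoc]
      exact mul_le_mul_right ((formNorm_covForm_le K hx hR hC).trans
        (mul_le_mul_right (enorm_le_hsNorm _) _)) _
    · exact mul_le_mul_left (iSup_le fun j : Fin (k n) => le_iSup (fun j : ℕ => K.normB (φ j)) j) _
  · filter_upwards [hδ, hCn', hrieszRate] with ω hω hD ⟨L', hL'⟩
    -- The three summands belong to `(C - C_n) ψ`, to `C (ψ - φ')` and to the eigenvalue error times
    -- `‖φ_j‖_B`, in this order.
    have hlim : Tendsto (fun n => ENNReal.ofReal (2 * (|L'| * √(x n)
        + √2 * 2 * (R * R) * |L| * x n + S * |L| * (√(c 0) * x n)))) atTop (𝓝 0) := by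
      have h1 : Tendsto (fun n => √(x n)) atTop (𝓝 0) := by
        have h := (Real.continuous_sqrt.tendsto 0).comp hx0
        rwa [Real.sqrt_zero] at h
      have h2 := (((h1.const_mul |L'|).add (hx0.const_mul (√2 * 2 * (R * R) * |L|))).add
        ((hx0.const_mul √(c 0)).const_mul (S * |L|))).const_mul 2
      simpa using ENNReal.tendsto_ofReal h2
    refine tendsto_of_tendsto_of_tendsto_of_le_of_le' tendsto_const_nhds hlim
      (.of_forall fun _ => zero_le) ?_
    filter_upwards [hω, hrates, eventually_ge_atTop 2] with n ⟨hδ1, hδ2⟩ ⟨r1, r2, r3, _⟩ hn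
    refine (iSup_normB_sub_signAligned_le_ofReal K hCsymm (empCovOp_symm K n ω)
      (exists_emb_eq_covOp K hx hR) (exists_emb_eq_empCovOp K n ω) hC hstrict (hD n hn) hδ2 hy hS0 hS
      (fun m => (hL' n (by omega) m).trans
        (mul_le_mul_of_nonneg_right (le_abs_self L') (Real.rpow_nonneg n.cast_nonneg _)))
      (norm_apply_riesz_le K (covForm_eq K hx hR) (mul_nonneg hR0 hR0)
        (abs_covForm_le K hR)) hδ1).trans (ENNReal.ofReal_le_ofReal ?_)
    calc _ = 2 * (|L'| * ((c (k n - 1))⁻¹ * (n : ℝ) ^ (-(1 / 4) : ℝ))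
          + √2 * 2 * (R * R) * |L| * ((c (k n - 1))⁻¹ * (Lam c (k n) * l n))
          + S * |L| * ((c (k n - 1))⁻¹ * ((√(c (k n - 1)))⁻¹ * l n))) := by ring
      _ ≤ _ := by gcongr
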